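/- Work over $\mathbb{C}$. Let $n\ge 0$, let $V$ be a complex vector space of dimension $2n+1$ with a non-degenerate quadratic form $Q$ and associated symmetric bilinear form $\langle\,,\rangle_Q$. Let $\mathfrak g_1\subset\mathfrak{sl}(V)$ be the space of traceless endomorphisms that are self-adjoint for $\langle\,,\rangle_Q$, and $\mathcal N_1\subset\mathfrak g_1$ the subset of nilpotent elements. For a partition $\lambda$ of $2n+1$ let $\mathcal O_\lambda\subset\mathcal N_1$ be the set (an $SO(V,Q)$-orbit) of those $x$ whose Jordan blocks have sizes $\lambda_1,\lambda_2,\dots$. Let $\mathcal B_K$ be the variety of complete flags $0=V_0\subset V_1\subset\cdots\subset V_{2n+1}=V$, $\dim V_i=i$, with $V_{2n+1-i}=V_i^\perp$ for all $i$, and let $$\pi:\{(x,(V_i))\in\mathcal N_1\times\mathcal B_K \mid xV_i\subset V_{i-1},\ 1\le i\le 2n+1\}\to\mathcal N_1,\qquad (x,(V_i))\mapsto x .$$ Let $p_1\ge p_2\ge\cdots\ge p_s\ge 0$ be integers with $s\ge 1$ and $p_1+\cdots+p_s=n$, let $\lambda=(2p_1+1,2p_2,\dots,2p_s)$ and let $x\in\mathcal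 O_\lambda$. Then $2\dim\pi^{-1}(x)+\dim\mathcal O_\lambda=\dim\mathcal N_1$, that is, the irreducible components of $\pi^{-1}(x)$ of top dimension have dimension $\tfrac12\operatorname{codim}_{\mathcal N_1}\mathcal O_\lambda$. Moreover, if $I_1,\dots,I_k$ are these components of top dimension, then the (reduced) variety $\bigcup_{i=1}^k I_i$ is isomorphic, as an algebraic variety, to the Springer fibre of any nilpotent $x'\in\mathfrak{gl}(n)$ whose Jordan blocks have sizes $p_1,\dots,p_s$, that is, to the variety of complete flags $0=F_0\subset F_1\subset\cdots\subset F_n=\mathbb C^n$, $\dim F_i=i$, with $x'F_i\subset F_{i-1}$ for $1\le i\le n$. -/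

import Mathlib

namespace SymSpringer

open Module

noncomputable section

/-! ### Zariski topology and regular functions -/

/-- The polynomial functions on a complex vector space `M`: the algebra of functions `M → ℂ`
generated by the linear functionals. -/
def polyFun (M : Type*) [AddCommGroup M] [Module ℂ M] : Subalgebra ℂ (M → ℂ) :=
  Algebra.adjoin ℂ (Set.range fun φ : Dual ℂ M => (φ : M → ℂ))

/-- The Zariski topology on a complex vector space `M`; the principal open sets `{P ≠ 0}` form a
basis of it. -/
abbrev zariski (M : Type*) [AddCommGroup M] [Module ℂ M] : TopologicalSpace M :=
  TopologicalSpace.generateFrom {U | ∃ P ∈ polyFun M, U = {v | P v ≠ 0}}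

/-- The (Krull) dimension of a subset `S` of a complex vector space `M`, for the topology on `S`
induced by the Zariski topology of `M`. -/
def zariskiDim {M : Type*} [AddCommGroup M] [Module ℂ M] (S : Set M) : WithBot ℕ∞ :=
  @topologicalKrullDim S (@instTopologicalSpaceSubtype M (fun v => v ∈ S) (zariski M))

/-! ### The variety of complete flags -/

/-- Complete flags `0 = V_0 ⊂ V_1 ⊂ ⋯ ⊂ V_N`, `dim V_i = i`, in a complex vector space `V`
(used with `dim V = N`, so that `V_N = V`). -/
@[ext]
structure CompleteFlag (N : ℕ) (V : Type*) [AddCommGroup V] [Module ℂ V] where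
  /-- The subspace `V_i`. -/
  sub : Fin (N + 1) → Submodule ℂ V
  mono : Monotone sub
  finrank_sub : ∀ i, finrank ℂ (sub i) = i

section Flags

variable {N : ℕ} {V : Type*} [AddCommGroup V] [Module ℂ V]

theorem finrank_basis_flag (b : Basis (Fin N) ℂ V) (k : Fin (N + 1)) :
    finrank ℂ (b.flag k) = k := by
  have hli : LinearIndependent ℂ fun i : {i : Fin N // i.castSucc < k} => b i :=
    b.linearIndependent.comp _ Subtype.val_injective
  have h : b.flag k
      = Submodule.span ℂ (Set.range fun i : {i : Fin N // i.castSucc < k} => b i) := by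
    rw [Basis.flag, Set.image_eq_range]
    rfl
  rw [h, finrank_span_eq_card hli, Fintype.card_subtype]
  have hk : (k : ℕ) ≤ N := Nat.lt_succ_iff.mp k.2
  have : (Finset.univ.filter fun i : Fin N => i.castSucc < k).card
      = (Finset.univ.filter fun i : Fin N => (i : ℕ) < (k : ℕ)).card := rfl
  rw [this, Fin.card_filter_val_lt]
  omega

/-- The complete flag spanned by an ordered basis (frame) of `V`. -/
def CompleteFlag.ofBasis (b : Basis (Fin N) ℂ V) : CompleteFlag N V where
  sub := b.flag
  mono := b.flag_mono
  finrank_sub := finrank_basis_flag b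

/-- The Zariski topology on the flag variety `GL_N / (Borel subgroup)`: the quotient topology of
the Zariski topology on the set of frames, which is an open subset of the vector space `V ^ N`. -/
instance : TopologicalSpace (CompleteFlag N V) :=
  TopologicalSpace.coinduced CompleteFlag.ofBasis
    (TopologicalSpace.induced (fun b : Basis (Fin N) ℂ V => (b : Fin N → V)) (zariski (Fin N → V)))

/-- `g` is a regular function on the subset `U` of the flag variety (used for open `U`): its
pull-back to the frames is, near every frame whose flag is in `U`, a quotient of polynomials in the
frame. -/
def IsRegularOn (g : CompleteFlag N V → ℂ) (U : Set (CompleteFlag N V)) : Prop :=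
  ∀ b : Basis (Fin N) ℂ V, CompleteFlag.ofBasis b ∈ U →
    ∃ P ∈ polyFun (Fin N → V), ∃ D ∈ polyFun (Fin N → V), D b ≠ 0 ∧
      ∀ b' : Basis (Fin N) ℂ V, D b' ≠ 0 → g (CompleteFlag.ofBasis b') = P b' / D b'

/-- A function `f` on a subvariety `X` of the flag variety (with its reduced structure) is regular
at `F ∈ X` if near `F` it is the restriction of a regular function on an open subset of the flag
variety. -/
def IsRegularAt {X : Set (CompleteFlag N V)} (f : X → ℂ) (F : X) : Prop :=
  ∃ U : Set (CompleteFlag N V), IsOpen U ∧ (F : CompleteFlag N V) ∈ U ∧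
    ∃ g : CompleteFlag N V → ℂ, IsRegularOn g U ∧
      ∀ F' : X, (F' : CompleteFlag N V) ∈ U → f F' = g F'

/-- Isomorphism of (reduced) algebraic varieties between subvarieties `X`, `Y` of flag varieties:
a homeomorphism for the Zariski topologies that identifies the sheaves of regular functions. -/
def IsIsomorphic {N' : ℕ} {W : Type*} [AddCommGroup W] [Module ℂ W]
    (X : Set (CompleteFlag N V)) (Y : Set (CompleteFlag N' W)) : Prop :=
  ∃ φ : X ≃ₜ Y, ∀ (f : Y → ℂ) (F : X), IsRegularAt f (φ F) ↔ IsRegularAt (f ∘ φ) F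

/-- The union of the irreducible components of maximal dimension of a subvariety `X` of the flag
variety. -/
def topComponentsUnion (X : Set (CompleteFlag N V)) : Set (CompleteFlag N V) :=
  Subtype.val '' ⋃₀ {Z ∈ irreducibleComponents X | topologicalKrullDim Z = topologicalKrullDim X}

/-- The Springer fibre of a nilpotent `x ∈ gl(V)`: complete flags with `x V_i ⊆ V_{i-1}` for
`1 ≤ i ≤ N`. -/
def springerFiber (N : ℕ) (x : End ℂ V) : Set (CompleteFlag N V) :=
  {F | ∀ i : Fin N, (F.sub i.succ).map x ≤ F.sub i.castSucc}

/-! ### The symmetric pair `(SL(V), SO(V, B))` -/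

/-- The nilpotent endomorphism `x` has Jordan blocks of sizes `lam 0, lam 1, …` (zeros allowed and
ignored): there is a Jordan basis. -/
def HasJordanType {s : ℕ} (x : End ℂ V) (lam : Fin s → ℕ) : Prop :=
  ∃ b : Basis (Σ i, Fin (lam i)) ℂ V, ∀ (i : Fin s) (a : Fin (lam i)),
    x (b ⟨i, a⟩) = if h : (a : ℕ) + 1 < lam i then b ⟨i, ⟨a + 1, h⟩⟩ else 0

/-- `𝔤₁ ⊆ sl(V)`, the `(-1)`-eigenspace of the involution `θ x = -x*`, where `x*` is the adjoint
with respect to `B`: the traceless endomorphisms that are self-adjoint for `B`. -/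
def gOne (B : LinearMap.BilinForm ℂ V) : Set (End ℂ V) :=
  {x | LinearMap.trace ℂ V x = 0 ∧ ∀ v w, B (x v) w = B v (x w)}

/-- The nilpotent cone `𝒩₁ = 𝒩 ∩ 𝔤₁`. -/
def nilpotentCone (B : LinearMap.BilinForm ℂ V) : Set (End ℂ V) :=
  {x | x ∈ gOne B ∧ IsNilpotent x}

/-- The orbit `𝒪_lam ⊆ 𝒩₁`: the elements with Jordan blocks of sizes `lam`. -/
def nilpotentOrbit (B : LinearMap.BilinForm ℂ V) {s : ℕ} (lam : Fin s → ℕ) : Set (End ℂ V) :=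
  {x | x ∈ nilpotentCone B ∧ HasJordanType x lam}

/-- The flag variety of `SO(V, B)` for `N = 2n+1`: complete flags with `V_{N-i} = V_i^⊥`. -/
def isotropicFlags (N : ℕ) (B : LinearMap.BilinForm ℂ V) : Set (CompleteFlag N V) :=
  {F | ∀ i : Fin (N + 1), F.sub i.rev = B.orthogonal (F.sub i)}

/-- The resolution of the nilpotent cone `𝒩₁`: pairs `(x, (V_i))` with `x ∈ 𝒩₁`, `(V_i)` in the
flag variety of `SO(V, B)` and `x V_i ⊆ V_{i-1}` for `1 ≤ i ≤ N`. -/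
def resolution (N : ℕ) (B : LinearMap.BilinForm ℂ V) : Set (End ℂ V × CompleteFlag N V) :=
  {q | q.1 ∈ nilpotentCone B ∧ q.2 ∈ isotropicFlags N B ∧
    ∀ i : Fin N, (q.2.sub i.succ).map q.1 ≤ q.2.sub i.castSucc}

/-- The fibre `π⁻¹(x)` of `π : resolution → 𝒩₁`, `(x, (V_i)) ↦ x`, as a subvariety of the flag
variety. -/
def resolutionFiber (N : ℕ) (B : LinearMap.BilinForm ℂ V) (x : End ℂ V) :
    Set (CompleteFlag N V) :=
  {F | (x, F) ∈ resolution N B}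

/-- The partition `(2 p₁ + 1, 2 p₂, …, 2 p_{s+1})`. -/
def doubledPartition {s : ℕ} (p : Fin (s + 1) → ℕ) : Fin (s + 1) → ℕ :=
  fun i => if i = 0 then 2 * p i + 1 else 2 * p i

end Flags

end

end SymSpringer

/-!
# Springer fibres for symmetric pairs of type `(sl (2n+1), so (2n+1))`

**Upper bound for the fibre.** Flags near a given one have coordinates in the space of lower
unipotent matrices, so a closed irreducible set of flags in the fibre has a generic point: a flag of
`K ^ (2n+1)`, where `K` is a finitely generated extension of `ℂ`, with `dim Der_ℂ K` equal to the
dimension of the set. A derivation of `K`, acting on coordinates, is a connection on `K ^ (2n+1)`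
preserving `x` and the form `B`, and only the zero derivation preserves the generic flag
(`derivation_eq_zero_of_coordDer`). The first line `K v` of the flag lies in `ker x`. If `j` is the
depth of `v`, the connections that do not preserve `K v` move it inside `ker x ∩ im x ^ j`, and the
others descend to `v^⊥ / v`. The numbers `kerRank x j = dim (ker x ∩ im x ^ j)` change in a
controlled way from `V` to `v^⊥ / v`, and induction gives twice the dimension `≤ pairCount x`. When
the partition of `x` is `(2 p₁ + 1, 2 p₂, …)`, equality forces the middle space `V_n` to contain the
*core space* `∑ k, (im x ^ k ∩ ker x ^ k)` (`two_mul_finrank_le_pairCount`,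
`topologicalKrullDim_le_of_subset_resolutionFiber`). So every other closed irreducible set of flags
in the fibre has dimension less than `pairCount x / 2`.

**The flags through the core space.** For this partition the core space is a maximal isotropic
subspace, of dimension `n`, and `x` acts on it with Jordan type `p`. A flag with `V_n` equal to
the core space and `V_{2n+1-i} = V_i^⊥` is determined by its part below `V_n`, which is any flag in
the Springer fibre of `x'`. Both directions are polynomial in frames, so that this is an isomorphism
of varieties (`exists_coreFiber_homeomorph`).

**Lower bound for the Springer fibre.** Every flag in the Springer fibre of `x'` lies in the largest
member of a chain of `pairCount x' + 1` irreducible closed subsets (`exists_chain_springerFiber`).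
By induction the flags with the same first line contain such a chain; the line, in `im x' ^ j`, can
then be moved inside `ker x' ∩ im x' ^ j` by invertible operators that commute with `x'`, one
dimension at a time. As `pairCount x = 2 * pairCount x'` (`pairCount_eq_two_mul`), the components of
top dimension are exactly those that make up the flags through the core space
(`topologicalKrullDim_eq_and_sUnion_eq`, `fiber_dimension_and_components`).

**Dimensions of the orbits.** In an orthonormal basis the space of self-adjoint operators consists
of the symmetric matrices. At a generic point `y` of a set of nilpotent symmetric matrices any
derivation of `y` is a commutator `[y, ξ]` (`exists_commutator_eq_derivation`), because the ranks of
the powers of `y` are defined over `ℂ`. The commutators which are symmetric have a space of half the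
rank of `ad y` (`rank_adMatrix_eq`), and this bounds the dimension above. For the lower bound, the
orbit of `x₀` contains the conjugates by Cayley transforms of skew-symmetric matrices, and the
derivations killing the generic conjugate correspond to skew-symmetric matrices commuting with `x₀`
(`le_topologicalKrullDim_of_orthogonal_conj`). Hence the dimension of an orbit is half the rank of
`ad x`, and that of the nilpotent cone is the value for a single Jordan block. The commutant of `x`
has dimension `∑ (kerRank x k) ^ 2` (`finrank_commutant`), which makes the codimension of the orbit
equal to `pairCount x` (`exists_zariskiDim_nilpotentOrbit`, `zariskiDim_nilpotentCone`).
-/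

namespace SymSpringer
open Module MvPolynomial TopologicalSpace KaehlerDifferential

universe u

/-! ### Derivations and transcendence degree -/

/-- In characteristic zero the derivations of `K` over `L` form a `K`-vector space whose dimension
is the transcendence degree: `K` is formally étale over the polynomial ring of a transcendence
basis, so its Kähler differentials are free on the differentials of that basis. -/
theorem finrank_derivation {L K : Type*} [Field L] [Field K] [Algebra L K] [CharZero L]
    {ι : Type*} [Fintype ι] {x : ι → K} (hx : IsTranscendenceBasis L x) :
    Module.Finite K (Derivation L K K) ∧ finrank K (Derivation L K K) = Fintype.card ι := by
  let A := MvPolynomial ι L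
  let _ : Algebra A K := (MvPolynomial.aeval x).toAlgebra
  have hinj : Function.Injective (algebraMap A K) := hx.1
  let Q := FractionRing A
  have : FaithfulSMul A K := (faithfulSMul_iff_algebraMap_injective A K).mpr hinj
  let _ : Algebra Q K := FractionRing.liftAlgebra A K
  have : IsScalarTower A Q K := FractionRing.isScalarTower_liftAlgebra A K
  have : IsScalarTower L A K := IsScalarTower.of_algebraMap_eq' (by
    ext a; simp [RingHom.algebraMap_toAlgebra, A])
  have : CharZero Q := charZero_of_injective_algebraMap (algebraMap L Q).injective
  have : Algebra.IsAlgebraic A K := by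
    have h := hx.isAlgebraic
    refine Algebra.IsAlgebraic.of_ringHom_of_comp_eq
      (hx.1.aevalEquiv : A →+* Algebra.adjoin L (Set.range x))
      (RingHom.id K) hx.1.aevalEquiv.surjective Function.injective_id ?_
    ext a <;> simp [RingHom.algebraMap_toAlgebra, A]
  have : Algebra.IsAlgebraic Q K := by
    exact Algebra.IsAlgebraic.extendScalars (IsFractionRing.injective A Q)
  have : Algebra.FormallyEtale Q K := Algebra.FormallyEtale.of_isSeparable Q K
  have : Algebra.FormallyEtale A Q := Algebra.FormallyEtale.of_isLocalization (nonZeroDivisors A)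
  have : Algebra.FormallyEtale A K := Algebra.FormallyEtale.comp A Q K
  let b : Basis ι K (Ω[K⁄L]) :=
    ((mvPolynomialBasis L ι).baseChange K).map (tensorKaehlerEquivOfFormallyEtale L A K)
  have : Module.Finite K (Ω[K⁄L]) := Module.Finite.of_basis b
  have : Module.Free K (Ω[K⁄L]) := Module.Free.of_basis b
  let e := KaehlerDifferential.linearMapEquivDerivation L K (M := K)
  refine ⟨Module.Finite.equiv e, ?_⟩
  rw [← e.finrank_eq, Module.finrank_linearMap_self, Module.finrank_eq_card_basis b]

/-- The dimension of an affine domain is the transcendence degree of its fraction field: Noether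
normalization, with incomparability for `≤` and going up for `≥`. -/
theorem exists_ringKrullDim_eq_transcendenceBasis (A : Type*) [CommRing A] [IsDomain A]
    [Algebra ℂ A] [Algebra.FiniteType ℂ A] (K : Type*) [Field K] [Algebra A K] [IsFractionRing A K]
    [Algebra ℂ K] [IsScalarTower ℂ A K] :
    ∃ s : ℕ, ringKrullDim A = s ∧ ∃ x : Fin s → K, IsTranscendenceBasis ℂ x := by
  obtain ⟨s, g, hg, hint⟩ := exists_integral_inj_algHom_of_fg ℂ A
  let M := MvPolynomial (Fin s) ℂ
  let _ : Algebra M A := g.toAlgebra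
  have hinj : Function.Injective (algebraMap M A) := hg
  have : IsScalarTower ℂ M A := IsScalarTower.of_algebraMap_eq' (by
    ext a; simp [RingHom.algebraMap_toAlgebra, M])
  have : Algebra.IsIntegral M A := ⟨hint⟩
  have : FaithfulSMul M A := (faithfulSMul_iff_algebraMap_injective M A).mpr hinj
  refine ⟨s, le_antisymm ?_ ?_, fun i => algebraMap A K (g (MvPolynomial.X i)), ?_⟩
  · have h : ringKrullDim M = s := by
      rw [MvPolynomial.ringKrullDim_of_isNoetherianRing]; simp
    rw [← h]
    refine Order.krullDim_le_of_strictMono (PrimeSpectrum.comap (algebraMap M A)) ?_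
    intro p q hpq
    exact Ideal.IsIntegral.comap_lt_comap hpq
  · have h : ringKrullDim M = s := by
      rw [MvPolynomial.ringKrullDim_of_isNoetherianRing]; simp
    rw [← h]
    refine iSup_le fun l => ?_
    obtain ⟨P, hP⟩ := Ideal.nonempty_primesOver (S := A) l.head.asIdeal
    have := hP.1
    have := hP.2
    obtain ⟨l', hl', -⟩ := Ideal.exists_ltSeries_of_hasGoingUp l P
    rw [← hl']
    exact Order.LTSeries.length_le_krullDim l'
  · have hA : Algebra.IsAlgebraic A K := IsLocalization.isAlgebraic K (nonZeroDivisors A)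
    let _ : Algebra M K := ((algebraMap A K).comp g.toRingHom).toAlgebra
    have : IsScalarTower M A K := IsScalarTower.of_algebraMap_eq' rfl
    have : Algebra.IsAlgebraic M K := Algebra.IsAlgebraic.trans M A K
    have : IsScalarTower ℂ M K := IsScalarTower.of_algebraMap_eq' (by
      ext a; simp [RingHom.algebraMap_toAlgebra, M, IsScalarTower.algebraMap_apply ℂ A K])
    have : FaithfulSMul M K := (faithfulSMul_iff_algebraMap_injective M K).mpr
      ((IsFractionRing.injective A K).comp hg)
    exact (IsTranscendenceBasis.mvPolynomial (Fin s) ℂ).algebraMap_comp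

/-- A lower bound for the dimension of a subalgebra `A` of a field `K` of transcendence degree `κ`:
if the derivations of `K` that kill `A` span at most `z` dimensions, then `A` has dimension at least
`card κ - z`. These derivations are the `Frac A`-linear ones, so `z` bounds the transcendence degree
of `K` over `Frac A`. -/
theorem le_of_finrank_derivation_le {A : Type*} [CommRing A] [IsDomain A]
    [Algebra ℂ A] [Algebra.FiniteType ℂ A] {K : Type*} [Field K] [Algebra A K]
    (hinj : Function.Injective (algebraMap A K))
    [Algebra ℂ K] [IsScalarTower ℂ A K] {κ : Type*} [Fintype κ] {t : κ → K}
    (ht : IsTranscendenceBasis ℂ t) (S : Submodule K (Derivation ℂ K K))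
    (hS : ∀ D : Derivation ℂ K K, (∀ a : A, D (algebraMap A K a) = 0) → D ∈ S) {z : ℕ}
    (hz : finrank K S ≤ z) :
    ((Fintype.card κ : ℕ) : WithBot ℕ∞) ≤ ringKrullDim A + z := by
  let L := FractionRing A
  have : FaithfulSMul A K := (faithfulSMul_iff_algebraMap_injective A K).mpr hinj
  let _ : Algebra L K := FractionRing.liftAlgebra A K
  have : IsScalarTower A L K := FractionRing.isScalarTower_liftAlgebra A K
  have : IsScalarTower ℂ L K := IsScalarTower.of_algebraMap_eq fun a => by
    rw [IsScalarTower.algebraMap_apply ℂ A K, IsScalarTower.algebraMap_apply A L K,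
      IsScalarTower.algebraMap_apply ℂ A L]
  obtain ⟨s, hs, x, hx⟩ := exists_ringKrullDim_eq_transcendenceBasis A L
  obtain ⟨Y, hY⟩ := exists_isTranscendenceBasis L K
  have hsum := hx.sumElim_comp hY
  have e := hsum.lift_cardinalMk_eq ht
  have : Finite (↑Y ⊕ Fin s) := by
    rw [← Cardinal.mk_lt_aleph0_iff, ← Cardinal.lift_lt_aleph0, e]
    simp
  have : Finite Y := Finite.of_injective (Sum.inl : Y → Y ⊕ Fin s) Sum.inl_injective
  have := Fintype.ofFinite Y
  have hcard : Nat.card Y + s = Fintype.card κ := by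
    have := congrArg Cardinal.toNat e
    simpa [Cardinal.toNat_lift] using this
  have : CharZero L := charZero_of_injective_algebraMap (algebraMap ℂ L).injective
  obtain ⟨hfin, hD⟩ := finrank_derivation hY
  replace hD : finrank K (Derivation L K K) = Nat.card Y := by rw [hD, Nat.card_eq_fintype_card]
  have := (finrank_derivation ht).1
  have hle : finrank K (Derivation L K K) ≤ finrank K S := by
    let f : Derivation L K K →ₗ[K] S :=
      { toFun := fun D => ⟨D.restrictScalars ℂ, hS _ fun a => by
          rw [IsScalarTower.algebraMap_apply A L K]
          exact D.map_algebraMap _⟩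
        map_add' := fun _ _ => rfl
        map_smul' := fun _ _ => rfl }
    refine LinearMap.finrank_le_finrank_of_injective (f := f) ?_
    intro D D' h
    ext a
    exact DFunLike.congr_fun (congrArg Subtype.val h) a
  rw [hs]
  have : Fintype.card κ ≤ s + z := by omega
  exact_mod_cast this

/-! ### The Zariski topology and polynomial maps -/

/-- The underlying set of a complex vector space, equipped with the Zariski topology. It is a type
synonym, as the spaces in question (`σ → ℂ` for instance) may carry another topology already. -/
def Zar (M : Type*) [AddCommGroup M] [Module ℂ M] : Type _ := M

instance (M : Type*) [AddCommGroup M] [Module ℂ M] : TopologicalSpace (Zar M) := zariski M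

section Zariski

variable {M M' : Type*} [AddCommGroup M] [Module ℂ M] [AddCommGroup M'] [Module ℂ M']

theorem isTopologicalBasis_zar :
    IsTopologicalBasis {U : Set (Zar M) | ∃ P ∈ polyFun M, U = {v : M | P v ≠ 0}} where
  exists_subset_inter := by
    rintro _ ⟨P, hP, rfl⟩ _ ⟨P', hP', rfl⟩ x hx
    refine ⟨_, ⟨P * P', mul_mem hP hP', rfl⟩, ?_, ?_⟩
    · exact mul_ne_zero hx.1 hx.2
    · intro v hv
      exact mul_ne_zero_iff.mp hv
  sUnion_eq := by
    refine Set.eq_univ_of_forall fun x => ⟨_, ⟨1, one_mem _, rfl⟩, ?_⟩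
    exact one_ne_zero (α := ℂ)
  eq_generateFrom := rfl

theorem zar_isOpen_iff {U : Set (Zar M)} :
    IsOpen U ↔ ∀ a ∈ U, ∃ P ∈ polyFun M, P a ≠ 0 ∧ ∀ v, P v ≠ 0 → v ∈ U := by
  rw [isTopologicalBasis_zar.isOpen_iff]
  constructor
  · intro h a ha
    obtain ⟨_, ⟨P, hP, rfl⟩, haP, hPU⟩ := h a ha
    exact ⟨P, hP, haP, fun v hv => hPU hv⟩
  · intro h a ha
    obtain ⟨P, hP, haP, hPU⟩ := h a ha
    exact ⟨_, ⟨P, hP, rfl⟩, haP, fun v hv => hPU v hv⟩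

theorem zar_isOpen_ne_zero {P : M → ℂ} (hP : P ∈ polyFun M) :
    IsOpen ({v : M | P v ≠ 0} : Set (Zar M)) :=
  (isTopologicalBasis_zar (M := M)).isOpen ⟨P, hP, rfl⟩

theorem zar_isClosed_eq_zero {P : M → ℂ} (hP : P ∈ polyFun M) :
    IsClosed ({v : M | P v = 0} : Set (Zar M)) := by
  rw [← isOpen_compl_iff]
  exact zar_isOpen_ne_zero (M := M) hP

theorem dual_mem_polyFun (φ : Dual ℂ M) : (φ : M → ℂ) ∈ polyFun M :=
  Algebra.subset_adjoin ⟨φ, rfl⟩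

theorem const_mem_polyFun (c : ℂ) : (fun _ => c) ∈ polyFun M :=
  (polyFun M).algebraMap_mem c

/-- A polynomial map between complex vector spaces: it pulls polynomial functions back to
polynomial functions. -/
def PolyMap (f : M → M') : Prop := ∀ P ∈ polyFun M', P ∘ f ∈ polyFun M

theorem PolyMap.of_dual {f : M → M'} (h : ∀ φ : Dual ℂ M', (fun v => φ (f v)) ∈ polyFun M) :
    PolyMap f := by
  intro P hP
  induction hP using Algebra.adjoin_induction with
  | mem x hx => obtain ⟨φ, rfl⟩ := hx; exact h φ
  | algebraMap r => exact (polyFun M).algebraMap_mem r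
  | add x y _ _ hx hy => exact add_mem hx hy
  | mul x y _ _ hx hy => exact mul_mem hx hy

theorem PolyMap.linear (f : M →ₗ[ℂ] M') : PolyMap f :=
  .of_dual fun φ => dual_mem_polyFun (φ ∘ₗ f)

theorem PolyMap.comp {M'' : Type*} [AddCommGroup M''] [Module ℂ M''] {g : M' → M''} {f : M → M'}
    (hg : PolyMap g) (hf : PolyMap f) : PolyMap (g ∘ f) :=
  fun P hP => hf _ (hg P hP)

theorem PolyMap.continuous {f : M → M'} (hf : PolyMap f) :
    @Continuous (Zar M) (Zar M') _ _ f := by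
  refine continuous_generateFrom_iff.mpr ?_
  rintro _ ⟨P, hP, rfl⟩
  exact zar_isOpen_ne_zero (M := M) (hf P hP)

theorem mem_polyFun_pi {σ : Type*} [Finite σ] {f : (σ → ℂ) → ℂ} :
    f ∈ polyFun (σ → ℂ) ↔ ∃ p : MvPolynomial σ ℂ, ∀ v, f v = aeval v p := by
  have := Fintype.ofFinite σ
  constructor
  · intro hf
    induction hf using Algebra.adjoin_induction with
    | mem x hx =>
      obtain ⟨φ, rfl⟩ := hx
      refine ⟨∑ i, C (φ (Pi.basisFun ℂ σ i)) * X i, fun v => ?_⟩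
      conv_lhs => rw [← (Pi.basisFun ℂ σ).sum_repr v]
      simp [mul_comm]
    | algebraMap r => exact ⟨C r, fun v => by simp⟩
    | add x y _ _ hx hy =>
      obtain ⟨p, hp⟩ := hx; obtain ⟨q, hq⟩ := hy
      exact ⟨p + q, fun v => by simp [hp, hq]⟩
    | mul x y _ _ hx hy =>
      obtain ⟨p, hp⟩ := hx; obtain ⟨q, hq⟩ := hy
      exact ⟨p * q, fun v => by simp [hp, hq]⟩
  · rintro ⟨p, hp⟩
    obtain rfl : f = fun v => aeval v p := funext hp
    clear hp
    induction p using MvPolynomial.induction_on with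
    | C a => simpa using const_mem_polyFun a
    | add p q hp hq =>
      simp only [map_add]
      exact add_mem hp hq
    | mul_X p i hp =>
      simp only [map_mul, aeval_X]
      exact mul_mem hp (dual_mem_polyFun (LinearMap.proj i : Dual ℂ (σ → ℂ)))

end Zariski

section Dimension

variable {σ : Type*} [Finite σ]

theorem zar_isIrreducible_vanishingIdeal {Z : Set (Zar (σ → ℂ))} (hZ : IsIrreducible Z) :
    (vanishingIdeal ℂ (Z : Set (σ → ℂ))).IsPrime := by
  refine ⟨?_, ?_⟩
  · obtain ⟨a, ha⟩ := hZ.1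
    intro h
    have : (1 : MvPolynomial σ ℂ) ∈ vanishingIdeal ℂ (Z : Set (σ → ℂ)) := by rw [h]; trivial
    simpa using this a ha
  · intro p q hpq
    by_contra! h
    obtain ⟨a, ha, hpa⟩ : ∃ a ∈ Z, aeval (R := ℂ) a p ≠ 0 := by
      by_contra! h'; exact h.1 h'
    obtain ⟨b, hb, hqb⟩ : ∃ a ∈ Z, aeval (R := ℂ) a q ≠ 0 := by
      by_contra! h'; exact h.2 h'
    obtain ⟨c, hc, hc'⟩ := hZ.2 {v : σ → ℂ | aeval v p ≠ 0} {v : σ → ℂ | aeval v q ≠ 0}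
      (zar_isOpen_ne_zero (mem_polyFun_pi.mpr ⟨p, fun _ => rfl⟩))
      (zar_isOpen_ne_zero (mem_polyFun_pi.mpr ⟨q, fun _ => rfl⟩)) ⟨a, ha, hpa⟩ ⟨b, hb, hqb⟩
    have := hpq c hc
    rw [map_mul] at this
    exact (mul_ne_zero hc'.1 hc'.2) this

theorem zar_closure_eq (Z : Set (Zar (σ → ℂ))) :
    closure Z = zeroLocus ℂ (vanishingIdeal ℂ (Z : Set (σ → ℂ))) := by
  apply Set.Subset.antisymm
  · refine closure_minimal (fun v hv p hp => hp v hv) ?_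
    have : (zeroLocus ℂ (vanishingIdeal ℂ (Z : Set (σ → ℂ))) : Set (σ → ℂ))
        = ⋂ p ∈ vanishingIdeal ℂ (Z : Set (σ → ℂ)), {v | aeval v p = 0} := by
      ext; simp
    rw [this]
    exact isClosed_biInter fun p _ =>
      zar_isClosed_eq_zero (mem_polyFun_pi.mpr ⟨p, fun _ => rfl⟩)
  · intro v hv
    by_contra hvZ
    obtain ⟨P, hP, hPv, hPZ⟩ := zar_isOpen_iff.mp isClosed_closure.isOpen_compl v hvZ
    obtain ⟨p, hp⟩ := mem_polyFun_pi.mp hP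
    refine hPv ((hp v).trans (hv p fun w hw => ?_))
    by_contra hpw
    exact hPZ w (fun h => hpw ((hp w).symm.trans h)) (subset_closure hw)

/-- A chain of irreducible closed subsets of `Z` gives a chain of primes containing the vanishing
ideal of `Z`. No closedness of `Z` is needed. -/
theorem topologicalKrullDim_le_ringKrullDim (Z : Set (Zar (σ → ℂ))) :
    topologicalKrullDim Z ≤
      ringKrullDim (MvPolynomial σ ℂ ⧸ vanishingIdeal ℂ (Z : Set (σ → ℂ))) := by
  rw [topologicalKrullDim, ringKrullDim_quotient, ← Order.krullDim_orderDual]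
  -- a closed subset of `Z` is recovered from its closure in the whole space
  have key : ∀ W : IrreducibleCloseds Z,
      closure (Subtype.val '' (W : Set Z)) ∩ Z = Subtype.val '' (W : Set Z) := by
    intro W
    have h := (W.isClosed.closure_eq ▸
      Topology.IsInducing.subtypeVal.closure_eq_preimage_closure_image (W : Set Z)).symm
    rw [Set.inter_comm, ← Subtype.image_preimage_coe]
    exact congrArg _ h
  let I : IrreducibleCloseds Z → Ideal (MvPolynomial σ ℂ) := fun W =>
    vanishingIdeal ℂ (Subtype.val '' (W : Set Z) : Set (Zar (σ → ℂ)))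
  have hI : ∀ W W', I W = I W' → W = W' := by
    intro W W' h
    have h1 : closure (Subtype.val '' (W : Set Z)) = closure (Subtype.val '' (W' : Set Z)) := by
      rw [zar_closure_eq, zar_closure_eq]
      exact congrArg _ h
    apply IrreducibleCloseds.ext
    exact Subtype.val_injective.image_injective (by rw [← key W, ← key W', h1])
  refine Order.krullDim_le_of_strictMono (fun W => OrderDual.toDual
    ⟨⟨I W, zar_isIrreducible_vanishingIdeal
      (W.isIrreducible.image _ continuous_subtype_val.continuousOn)⟩, ?_⟩) ?_
  · exact vanishingIdeal_anti_mono (Subtype.coe_image_subset _ _)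
  · refine Monotone.strictMono_of_injective ?_ ?_
    · intro W W' h
      exact vanishingIdeal_anti_mono (Set.image_mono h)
    · intro W W' h
      exact hI _ _ (congrArg (fun P => (OrderDual.ofDual P).1.asIdeal) h)

end Dimension

/-! ### Bounds for Krull dimensions by derivations -/

theorem isIrreducible_of_image_subtypeVal {X : Type*} [TopologicalSpace X] {S : Set X} {t : Set S}
    (h : IsIrreducible (Subtype.val '' t)) : IsIrreducible t := by
  refine ⟨h.1.of_image, ?_⟩
  rintro _ _ ⟨U, hU, rfl⟩ ⟨U', hU', rfl⟩ ⟨a, ha, ha'⟩ ⟨b, hb, hb'⟩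
  obtain ⟨_, ⟨c, hc, rfl⟩, hc'⟩ := h.2 U U' hU hU' ⟨a, ⟨a, ha, rfl⟩, ha'⟩ ⟨b, ⟨b, hb, rfl⟩, hb'⟩
  exact ⟨c, hc, hc'⟩

section Dimension

variable {σ : Type*} [Finite σ]

/-- An irreducible set has at most as many dimensions as there are independent derivations of its
function field. This is how dimensions are bounded from above. -/
theorem topologicalKrullDim_le_finrank_derivation (Z : Set (Zar (σ → ℂ)))
    (hZ : (vanishingIdeal ℂ (Z : Set (σ → ℂ))).IsPrime) :
    topologicalKrullDim Z ≤ (finrank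
      (FractionRing (MvPolynomial σ ℂ ⧸ vanishingIdeal ℂ (Z : Set (σ → ℂ))))
      (Derivation ℂ (FractionRing (MvPolynomial σ ℂ ⧸ vanishingIdeal ℂ (Z : Set (σ → ℂ))))
        (FractionRing (MvPolynomial σ ℂ ⧸ vanishingIdeal ℂ (Z : Set (σ → ℂ))))) : ℕ) := by
  refine (topologicalKrullDim_le_ringKrullDim Z).trans ?_
  obtain ⟨s, hs, x, hx⟩ := exists_ringKrullDim_eq_transcendenceBasis
    (MvPolynomial σ ℂ ⧸ vanishingIdeal ℂ (Z : Set (σ → ℂ)))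
    (FractionRing (MvPolynomial σ ℂ ⧸ vanishingIdeal ℂ (Z : Set (σ → ℂ))))
  rw [hs, (finrank_derivation hx).2]
  simp

/-- The nonempty principal open subsets of an irreducible variety are dense (Nullstellensatz). -/
theorem vanishingIdeal_zeroLocus_diff (q : Ideal (MvPolynomial σ ℂ)) [q.IsPrime]
    {h : MvPolynomial σ ℂ} (hq : h ∉ q) :
    vanishingIdeal ℂ {v ∈ zeroLocus ℂ q | aeval v h ≠ 0} = q := by
  apply le_antisymm
  · intro p hp
    have : p * h ∈ vanishingIdeal ℂ (zeroLocus ℂ q) := by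
      intro v hv
      rw [map_mul]
      by_cases hv' : aeval v h = 0
      · rw [hv', mul_zero]
      · rw [hp v ⟨hv, hv'⟩, zero_mul]
    rw [IsPrime.vanishingIdeal_zeroLocus] at this
    exact (Ideal.IsPrime.mem_or_mem ‹_› this).resolve_right hq
  · intro p hp v hv
    exact hv.1 p hp

theorem zar_isIrreducible_of_vanishingIdeal {Z : Set (Zar (σ → ℂ))}
    (hZ : (vanishingIdeal ℂ (Z : Set (σ → ℂ))).IsPrime) : IsIrreducible Z := by
  refine ⟨?_, ?_⟩
  · by_contra h
    rw [Set.not_nonempty_iff_eq_empty] at h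
    exact hZ.ne_top (h ▸ vanishingIdeal_empty)
  · rintro U U' hU hU' ⟨a, haZ, ha⟩ ⟨b, hbZ, hb⟩
    obtain ⟨P, hP, hPa, hPU⟩ := zar_isOpen_iff.mp hU a ha
    obtain ⟨P', hP', hPb, hPU'⟩ := zar_isOpen_iff.mp hU' b hb
    obtain ⟨p, hp⟩ := mem_polyFun_pi.mp hP
    obtain ⟨p', hp'⟩ := mem_polyFun_pi.mp hP'
    by_contra hne
    have : p * p' ∈ vanishingIdeal ℂ (Z : Set (σ → ℂ)) := by
      intro v hv
      by_contra hv'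
      rw [map_mul, mul_eq_zero, not_or] at hv'
      exact hne ⟨v, hv, hPU v fun h => hv'.1 ((hp v).symm.trans h),
        hPU' v fun h => hv'.2 ((hp' v).symm.trans h)⟩
    rcases hZ.mem_or_mem this with h | h
    · exact hPa ((hp a).trans (h a haZ))
    · exact hPb ((hp' b).trans (h b hbZ))

/-- A set that contains the principal open subset `h ≠ 0` of the zero locus of `P` has at least the
dimension of the coordinate ring of that open subset. -/
theorem ringKrullDim_away_le_topologicalKrullDim {T : Set (Zar (σ → ℂ))}
    (P : Ideal (MvPolynomial σ ℂ)) (h : MvPolynomial σ ℂ)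
    (hT : ∀ v ∈ zeroLocus ℂ P, aeval v h ≠ 0 → v ∈ T) :
    ringKrullDim (Localization.Away (Ideal.Quotient.mk P h)) ≤ topologicalKrullDim T := by
  let T' : Set (Zar (σ → ℂ)) := {v ∈ zeroLocus ℂ P | aeval v h ≠ 0}
  have hTT : T' ⊆ T := fun v hv => hT v hv.1 hv.2
  refine le_trans ?_ (Topology.IsInducing.topologicalKrullDim_le
    (Topology.IsEmbedding.inclusion hTT).isInducing)
  rw [ringKrullDim, ← Order.krullDim_orderDual]
  let S := Localization.Away (Ideal.Quotient.mk P h)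
  let f : MvPolynomial σ ℂ →+* S := (algebraMap _ S).comp (Ideal.Quotient.mk P)
  let I : PrimeSpectrum S → Ideal (MvPolynomial σ ℂ) := fun q => q.asIdeal.comap f
  have hIP : ∀ q, P ≤ I q := by
    intro q p hp
    have : f p = 0 := by simp [f, Ideal.Quotient.eq_zero_iff_mem.mpr hp]
    simp [I, this]
  have hIh : ∀ q, h ∉ I q := by
    intro q hq
    have hu : IsUnit (f h) := IsLocalization.Away.algebraMap_isUnit (S := S) (Ideal.Quotient.mk P h)
    exact q.2.ne_top (Ideal.eq_top_of_isUnit_mem _ hq hu)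
  have hprime : ∀ q, (I q).IsPrime := fun q => Ideal.comap_isPrime _ _
  have hIlt : ∀ q q', I q ≤ I q' → q ≤ q' := by
    intro q q' hqq
    have h1 : q.asIdeal.comap (algebraMap (MvPolynomial σ ℂ ⧸ P) S)
        ≤ q'.asIdeal.comap (algebraMap (MvPolynomial σ ℂ ⧸ P) S) := by
      intro a ha
      obtain ⟨p, rfl⟩ := Ideal.Quotient.mk_surjective a
      exact hqq ha
    rw [← PrimeSpectrum.asIdeal_le_asIdeal, ← IsLocalization.map_under
      (Submonoid.powers (Ideal.Quotient.mk P h)) S q.asIdeal]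
    exact Ideal.map_le_iff_le_comap.mpr h1
  let Z : PrimeSpectrum S → Set T' := fun q => {v | v.1 ∈ zeroLocus ℂ (I q)}
  have hval : ∀ q, (Subtype.val '' Z q : Set (Zar (σ → ℂ)))
      = {v ∈ zeroLocus ℂ (I q) | aeval v h ≠ 0} := by
    intro q
    ext v
    constructor
    · rintro ⟨v, hv, rfl⟩
      exact ⟨hv, v.2.2⟩
    · rintro ⟨hv, hv'⟩
      exact ⟨⟨v, zeroLocus_anti_mono (hIP q) hv, hv'⟩, hv, rfl⟩
  have hvan : ∀ q, vanishingIdeal ℂ (Subtype.val '' Z q : Set (Zar (σ → ℂ))) = I q := by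
    intro q
    rw [hval]
    have := hprime q
    exact vanishingIdeal_zeroLocus_diff (I q) (hIh q)
  have hclosed : ∀ q, IsClosed (Z q) := by
    intro q
    have : Z q = Subtype.val ⁻¹' (closure (Subtype.val '' Z q) : Set (Zar (σ → ℂ))) := by
      rw [zar_closure_eq, hvan]; rfl
    rw [this]
    exact isClosed_closure.preimage continuous_subtype_val
  have hirr : ∀ q, IsIrreducible (Z q) := by
    intro q
    have h1 : IsIrreducible (Subtype.val '' Z q : Set (Zar (σ → ℂ))) :=
      zar_isIrreducible_of_vanishingIdeal (by rw [hvan]; exact hprime q)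
    exact isIrreducible_of_image_subtypeVal h1
  refine Order.krullDim_le_of_strictMono
    (fun q => (⟨Z (OrderDual.ofDual q), hirr _, hclosed _⟩ : IrreducibleCloseds T')) ?_
  refine Monotone.strictMono_of_injective ?_ ?_
  · intro q q' hqq v hv
    exact zeroLocus_anti_mono (Ideal.comap_mono hqq) hv
  · intro q q' hqq
    have h0 : Z (OrderDual.ofDual q) = Z (OrderDual.ofDual q') := congrArg (fun W => W.carrier) hqq
    have h1 : I (OrderDual.ofDual q) = I (OrderDual.ofDual q') := by
      rw [← hvan, ← hvan, h0]
    exact OrderDual.ofDual.injective (le_antisymm (hIlt _ _ h1.le) (hIlt _ _ h1.ge))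

/-- The lower bound for dimensions: let `t` be a transcendence basis of `K`, and let `y` be a
`K`-point whose vanishing ideal is `P`. If the derivations of `K` that kill `y` span at most `z`
dimensions, a set containing a nonempty open subset of the zero locus of `P` has dimension at least
`card κ - z`. -/
theorem card_le_topologicalKrullDim_add {T : Set (Zar (σ → ℂ))}
    {P : Ideal (MvPolynomial σ ℂ)} {h : MvPolynomial σ ℂ} (hP : h ∉ P)
    (hT : ∀ v ∈ zeroLocus ℂ P, aeval v h ≠ 0 → v ∈ T)
    {K : Type*} [Field K] [Algebra ℂ K] (y : σ → K)
    (hy : ∀ p : MvPolynomial σ ℂ, aeval y p = 0 ↔ p ∈ P)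
    {κ : Type*} [Fintype κ] {t : κ → K}
    (ht : IsTranscendenceBasis ℂ t) (S : Submodule K (Derivation ℂ K K))
    (hS : ∀ D : Derivation ℂ K K, (∀ i, D (y i) = 0) → D ∈ S) {z : ℕ}
    (hz : finrank K S ≤ z) :
    ((Fintype.card κ : ℕ) : WithBot ℕ∞) ≤ topologicalKrullDim T + z := by
  refine le_trans ?_ (add_le_add (ringKrullDim_away_le_topologicalKrullDim P h hT) le_rfl)
  let R := MvPolynomial σ ℂ ⧸ P
  let g : R →ₐ[ℂ] K := Ideal.Quotient.liftₐ P (aeval y) fun p hp => (hy p).mpr hp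
  have hg : Function.Injective g := by
    rw [injective_iff_map_eq_zero]
    intro a ha
    obtain ⟨p, rfl⟩ := Ideal.Quotient.mk_surjective a
    exact Ideal.Quotient.eq_zero_iff_mem.mpr ((hy p).mp ha)
  have : IsDomain R := hg.isDomain g.toRingHom
  let A := Localization.Away (Ideal.Quotient.mk P h)
  have hne : Ideal.Quotient.mk P h ≠ 0 := fun h0 => hP (Ideal.Quotient.eq_zero_iff_mem.mp h0)
  have hpow : Submonoid.powers (Ideal.Quotient.mk P h) ≤ nonZeroDivisors R :=
    powers_le_nonZeroDivisors_of_noZeroDivisors hne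
  have : IsDomain A := IsLocalization.isDomain_localization hpow
  let g' : A →ₐ[ℂ] K := IsLocalization.liftAlgHom (M := Submonoid.powers (Ideal.Quotient.mk P h))
    (f := g) fun m => by
      refine IsUnit.mk0 _ fun h0 => ?_
      have h1 : (m : R) = 0 := hg (h0.trans (map_zero g).symm)
      exact nonZeroDivisors.ne_zero (hpow m.2) h1
  have hgg : ∀ r : R, g' (algebraMap R A r) = g r := fun r => IsLocalization.lift_eq _ r
  have hg' : Function.Injective g' := by
    rw [injective_iff_map_eq_zero]
    intro a ha
    obtain ⟨b, m, rfl⟩ := IsLocalization.exists_mk'_eq (Submonoid.powers (Ideal.Quotient.mk P h)) a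
    have h1 : g' (algebraMap R A b) = 0 := by
      rw [← IsLocalization.mk'_spec A b m, map_mul, ha, zero_mul]
    rw [hgg] at h1
    rw [hg (h1.trans (map_zero g).symm), IsLocalization.mk'_zero]
  let _ : Algebra A K := g'.toRingHom.toAlgebra
  have : IsScalarTower ℂ A K := IsScalarTower.of_algebraMap_eq fun c => (g'.commutes c).symm
  have : Algebra.FiniteType R A :=
    IsLocalization.finiteType_of_monoid_fg (Submonoid.powers (Ideal.Quotient.mk P h)) A
  have : Algebra.FiniteType ℂ A := Algebra.FiniteType.trans (S := R) inferInstance inferInstance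
  refine le_of_finrank_derivation_le (A := A) hg' ht S (fun D hD => hS D fun i => ?_) hz
  have := hD (algebraMap R A (Ideal.Quotient.mk P (X i)))
  have h2 : algebraMap A K (algebraMap R A (Ideal.Quotient.mk P (X i))) = y i := by
    exact (hgg _).trans (aeval_X y i)
  rwa [h2] at this

/-- The image of a morphism of affine varieties with irreducible source contains a nonempty open
subset of its closure (from Chevalley's theorem on constructible sets). -/
theorem exists_forall_zeroLocus_ker_exists_algHom {B : Type*} [CommRing B] [IsDomain B]
    [Algebra ℂ B] [Algebra.FiniteType ℂ B] (φ : MvPolynomial σ ℂ →ₐ[ℂ] B) :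
    ∃ h ∉ RingHom.ker φ, ∀ v ∈ zeroLocus ℂ (RingHom.ker φ), aeval v h ≠ 0 →
      ∃ θ : B →ₐ[ℂ] ℂ, ∀ i, θ (φ (X i)) = v i := by
  let A := MvPolynomial σ ℂ ⧸ RingHom.ker φ
  let g : A →ₐ[ℂ] B := Ideal.kerLiftAlg φ
  have hg : Function.Injective g := Ideal.kerLiftAlg_injective φ
  have hgft : g.toRingHom.FiniteType := by
    have : (algebraMap ℂ B).FiniteType := RingHom.finiteType_algebraMap.mpr inferInstance
    rw [← g.comp_algebraMap] at this
    exact RingHom.FiniteType.of_comp_finiteType this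
  have hfp : g.toRingHom.FinitePresentation :=
    RingHom.FinitePresentation.of_finiteType.mp hgft
  obtain ⟨C, hC⟩ := PrimeSpectrum.exists_constructibleSetData_iff.mpr
    (PrimeSpectrum.isConstructible_range_comap hfp)
  have : IsDomain A := hg.isDomain g.toRingHom
  have hbot : (⊥ : PrimeSpectrum A) ∈ C.toSet := by
    rw [hC]
    refine ⟨⊥, PrimeSpectrum.ext ?_⟩
    exact (RingHom.injective_iff_ker_eq_bot _).mp hg
  simp only [PrimeSpectrum.ConstructibleSetData.toSet, Set.mem_iUnion] at hbot
  obtain ⟨c, hc, hbc⟩ := hbot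
  obtain ⟨h, hh⟩ := Ideal.Quotient.mk_surjective c.f
  refine ⟨h, ?_, ?_⟩
  · intro hk
    apply hbc.2
    rw [← hh, Ideal.Quotient.eq_zero_iff_mem.mpr hk]
    simp
  · intro v hv hvh
    let ev : A →ₐ[ℂ] ℂ := Ideal.Quotient.liftₐ _ (aeval v) hv
    have hevs : Function.Surjective ev := fun a => ⟨algebraMap ℂ A a, ev.commutes a⟩
    have hmax : (RingHom.ker ev).IsMaximal := RingHom.ker_isMaximal_of_surjective _ hevs
    let m : PrimeSpectrum A := ⟨RingHom.ker ev, hmax.isPrime⟩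
    have hm : m ∈ C.toSet := by
      simp only [PrimeSpectrum.ConstructibleSetData.toSet, Set.mem_iUnion]
      refine ⟨c, hc, ?_, ?_⟩
      · intro a ha
        have h0 : a = 0 := by simpa using hbc.1 ha
        rw [h0]
        exact zero_mem _
      · intro hcm
        have : c.f ∈ RingHom.ker ev := by simpa [m] using hcm
        rw [← hh] at this
        exact hvh this
    rw [hC] at hm
    obtain ⟨q, hq⟩ := hm
    -- the prime over the maximal ideal of `v` may be enlarged to a maximal ideal, whose residue
    -- field is `ℂ`
    obtain ⟨Q, hQ, hqQ⟩ := Ideal.exists_le_maximal q.asIdeal q.2.ne_top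
    have hmQ : RingHom.ker ev = Q.comap g.toRingHom := by
      refine hmax.eq_of_le (Ideal.comap_isPrime _ Q).ne_top ?_
      have : RingHom.ker ev = q.asIdeal.comap g.toRingHom := by
        rw [← PrimeSpectrum.comap_asIdeal, hq]
      rw [this]
      exact Ideal.comap_mono hqQ
    let _ : Field (B ⧸ Q) := Ideal.Quotient.field Q
    have : Algebra.FiniteType ℂ (B ⧸ Q) :=
      .of_surjective (Ideal.Quotient.mkₐ ℂ Q) Ideal.Quotient.mk_surjective
    have : Module.Finite ℂ (B ⧸ Q) := finite_of_finite_type_of_isJacobsonRing ℂ (B ⧸ Q)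
    have hbij := IsAlgClosed.algebraMap_bijective_of_isIntegral (k := ℂ) (K := B ⧸ Q)
    let e : ℂ ≃ₐ[ℂ] (B ⧸ Q) := AlgEquiv.ofBijective (Algebra.ofId _ _) hbij
    refine ⟨(e.symm : (B ⧸ Q) →ₐ[ℂ] ℂ).comp (Ideal.Quotient.mkₐ ℂ Q), fun i => ?_⟩
    have h1 : Ideal.Quotient.mk (RingHom.ker φ) (X i - MvPolynomial.C (v i)) ∈ RingHom.ker ev := by
      change aeval v (X i - MvPolynomial.C (v i)) = 0
      simp
    rw [hmQ] at h1
    have h2 : φ (X i - MvPolynomial.C (v i)) ∈ Q := h1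
    rw [map_sub] at h2
    have h3 : Ideal.Quotient.mkₐ ℂ Q (φ (X i)) = e (v i) := by
      have := Ideal.Quotient.eq.mpr h2
      refine this.trans ?_
      rw [← MvPolynomial.algebraMap_eq, AlgHom.commutes]
      rfl
    change e.symm (Ideal.Quotient.mkₐ ℂ Q (φ (X i))) = v i
    rw [h3, AlgEquiv.symm_apply_apply]

end Dimension

section Topology

variable {X : Type*} [TopologicalSpace X]

theorem length_le_topologicalKrullDim_last (l : LTSeries (IrreducibleCloseds X)) :
    (l.length : WithBot ℕ∞) ≤ topologicalKrullDim (l.last : Set X) := by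
  let f : Set X → Set (l.last : Set X) := fun W => Subtype.val ⁻¹' W
  have hsub : ∀ i, (l i : Set X) ⊆ l.last := fun i => l.monotone (Fin.le_last i)
  have himg : ∀ i, Subtype.val '' f (l i) = (l i : Set X) := fun i => by
    rw [Subtype.image_preimage_coe, Set.inter_eq_right.mpr (hsub i)]
  let l' : LTSeries (IrreducibleCloseds (l.last : Set X)) :=
    { length := l.length
      toFun := fun i => ⟨f (l i), by
        refine isIrreducible_of_image_subtypeVal ?_
        rw [himg]
        exact (l i).isIrreducible, (l i).isClosed.preimage continuous_subtype_val⟩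
      step := fun i => by
        have h1 := l.step i
        refine lt_of_le_of_ne (Set.preimage_mono (le_of_lt h1)) fun h2 => ?_
        have h3 : f (l i.castSucc) = f (l i.succ) := h2
        refine h1.ne (IrreducibleCloseds.ext ?_)
        exact (himg i.castSucc).symm.trans ((congrArg _ h3).trans (himg i.succ)) }
  exact Order.LTSeries.length_le_krullDim l'

theorem topologicalKrullDim_le_of_irreducible {d : WithBot ℕ∞}
    (h : ∀ Z : Set X, IsIrreducible Z → IsClosed Z → topologicalKrullDim Z ≤ d) :
    topologicalKrullDim X ≤ d :=
  iSup_le fun l => (length_le_topologicalKrullDim_last l).trans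
    (h l.last l.last.isIrreducible l.last.isClosed)

/-- The image of a product of irreducible sets under a separately continuous map is irreducible. The
Zariski topology of a product is finer than the product topology, so joint continuity would be too
much to ask. -/
theorem IsIrreducible.image2_of_separatelyContinuous {Y W : Type*} [TopologicalSpace Y]
    [TopologicalSpace W] {s : Set X} {t : Set Y} (hs : IsIrreducible s) (ht : IsIrreducible t)
    {f : X → Y → W} (h1 : ∀ y ∈ t, ContinuousOn (fun x => f x y) s)
    (h2 : ∀ x ∈ s, ContinuousOn (f x) t) : IsIrreducible (Set.image2 f s t) := by
  refine ⟨hs.1.image2 ht.1, ?_⟩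
  rintro U U' hU hU' ⟨_, ⟨a, ha, b, hb, rfl⟩, hab⟩ ⟨_, ⟨a', ha', b', hb', rfl⟩, hab'⟩
  obtain ⟨O1, hO1, h11⟩ := continuousOn_iff'.mp (h1 b hb) U hU
  obtain ⟨O2, hO2, h22⟩ := continuousOn_iff'.mp (h1 b' hb') U' hU'
  have m1 : ∀ x ∈ s, x ∈ O1 ↔ f x b ∈ U := fun x hx => by
    have := Set.ext_iff.mp h11 x
    simpa [hx] using this.symm
  have m2 : ∀ x ∈ s, x ∈ O2 ↔ f x b' ∈ U' := fun x hx => by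
    have := Set.ext_iff.mp h22 x
    simpa [hx] using this.symm
  obtain ⟨x, hx, hx1, hx2⟩ := hs.2 O1 O2 hO1 hO2 ⟨a, ha, (m1 a ha).mpr hab⟩
    ⟨a', ha', (m2 a' ha').mpr hab'⟩
  rw [m1 x hx] at hx1
  rw [m2 x hx] at hx2
  obtain ⟨O3, hO3, h33⟩ := continuousOn_iff'.mp (h2 x hx) U hU
  obtain ⟨O4, hO4, h44⟩ := continuousOn_iff'.mp (h2 x hx) U' hU'
  have m3 : ∀ y ∈ t, y ∈ O3 ↔ f x y ∈ U := fun y hy => by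
    have := Set.ext_iff.mp h33 y
    simpa [hy] using this.symm
  have m4 : ∀ y ∈ t, y ∈ O4 ↔ f x y ∈ U' := fun y hy => by
    have := Set.ext_iff.mp h44 y
    simpa [hy] using this.symm
  obtain ⟨y, hy, hy1, hy2⟩ := ht.2 O3 O4 hO3 hO4 ⟨b, hb, (m3 b hb).mpr hx1⟩
    ⟨b', hb', (m4 b' hb').mpr hx2⟩
  exact ⟨f x y, ⟨x, hx, y, hy, rfl⟩, (m3 y hy).mp hy1, (m4 y hy).mp hy2⟩

end Topology

/-! ### Frames of flags and morphisms of flag varieties -/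

section Flags

variable {N N' : ℕ} {V V' : Type*} [AddCommGroup V] [Module ℂ V] [AddCommGroup V'] [Module ℂ V']

/-- Frames carry the topology induced from the Zariski topology of `V ^ N`, so that the topology of
the flag variety is the quotient topology. -/
noncomputable instance : TopologicalSpace (Basis (Fin N) ℂ V) :=
  TopologicalSpace.induced (fun b : Basis (Fin N) ℂ V => (b : Fin N → V)) (zariski (Fin N → V))

theorem continuous_ofBasis :
    Continuous (CompleteFlag.ofBasis : Basis (Fin N) ℂ V → CompleteFlag N V) :=
  continuous_coinduced_rng

/-- Principal open sets of frames are a basis of open sets. -/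
theorem frame_isOpen_iff {U : Set (Basis (Fin N) ℂ V)} :
    IsOpen U ↔ ∀ b ∈ U, ∃ P ∈ polyFun (Fin N → V), P b ≠ 0 ∧
      ∀ b' : Basis (Fin N) ℂ V, P b' ≠ 0 → b' ∈ U := by
  constructor
  · rintro ⟨O, hO, rfl⟩ b hb
    obtain ⟨P, hP, hPb, h⟩ := zar_isOpen_iff.mp hO (show Zar (Fin N → V) from ⇑b) hb
    exact ⟨P, hP, hPb, fun b' hb' => h b' hb'⟩
  · intro h
    choose P hP hPb hPU using h
    have : U = ⋃ b : U, {b' : Basis (Fin N) ℂ V | P b b.2 b' ≠ 0} := by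
      ext b
      simp only [Set.mem_iUnion]
      exact ⟨fun hb => ⟨⟨b, hb⟩, hPb b hb⟩, fun ⟨c, hc⟩ => hPU c c.2 b hc⟩
    rw [this]
    exact isOpen_iUnion fun b => ⟨_, zar_isOpen_ne_zero (M := Fin N → V) (hP b b.2), rfl⟩

/-- A set of flags is open if, around each frame whose flag is in it, it contains the flags of a
principal open set of frames. -/
theorem flag_isOpen_iff {U : Set (CompleteFlag N V)} :
    IsOpen U ↔ ∀ b : Basis (Fin N) ℂ V, CompleteFlag.ofBasis b ∈ U →
      ∃ P ∈ polyFun (Fin N → V), P b ≠ 0 ∧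
        ∀ b' : Basis (Fin N) ℂ V, P b' ≠ 0 → CompleteFlag.ofBasis b' ∈ U :=
  frame_isOpen_iff (U := CompleteFlag.ofBasis ⁻¹' U)

theorem ofBasis_eq_iff [FiniteDimensional ℂ V] {b : Basis (Fin N) ℂ V} {F : CompleteFlag N V} :
    CompleteFlag.ofBasis b = F ↔ ∀ i, b i ∈ F.sub i.succ := by
  constructor
  · rintro rfl i
    exact b.self_mem_flag (Fin.castSucc_lt_succ)
  · intro h
    refine CompleteFlag.ext (funext fun k => ?_)
    refine Submodule.eq_of_le_of_finrank_eq ?_ (by rw [F.finrank_sub, CompleteFlag.finrank_sub])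
    refine b.flag_le_iff.mpr fun i hi => F.mono ?_ (h i)
    exact hi

theorem mem_ofBasis_sub_iff {b : Basis (Fin N) ℂ V} {k : Fin (N + 1)} {v : V} :
    v ∈ (CompleteFlag.ofBasis b).sub k ↔ ∀ i : Fin N, (k : ℕ) ≤ i → b.repr v i = 0 := by
  change v ∈ b.flag k ↔ _
  rw [Basis.flag, b.mem_span_image]
  constructor
  · intro h i hi
    by_contra h0
    have := h (Finsupp.mem_support_iff.mpr h0)
    exact absurd hi (not_le.mpr this)
  · intro h i hi
    have := Finsupp.mem_support_iff.mp hi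
    by_contra h1
    exact this (h i (not_lt.mp h1))

theorem exists_basis_of_linearIndependent [FiniteDimensional ℂ V] (hV : finrank ℂ V = N)
    {v : Fin N → V} (hv : LinearIndependent ℂ v) : ∃ b : Basis (Fin N) ℂ V, (b : Fin N → V) = v :=
  ⟨basisOfLinearIndependentOfCardEqFinrank' v hv (by simp [hV]), by simp⟩

/-- Every complete flag is the flag of a frame: choose vectors in the successive differences. -/
theorem exists_ofBasis_eq [FiniteDimensional ℂ V] (hV : finrank ℂ V = N) (F : CompleteFlag N V) :
    ∃ b : Basis (Fin N) ℂ V, CompleteFlag.ofBasis b = F := by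
  have h1 : ∀ i : Fin N, ∃ v ∈ F.sub i.succ, v ∉ F.sub i.castSucc := by
    intro i
    have : F.sub i.castSucc < F.sub i.succ := by
      refine lt_of_le_of_ne (F.mono (Fin.castSucc_le_succ i)) fun h => ?_
      have h1 := F.finrank_sub i.castSucc
      rw [h, F.finrank_sub] at h1
      simp at h1
    exact SetLike.exists_of_lt this
  choose v hv hv' using h1
  have hspan : ∀ k : ℕ, ∀ hk : k < N + 1,
      F.sub ⟨k, hk⟩ ≤ Submodule.span ℂ (Set.range v) := by
    intro k
    induction k with
    | zero =>
      intro hk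
      have : F.sub ⟨0, hk⟩ = ⊥ := Submodule.finrank_eq_zero.mp (F.finrank_sub _)
      rw [this]; exact bot_le
    | succ k ih =>
      intro hk
      let i : Fin N := ⟨k, by omega⟩
      have h2 : F.sub i.castSucc ⊔ Submodule.span ℂ {v i} = F.sub i.succ := by
        refine Submodule.eq_of_le_of_finrank_le (sup_le (F.mono (Fin.castSucc_le_succ i))
          ((Submodule.span_singleton_le_iff_mem _ _).mpr (hv i))) ?_
        have h3 : F.sub i.castSucc < F.sub i.castSucc ⊔ Submodule.span ℂ {v i} := by
          refine lt_of_le_of_ne le_sup_left fun h => hv' i ?_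
          rw [h]
          exact Submodule.mem_sup_right (Submodule.mem_span_singleton_self _)
        have h4 := Submodule.finrank_lt_finrank_of_lt h3
        rw [F.finrank_sub] at h4 ⊢
        simpa using h4
      have h5 : F.sub ⟨k + 1, hk⟩ = F.sub i.succ := rfl
      rw [h5, ← h2]
      exact sup_le (ih (by omega)) ((Submodule.span_singleton_le_iff_mem _ _).mpr
        (Submodule.subset_span ⟨i, rfl⟩))
  have htop : ⊤ ≤ Submodule.span ℂ (Set.range v) := by
    have : F.sub (Fin.last N) = ⊤ := Submodule.eq_top_of_finrank_eq (by rw [F.finrank_sub, hV]; rfl)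
    rw [← this]
    exact hspan N (Nat.lt_succ_self N)
  refine ⟨basisOfTopLeSpanOfCardEqFinrank v htop (by simp [hV]), ofBasis_eq_iff.mpr fun i => ?_⟩
  simpa using hv i

theorem polyFun_repr {ι : Type*} (b : Basis ι ℂ V) {M : Type*} [AddCommGroup M] [Module ℂ M]
    (f : M →ₗ[ℂ] V) (i : ι) : (fun v => b.repr (f v) i) ∈ polyFun M :=
  dual_mem_polyFun (b.coord i ∘ₗ f)

theorem prod_mem_polyFun {M : Type*} [AddCommGroup M] [Module ℂ M] {ι : Type*} (s : Finset ι)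
    {f : ι → M → ℂ} (h : ∀ i ∈ s, f i ∈ polyFun M) : (fun v => ∏ i ∈ s, f i v) ∈ polyFun M := by
  have : (fun v => ∏ i ∈ s, f i v) = ∏ i ∈ s, f i := by ext; simp
  rw [this]; exact prod_mem h

theorem sum_mem_polyFun {M : Type*} [AddCommGroup M] [Module ℂ M] {ι : Type*} (s : Finset ι)
    {f : ι → M → ℂ} (h : ∀ i ∈ s, f i ∈ polyFun M) : (fun v => ∑ i ∈ s, f i v) ∈ polyFun M := by
  have : (fun v => ∑ i ∈ s, f i v) = ∑ i ∈ s, f i := by ext; simp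
  rw [this]; exact sum_mem h

theorem det_mem_polyFun {M : Type*} [AddCommGroup M] [Module ℂ M] {ι : Type*} [Fintype ι]
    [DecidableEq ι] {A : M → Matrix ι ι ℂ} (h : ∀ i j, (fun v => A v i j) ∈ polyFun M) :
    (fun v => (A v).det) ∈ polyFun M := by
  simp only [Matrix.det_apply]
  refine sum_mem_polyFun _ fun τ _ => ?_
  have := prod_mem_polyFun Finset.univ (f := fun i v => A v (τ i) i) fun i _ => h _ _
  rcases Int.units_eq_one_or (Equiv.Perm.sign τ) with hτ | hτ
  · simpa [hτ] using this
  · simp only [hτ, Units.neg_smul, one_smul]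
    exact neg_mem this

theorem adjugate_mem_polyFun {M : Type*} [AddCommGroup M] [Module ℂ M] {ι : Type*} [Fintype ι]
    [DecidableEq ι] {A : M → Matrix ι ι ℂ} (h : ∀ i j, (fun v => A v i j) ∈ polyFun M) (i j : ι) :
    (fun v => (A v).adjugate i j) ∈ polyFun M := by
  simp only [Matrix.adjugate_apply]
  refine det_mem_polyFun fun k l => ?_
  by_cases hk : k = j
  · subst hk
    simp only [Matrix.updateRow_self]
    exact const_mem_polyFun _
  · simp only [Matrix.updateRow_ne hk]
    exact h _ _

theorem exists_polyFun_ne_zero_iff_linearIndependent [FiniteDimensional ℂ V]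
    (hV : finrank ℂ V = N) :
    ∃ δ ∈ polyFun (Fin N → V), ∀ v, δ v ≠ 0 ↔ LinearIndependent ℂ v := by
  let e : Basis (Fin N) ℂ V := finBasisOfFinrankEq ℂ V hV
  refine ⟨fun v => (e.toMatrix v).det, det_mem_polyFun fun i j => ?_, fun v => ?_⟩
  · exact polyFun_repr e (LinearMap.proj j : (Fin N → V) →ₗ[ℂ] V) i
  · change (e.toMatrix v).det ≠ 0 ↔ _
    rw [← Basis.det_apply, ← isUnit_iff_ne_zero, ← Basis.is_basis_iff_det]
    refine ⟨fun h => h.1, fun h => ⟨h, ?_⟩⟩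
    exact h.span_eq_top_of_card_eq_finrank' (by simp [hV])

/-- `f` is a polynomial map that takes the frames of the flags in `O`, and no other frames, to
frames, and it takes a frame of `F ∈ O` to a frame of `Φ F`. So `Φ` is a morphism on the open set
`O`, while nothing is asked of it elsewhere. -/
structure IsFrameMap (Φ : CompleteFlag N V → CompleteFlag N' V') (O : Set (CompleteFlag N V))
    (f : (Fin N → V) → (Fin N' → V')) : Prop where
  poly : PolyMap f
  mem_iff : ∀ b : Basis (Fin N) ℂ V, CompleteFlag.ofBasis b ∈ O ↔ LinearIndependent ℂ (f b)
  mem_sub : ∀ b : Basis (Fin N) ℂ V, CompleteFlag.ofBasis b ∈ O →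
    ∀ i, f b i ∈ (Φ (CompleteFlag.ofBasis b)).sub i.succ

namespace IsFrameMap

variable [FiniteDimensional ℂ V'] {Φ : CompleteFlag N V → CompleteFlag N' V'}
  {O : Set (CompleteFlag N V)} {f : (Fin N → V) → (Fin N' → V')}

theorem exists_frame (h : IsFrameMap Φ O f) (hV' : finrank ℂ V' = N') {b : Basis (Fin N) ℂ V}
    (hb : CompleteFlag.ofBasis b ∈ O) : ∃ b' : Basis (Fin N') ℂ V', (b' : Fin N' → V') = f b ∧
      Φ (CompleteFlag.ofBasis b) = CompleteFlag.ofBasis b' := by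
  obtain ⟨b', hb'⟩ := exists_basis_of_linearIndependent hV' ((h.mem_iff b).mp hb)
  refine ⟨b', hb', (ofBasis_eq_iff.mpr fun i => ?_).symm⟩
  rw [hb']
  exact h.mem_sub b hb i

theorem isOpen_inter_preimage (h : IsFrameMap Φ O f) (hV' : finrank ℂ V' = N')
    {U : Set (CompleteFlag N' V')} (hU : IsOpen U) : IsOpen (O ∩ Φ ⁻¹' U) := by
  obtain ⟨δ, hδ, hδi⟩ := exists_polyFun_ne_zero_iff_linearIndependent hV'
  rw [flag_isOpen_iff]
  rintro b ⟨hbO, hbU⟩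
  obtain ⟨b', hb', hΦ⟩ := h.exists_frame hV' hbO
  rw [Set.mem_preimage, hΦ] at hbU
  obtain ⟨P, hP, hPb, hPU⟩ := flag_isOpen_iff.mp hU b' hbU
  refine ⟨_, mul_mem (h.poly P hP) (h.poly δ hδ), mul_ne_zero ?_ ?_, fun c hc => ?_⟩
  · rwa [hb'] at hPb
  · exact (hδi _).mpr ((h.mem_iff b).mp hbO)
  · obtain ⟨h1, h2⟩ := mul_ne_zero_iff.mp hc
    have hcO := (h.mem_iff c).mpr ((hδi _).mp h2)
    obtain ⟨c', hc', hΦ'⟩ := h.exists_frame hV' hcO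
    refine ⟨hcO, ?_⟩
    rw [Set.mem_preimage, hΦ']
    exact hPU c' (by rw [hc']; exact h1)

theorem continuousOn (h : IsFrameMap Φ O f) (hV' : finrank ℂ V' = N') : ContinuousOn Φ O := by
  refine continuousOn_iff'.mpr fun U hU => ⟨O ∩ Φ ⁻¹' U, h.isOpen_inter_preimage hV' hU, ?_⟩
  ext; simp; tauto

/-- The pull-back of a regular function by a map of flags that lifts to a polynomial map of frames
is regular: substitute the map of frames in numerator and denominator. -/
theorem isRegularOn (h : IsFrameMap Φ O f) (hV' : finrank ℂ V' = N')
    {U : Set (CompleteFlag N' V')} {g : CompleteFlag N' V' → ℂ} (hg : IsRegularOn g U) :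
    IsRegularOn (g ∘ Φ) (O ∩ Φ ⁻¹' U) := by
  obtain ⟨δ, hδ, hδi⟩ := exists_polyFun_ne_zero_iff_linearIndependent hV'
  rintro b ⟨hbO, hbU⟩
  obtain ⟨b', hb', hΦ⟩ := h.exists_frame hV' hbO
  rw [Set.mem_preimage, hΦ] at hbU
  obtain ⟨P, hP, D, hD, hDb, hPD⟩ := hg b' hbU
  refine ⟨_, mul_mem (h.poly P hP) (h.poly δ hδ), _, mul_mem (h.poly D hD) (h.poly δ hδ),
    mul_ne_zero ?_ ?_, fun c hc => ?_⟩
  · rwa [hb'] at hDb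
  · exact (hδi _).mpr ((h.mem_iff b).mp hbO)
  · obtain ⟨h1, h2⟩ := mul_ne_zero_iff.mp hc
    have hcO := (h.mem_iff c).mpr ((hδi _).mp h2)
    obtain ⟨c', hc', hΦ'⟩ := h.exists_frame hV' hcO
    have h3 := hPD c' (by rw [hc']; exact h1)
    rw [Function.comp_apply, hΦ', h3, hc']
    exact (mul_div_mul_right _ _ h2).symm

theorem isRegularAt (h : IsFrameMap Φ O f) (hV' : finrank ℂ V' = N')
    {X : Set (CompleteFlag N V)} {Y : Set (CompleteFlag N' V')} (hX : X ⊆ O) (φ : X → Y)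
    (hφ : ∀ F : X, (φ F : CompleteFlag N' V') = Φ F) {g : Y → ℂ} {F : X}
    (hg : IsRegularAt g (φ F)) : IsRegularAt (g ∘ φ) F := by
  obtain ⟨U, hU, hFU, G, hG, hgG⟩ := hg
  refine ⟨O ∩ Φ ⁻¹' U, h.isOpen_inter_preimage hV' hU, ⟨hX F.2, by rwa [hφ] at hFU⟩, G ∘ Φ,
    h.isRegularOn hV' hG, fun F' hF' => ?_⟩
  have := hgG (φ F') (by rw [hφ]; exact hF'.2)
  rw [Function.comp_apply, this, hφ]; rfl

end IsFrameMap

/-- Mutually inverse maps between subvarieties of two flag varieties which extend to maps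
represented by polynomial maps of frames form an isomorphism of varieties. -/
theorem isIsomorphic_of_isFrameMap [FiniteDimensional ℂ V] [FiniteDimensional ℂ V']
    (hV : finrank ℂ V = N) (hV' : finrank ℂ V' = N')
    {Φ : CompleteFlag N V → CompleteFlag N' V'} {O : Set (CompleteFlag N V)}
    {f : (Fin N → V) → (Fin N' → V')} (hΦ : IsFrameMap Φ O f)
    {Ψ : CompleteFlag N' V' → CompleteFlag N V} {O' : Set (CompleteFlag N' V')}
    {f' : (Fin N' → V') → (Fin N → V)} (hΨ : IsFrameMap Ψ O' f')
    {X : Set (CompleteFlag N V)} {Y : Set (CompleteFlag N' V')} (hX : X ⊆ O) (hY : Y ⊆ O')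
    (hXY : ∀ F ∈ X, Φ F ∈ Y) (hYX : ∀ G ∈ Y, Ψ G ∈ X) (hl : ∀ F ∈ X, Ψ (Φ F) = F)
    (hr : ∀ G ∈ Y, Φ (Ψ G) = G) :
    ∃ φ : X ≃ₜ Y, (∀ F : X, (φ F : CompleteFlag N' V') = Φ F) ∧
      ∀ (f : Y → ℂ) (F : X), IsRegularAt f (φ F) ↔ IsRegularAt (f ∘ φ) F := by
  let φ : X ≃ₜ Y :=
    { toFun := fun F => ⟨Φ F, hXY F F.2⟩
      invFun := fun G => ⟨Ψ G, hYX G G.2⟩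
      left_inv := fun F => Subtype.ext (hl F F.2)
      right_inv := fun G => Subtype.ext (hr G G.2)
      continuous_toFun := by
        have := ((hΦ.continuousOn hV').mono hX).domRestrict
        exact Continuous.subtype_mk this _
      continuous_invFun := by
        have := ((hΨ.continuousOn hV).mono hY).domRestrict
        exact Continuous.subtype_mk this _ }
  refine ⟨φ, fun F => rfl, fun g F => ⟨fun h => hΦ.isRegularAt hV' hX φ (fun _ => rfl) h,
    fun h => ?_⟩⟩
  have h1 : IsRegularAt (g ∘ φ) (φ.symm (φ F)) := by rwa [φ.symm_apply_apply]
  have h2 := hΨ.isRegularAt hV hY φ.symm (fun _ => rfl) h1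
  have h3 : (g ∘ φ) ∘ φ.symm = g := by ext G; simp
  rwa [h3] at h2

end Flags

/-! ### Affine charts of the flag variety -/

/-- The positions strictly below the diagonal of an `N × N` matrix; they index the coordinates on
the big cell of the flag variety, and on the space of skew-symmetric matrices. -/
abbrev LowerIdx (N : ℕ) := {p : Fin N × Fin N // p.2 < p.1}

section Unipotent

variable {N : ℕ} {R S : Type*} [CommRing R] [CommRing S]

/-- The lower unipotent matrix with entries `a` below the diagonal. -/
def uniMat (a : LowerIdx N → R) : Matrix (Fin N) (Fin N) R :=
  Matrix.of fun i j => if h : j < i then a ⟨(i, j), h⟩ else if i = j then 1 else 0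

theorem uniMat_of_lt (a : LowerIdx N → R) {i j : Fin N} (h : j < i) :
    uniMat a i j = a ⟨(i, j), h⟩ := by simp [uniMat, h]

theorem uniMat_self (a : LowerIdx N → R) (i : Fin N) : uniMat a i i = 1 := by simp [uniMat]

theorem uniMat_of_gt (a : LowerIdx N → R) {i j : Fin N} (h : i < j) : uniMat a i j = 0 := by
  simp [uniMat, h.not_gt, h.ne]

theorem det_uniMat (a : LowerIdx N → R) : (uniMat a).det = 1 := by
  rw [Matrix.det_of_isLowerTriangular _ fun i j h => uniMat_of_gt a (by simpa using h)]
  simp [uniMat_self]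

theorem map_uniMat (f : R →+* S) (a : LowerIdx N → R) :
    (uniMat a).map f = uniMat (f ∘ a) := by
  ext i j
  simp only [uniMat, Matrix.map_apply, Matrix.of_apply, Function.comp]
  split_ifs <;> simp

theorem uniMat_zero : uniMat (0 : LowerIdx N → R) = 1 := by
  ext i j
  simp only [uniMat, Matrix.of_apply, Matrix.one_apply]
  split_ifs with h1 h2
  · exact absurd h2 h1.ne'
  all_goals rfl

end Unipotent

section GeneralField

variable {N : ℕ} {K V : Type*} [Field K] [AddCommGroup V] [Module K V]

/-- The frame obtained from `b` by the lower unipotent matrix with entries `a`. Its flags, for all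
`a`, form the big cell opposite to the flag of `b`. -/
noncomputable def chartBasis (b : Basis (Fin N) K V) (a : LowerIdx N → K) : Basis (Fin N) K V :=
  b.map (Matrix.toLinearEquiv b (uniMat a) (by rw [det_uniMat]; exact isUnit_one))

theorem chartBasis_apply (b : Basis (Fin N) K V) (a : LowerIdx N → K) (j : Fin N) :
    chartBasis b a j = ∑ i, uniMat a i j • b i := by
  simp [chartBasis, Matrix.toLin_self]

theorem repr_chartBasis (b : Basis (Fin N) K V) (a : LowerIdx N → K) (i j : Fin N) :
    b.repr (chartBasis b a j) i = uniMat a i j := by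
  rw [chartBasis_apply, map_sum]
  simp [Finsupp.single_apply]

theorem toMatrix_chartBasis (b : Basis (Fin N) K V) (a : LowerIdx N → K) :
    b.toMatrix (chartBasis b a) = uniMat a := by
  ext i j
  rw [Basis.toMatrix_apply, repr_chartBasis]

theorem chartBasis_toMatrix (b : Basis (Fin N) K V) (a : LowerIdx N → K) :
    (chartBasis b a).toMatrix b = (uniMat a).adjugate := by
  have h1 := (chartBasis b a).toMatrix_mul_toMatrix_flip b
  rw [toMatrix_chartBasis] at h1
  have h2 := (uniMat a).mul_adjugate
  rw [det_uniMat, one_smul] at h2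
  exact left_inv_eq_right_inv h1 h2

theorem repr_chartBasis_eq_mulVec (b : Basis (Fin N) K V) (a : LowerIdx N → K) (v : V) :
    ⇑((chartBasis b a).repr v) = Matrix.mulVec (uniMat a).adjugate ⇑(b.repr v) := by
  rw [← chartBasis_toMatrix b a, Basis.toMatrix_mulVec_repr]

theorem toMatrix_chartBasis_end (b : Basis (Fin N) K V) (a : LowerIdx N → K) (x : End K V) :
    LinearMap.toMatrix (chartBasis b a) (chartBasis b a) x
      = (uniMat a).adjugate * LinearMap.toMatrix b b x * uniMat a := by
  rw [← chartBasis_toMatrix b a, ← toMatrix_chartBasis b a,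
    basis_toMatrix_mul_linearMap_toMatrix_mul_basis_toMatrix]

theorem toMatrix_chartBasis_bilin (b : Basis (Fin N) K V) (a : LowerIdx N → K)
    (B : LinearMap.BilinForm K V) :
    LinearMap.BilinForm.toMatrix (chartBasis b a) B
      = (uniMat a).transpose * LinearMap.BilinForm.toMatrix b B * uniMat a := by
  rw [← toMatrix_chartBasis b a, LinearMap.BilinForm.toMatrix_mul_basis_toMatrix]

/-- The span of the first `i` vectors of the frame `b`, described by coordinates; here `K` may be
any field and `i` any natural number. -/
def basisFlag (b : Basis (Fin N) K V) (i : ℕ) : Submodule K V where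
  carrier := {v | ∀ k : Fin N, i ≤ k → b.repr v k = 0}
  add_mem' hv hw k hk := by rw [map_add, Finsupp.add_apply, hv k hk, hw k hk, add_zero]
  zero_mem' k _ := by rw [map_zero, Finsupp.zero_apply]
  smul_mem' c v hv k hk := by rw [map_smul, Finsupp.smul_apply, hv k hk, smul_zero]

theorem basisFlag_mono (b : Basis (Fin N) K V) {i j : ℕ} (h : i ≤ j) :
    basisFlag b i ≤ basisFlag b j := fun _ hv k hk => hv k (h.trans hk)

theorem self_mem_basisFlag (b : Basis (Fin N) K V) (j : Fin N) : b j ∈ basisFlag b (j + 1) := by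
  intro k hk
  rw [b.repr_self, Finsupp.single_eq_of_ne]
  rintro rfl
  omega

theorem basisFlag_eq_span (b : Basis (Fin N) K V) (i : ℕ) :
    basisFlag b i = Submodule.span K (Set.range fun k : {k : Fin N // (k : ℕ) < i} => b k) := by
  refine le_antisymm (fun v hv => ?_) (Submodule.span_le.mpr ?_)
  · rw [← b.sum_repr v]
    refine Submodule.sum_mem _ fun k _ => ?_
    by_cases hk : (k : ℕ) < i
    · exact Submodule.smul_mem _ _ (Submodule.subset_span ⟨⟨k, hk⟩, rfl⟩)
    · rw [hv k (not_lt.mp hk), zero_smul]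
      exact zero_mem _
  · rintro _ ⟨⟨k, hk⟩, rfl⟩
    exact basisFlag_mono b hk (self_mem_basisFlag b k)

theorem finrank_basisFlag (b : Basis (Fin N) K V) {i : ℕ} (hi : i ≤ N) :
    finrank K (basisFlag b i) = i := by
  have hli : LinearIndependent K fun k : {k : Fin N // (k : ℕ) < i} => b k :=
    b.linearIndependent.comp _ Subtype.val_injective
  rw [basisFlag_eq_span, finrank_span_eq_card hli, Fintype.card_subtype, Fin.card_filter_val_lt]
  omega

theorem mem_of_mem_basisFlag {b : Basis (Fin N) K V} {i : ℕ} {W : Submodule K V}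
    (h : ∀ k : Fin N, (k : ℕ) < i → b k ∈ W) : basisFlag b i ≤ W := by
  rw [basisFlag_eq_span, Submodule.span_le]
  rintro _ ⟨⟨k, hk⟩, rfl⟩
  exact h k hk

/-- The first `j` vectors of a frame in the big cell project isomorphically to the span of the first
`j` vectors of `b`. -/
theorem eq_zero_of_mem_basisFlag (b : Basis (Fin N) K V) (a : LowerIdx N → K) {j : ℕ} {v : V}
    (hv : v ∈ basisFlag (chartBasis b a) j) (h : ∀ i : Fin N, (i : ℕ) < j → b.repr v i = 0) :
    v = 0 := by
  have h1 : ∀ k : Fin N, (chartBasis b a).repr v k = 0 := by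
    rintro ⟨k, hk⟩
    induction k using Nat.strong_induction_on with
    | _ k ih =>
      by_cases hkj : k < j
      · have h2 := h ⟨k, hk⟩ hkj
        rw [← (chartBasis b a).sum_repr v, map_sum, Finsupp.finsetSum_apply,
          Finset.sum_eq_single ⟨k, hk⟩] at h2
        · rwa [map_smul, Finsupp.smul_apply, repr_chartBasis, uniMat_self, smul_eq_mul,
            mul_one] at h2
        · rintro ⟨l, hl⟩ _ hlk
          rw [map_smul, Finsupp.smul_apply, repr_chartBasis, smul_eq_mul]
          rcases lt_or_gt_of_ne hlk with h3 | h3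
          · rw [ih l h3 hl, zero_mul]
          · rw [uniMat_of_gt a h3, mul_zero]
        · simp
      · exact hv ⟨k, hk⟩ (not_lt.mp hkj)
  exact (chartBasis b a).repr.map_eq_zero_iff.mp (Finsupp.ext h1)

end GeneralField

section Charts

variable {N : ℕ} {V : Type*} [AddCommGroup V] [Module ℂ V]

/-- The chart of the flag variety with coordinates `a`, centred at the flag of `b`. -/
noncomputable def flagChart (b : Basis (Fin N) ℂ V) (a : Zar (LowerIdx N → ℂ)) : CompleteFlag N V :=
  CompleteFlag.ofBasis (chartBasis b a)

theorem continuous_flagChart (b : Basis (Fin N) ℂ V) : Continuous (flagChart b) := by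
  refine continuous_ofBasis.comp ?_
  refine continuous_induced_rng.mpr ?_
  refine PolyMap.continuous (M := LowerIdx N → ℂ) (M' := Fin N → V)
    (f := fun a => chartBasis b a) (PolyMap.of_dual fun φ => ?_)
  have : (fun a => φ (chartBasis b a))
      = fun a => ∑ j, ∑ i, uniMat a i j * φ (Pi.single j (b i)) := by
    funext a
    have h : ((chartBasis b a : Basis (Fin N) ℂ V) : Fin N → V)
        = ∑ j, ∑ i, uniMat (R := ℂ) a i j • (Pi.single j (b i) : Fin N → V) := by
      funext k
      simp only [chartBasis_apply, Finset.sum_apply, Pi.smul_apply, Pi.single_apply]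
      rw [Finset.sum_comm]
      simp
    rw [h]
    simp only [map_sum, map_smul, smul_eq_mul]
  rw [this]
  refine sum_mem_polyFun _ fun j _ => sum_mem_polyFun _ fun i _ =>
    mul_mem ?_ (const_mem_polyFun _)
  simp only [uniMat, Matrix.of_apply]
  split_ifs with h1
  · exact dual_mem_polyFun (LinearMap.proj (⟨(i, j), h1⟩ : LowerIdx N) : Dual ℂ (LowerIdx N → ℂ))
  · exact const_mem_polyFun _
  · exact const_mem_polyFun _

theorem ofBasis_sub_eq_basisFlag (b : Basis (Fin N) ℂ V) (i : Fin (N + 1)) :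
    (CompleteFlag.ofBasis b).sub i = basisFlag b i :=
  Submodule.ext fun _ => mem_ofBasis_sub_iff

theorem flagChart_injective [FiniteDimensional ℂ V] (b : Basis (Fin N) ℂ V) :
    Function.Injective (flagChart b) := by
  intro (a : LowerIdx N → ℂ) (a' : LowerIdx N → ℂ) h
  have key : ∀ j, chartBasis b a j = chartBasis b a' j := by
    intro j
    rw [← sub_eq_zero]
    refine eq_zero_of_mem_basisFlag b a (j := j + 1) (sub_mem ?_ ?_) ?_
    · exact self_mem_basisFlag _ j
    · have h1 : CompleteFlag.ofBasis (chartBasis b a') = CompleteFlag.ofBasis (chartBasis b a) :=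
        h.symm
      have h2 := ofBasis_eq_iff.mp h1 j
      rwa [ofBasis_sub_eq_basisFlag] at h2
    · intro i hi
      rw [map_sub, Finsupp.sub_apply, repr_chartBasis, repr_chartBasis]
      rcases (Nat.lt_succ_iff.mp hi).lt_or_eq with h1 | h1
      · rw [uniMat_of_gt _ h1, uniMat_of_gt _ h1, sub_zero]
      · obtain rfl := Fin.ext h1
        rw [uniMat_self, uniMat_self, sub_self]
  refine funext fun (⟨(i, j), hij⟩ : LowerIdx N) => ?_
  have h1 := congrArg (fun v => b.repr v i) (key j)
  simp only [repr_chartBasis] at h1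
  rwa [uniMat_of_lt a hij, uniMat_of_lt a' hij] at h1

/-- The leading `(j + 1) × (j + 1)` block of the matrix of the frame `v` in the basis `b`. The flag
of `v` is in the big cell exactly when all these blocks are invertible. -/
noncomputable def leadingBlock (b : Basis (Fin N) ℂ V) (v : Fin N → V) (j : Fin N) :
    Matrix (Fin (j + 1)) (Fin (j + 1)) ℂ :=
  Matrix.of fun i k => b.repr (v (k.castLE j.2)) (i.castLE j.2)

/-- The combination of the first `j + 1` vectors of `v` whose first `j` coordinates vanish, by
Cramer's rule, without the division by the determinant of the leading block. -/
noncomputable def chartNum (b : Basis (Fin N) ℂ V) (v : Fin N → V) (j : Fin N) : V :=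
  ∑ k, (leadingBlock b v j).adjugate k (Fin.last j) • v (k.castLE j.2)

theorem repr_chartNum (b : Basis (Fin N) ℂ V) (v : Fin N → V) (j : Fin N) {i : Fin N} (hi : i ≤ j) :
    b.repr (chartNum b v j) i = if i = j then (leadingBlock b v j).det else 0 := by
  have h := congrFun (congrFun ((leadingBlock b v j).mul_adjugate) ⟨i, Nat.lt_succ_of_le hi⟩)
    (Fin.last j)
  have h2 : b.repr (chartNum b v j) i = (leadingBlock b v j * (leadingBlock b v j).adjugate)
      ⟨i, Nat.lt_succ_of_le hi⟩ (Fin.last j) := by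
    rw [Matrix.mul_apply, chartNum, map_sum, Finsupp.finsetSum_apply]
    refine Finset.sum_congr rfl fun k _ => ?_
    simp [leadingBlock, mul_comm]
  rw [h2, h, Matrix.smul_apply, Matrix.one_apply]
  by_cases hij : i = j
  · subst hij; simp [Fin.ext_iff]
  · have : (⟨i, Nat.lt_succ_of_le hi⟩ : Fin (j + 1)) ≠ Fin.last j := by
      simpa [Fin.ext_iff] using hij
    simp [hij, this]

/-- The chart coordinates of the flag of a frame are quotients of minors. -/
theorem ofBasis_eq_flagChart [FiniteDimensional ℂ V] (b g : Basis (Fin N) ℂ V)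
    (h : ∀ j, (leadingBlock b g j).det ≠ 0) :
    CompleteFlag.ofBasis g = flagChart b
      fun p => b.repr (chartNum b g p.1.2) p.1.1 / (leadingBlock b g p.1.2).det := by
  refine (ofBasis_eq_iff.mpr fun j => ?_).symm
  have h1 : chartBasis b (fun p => b.repr (chartNum b g p.1.2) p.1.1 /
      (leadingBlock b g p.1.2).det) j = ((leadingBlock b g j).det)⁻¹ • chartNum b g j := by
    apply b.repr.injective
    ext i
    rw [repr_chartBasis, map_smul, Finsupp.smul_apply, smul_eq_mul]
    rcases lt_trichotomy j i with hij | hij | hij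
    · rw [uniMat_of_lt _ hij, div_eq_inv_mul]
    · subst hij
      rw [uniMat_self, repr_chartNum b g j le_rfl, if_pos rfl, inv_mul_cancel₀ (h j)]
    · rw [uniMat_of_gt _ hij, repr_chartNum b g j hij.le, if_neg hij.ne, mul_zero]
  rw [h1]
  refine Submodule.smul_mem _ _ (Submodule.sum_mem _ fun k _ => Submodule.smul_mem _ _ ?_)
  refine (CompleteFlag.ofBasis g).mono ?_ (ofBasis_eq_iff.mp rfl (k.castLE j.2))
  exact Fin.succ_le_succ_iff.mpr (Nat.lt_succ_iff.mp k.2)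

theorem leadingBlock_det_ne_zero [FiniteDimensional ℂ V] {b g : Basis (Fin N) ℂ V}
    {a : LowerIdx N → ℂ} (h : CompleteFlag.ofBasis g = flagChart b a) (j : Fin N) :
    (leadingBlock b g j).det ≠ 0 := by
  intro hdet
  obtain ⟨c, hc, hc0⟩ := Matrix.exists_mulVec_eq_zero_iff.mpr hdet
  have h1 : ∑ k, c k • g (k.castLE j.2) = 0 := by
    refine eq_zero_of_mem_basisFlag b a (j := j + 1) ?_ ?_
    · have h1 : CompleteFlag.ofBasis g = CompleteFlag.ofBasis (chartBasis b a) := h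
      change _ ∈ basisFlag (chartBasis b a) (j.succ : ℕ)
      rw [← ofBasis_sub_eq_basisFlag, ← h1]
      refine Submodule.sum_mem _ fun k _ => Submodule.smul_mem _ _ ?_
      refine (CompleteFlag.ofBasis g).mono ?_ (ofBasis_eq_iff.mp rfl (k.castLE j.2))
      exact Fin.succ_le_succ_iff.mpr (Nat.lt_succ_iff.mp k.2)
    · intro i hi
      have := congrFun hc0 ⟨i, hi⟩
      rw [map_sum, Finsupp.finsetSum_apply]
      rw [Matrix.mulVec, dotProduct] at this
      simpa [leadingBlock, mul_comm] using this
  have h2 := Fintype.linearIndependent_iff.mp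
    (g.linearIndependent.comp (Fin.castLE j.2) (Fin.castLE_injective j.2)) c h1
  exact hc (funext h2)

/-- A polynomial in quotients `n i / δ` becomes polynomial after multiplication by a power of
`δ`. -/
theorem exists_clear_denominators {σ M : Type*} [Finite σ] [AddCommGroup M] [Module ℂ M]
    {n : σ → M → ℂ} {δ : M → ℂ} (hn : ∀ i, n i ∈ polyFun M) (hδ : δ ∈ polyFun M)
    (p : MvPolynomial σ ℂ) : ∃ P ∈ polyFun M, ∃ k : ℕ, ∀ v, δ v ≠ 0 →
      aeval (fun i => n i v / δ v) p * δ v ^ k = P v := by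
  induction p using MvPolynomial.induction_on with
  | C a => exact ⟨fun _ => a, const_mem_polyFun a, 0, by simp⟩
  | add p q hp hq =>
    obtain ⟨P, hP, k, h⟩ := hp
    obtain ⟨P', hP', k', h'⟩ := hq
    refine ⟨P * δ ^ k' + P' * δ ^ k, add_mem (mul_mem hP (pow_mem hδ _))
      (mul_mem hP' (pow_mem hδ _)), k + k', fun v hv => ?_⟩
    simp only [map_add, Pi.add_apply, Pi.mul_apply, Pi.pow_apply, ← h v hv, ← h' v hv]
    ring
  | mul_X p i hp =>
    obtain ⟨P, hP, k, h⟩ := hp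
    refine ⟨P * n i, mul_mem hP (hn i), k + 1, fun v hv => ?_⟩
    simp only [map_mul, Pi.mul_apply, ← h v hv, aeval_X]
    rw [pow_succ, mul_comm (δ v ^ k), ← mul_assoc, mul_assoc _ (n i v / δ v),
      div_mul_cancel₀ _ hv]
    ring

theorem isOpenEmbedding_flagChart [FiniteDimensional ℂ V] (b : Basis (Fin N) ℂ V) :
    Topology.IsOpenEmbedding (flagChart b) := by
  refine .of_continuous_injective_isOpenMap (continuous_flagChart b) (flagChart_injective b) ?_
  intro U hU
  rw [flag_isOpen_iff]
  rintro g ⟨a, haU, hag⟩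
  obtain ⟨P, hP, hPa, hPU⟩ := zar_isOpen_iff.mp hU a haU
  obtain ⟨p, hp⟩ := mem_polyFun_pi.mp hP
  have hlb : ∀ j, (fun v => (leadingBlock b v j).det) ∈ polyFun (Fin N → V) := fun j =>
    det_mem_polyFun fun i k =>
      polyFun_repr b (LinearMap.proj (k.castLE j.2) : (Fin N → V) →ₗ[ℂ] V) _
  have hnum : ∀ j i, (fun v => b.repr (chartNum b v j) i) ∈ polyFun (Fin N → V) := by
    intro j i
    have : (fun v => b.repr (chartNum b v j) i) = fun v => ∑ k,
        (leadingBlock b v j).adjugate k (Fin.last j) * b.repr (v (k.castLE j.2)) i := by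
      funext v
      simp [chartNum, map_sum, Finsupp.finsetSum_apply]
    rw [this]
    refine sum_mem_polyFun _ fun k _ => mul_mem (adjugate_mem_polyFun (fun i k => ?_) _ _) ?_
    · exact polyFun_repr b (LinearMap.proj (k.castLE j.2) : (Fin N → V) →ₗ[ℂ] V) _
    · exact polyFun_repr b (LinearMap.proj (k.castLE j.2) : (Fin N → V) →ₗ[ℂ] V) _
  let δ : (Fin N → V) → ℂ := fun v => ∏ j, (leadingBlock b v j).det
  have hδ : δ ∈ polyFun (Fin N → V) := prod_mem_polyFun _ fun j _ => hlb j
  let n : LowerIdx N → (Fin N → V) → ℂ := fun q v => b.repr (chartNum b v q.1.2) q.1.1 *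
    ∏ j ∈ Finset.univ.erase q.1.2, (leadingBlock b v j).det
  have hn : ∀ q, n q ∈ polyFun (Fin N → V) := fun q =>
    mul_mem (hnum _ _) (prod_mem_polyFun _ fun j _ => hlb j)
  have hnδ : ∀ v, δ v ≠ 0 → ∀ q : LowerIdx N, n q v / δ v =
      b.repr (chartNum b v q.1.2) q.1.1 / (leadingBlock b v q.1.2).det := by
    intro v hv q
    have h1 : δ v = (leadingBlock b v q.1.2).det *
      ∏ j ∈ Finset.univ.erase q.1.2, (leadingBlock b v j).det :=
      (Finset.mul_prod_erase _ (fun j => (leadingBlock b v j).det) (Finset.mem_univ _)).symm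
    rw [h1] at hv ⊢
    exact mul_div_mul_right _ _ (right_ne_zero_of_mul hv)
  obtain ⟨P', hP', k, hk⟩ := exists_clear_denominators hn hδ p
  have hgδ : δ g ≠ 0 := Finset.prod_ne_zero_iff.mpr fun j _ => leadingBlock_det_ne_zero hag.symm j
  have hga : (fun q => n q g / δ g) = a := by
    apply flagChart_injective b
    rw [hag, ofBasis_eq_flagChart b g fun j => leadingBlock_det_ne_zero hag.symm j]
    exact congrArg _ (funext fun q => hnδ g hgδ q)
  refine ⟨P' * δ, mul_mem hP' hδ, mul_ne_zero ?_ hgδ, fun c hc => ?_⟩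
  · have h1 : aeval (fun q => n q g / δ g) p ≠ 0 := by
      rw [hga]
      exact fun h => hPa ((hp _).trans h)
    rw [← hk g hgδ]
    exact mul_ne_zero h1 (pow_ne_zero _ hgδ)
  · obtain ⟨h1, h2⟩ := mul_ne_zero_iff.mp hc
    refine ⟨fun q => n q c / δ c, hPU _ ?_, ?_⟩
    · rw [← hk c h2] at h1
      exact fun h => left_ne_zero_of_mul h1 ((hp _).symm.trans h)
    · rw [ofBasis_eq_flagChart b c fun j => Finset.prod_ne_zero_iff.mp h2 j (Finset.mem_univ _)]
      exact congrArg _ (funext fun q => hnδ c h2 q)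

/-- The dimension of a set of flags can be bounded in the charts centred at its points. -/
theorem topologicalKrullDim_le_of_charts [FiniteDimensional ℂ V] (hV : finrank ℂ V = N)
    {Z : Set (CompleteFlag N V)} {d : WithBot ℕ∞}
    (h : ∀ b : Basis (Fin N) ℂ V, CompleteFlag.ofBasis b ∈ Z →
      topologicalKrullDim (flagChart b ⁻¹' Z) ≤ d) : topologicalKrullDim Z ≤ d := by
  refine iSup_le fun l => ?_
  obtain ⟨F, hF⟩ := l.head.isIrreducible.nonempty
  obtain ⟨b, hb⟩ := exists_ofBasis_eq hV (F : CompleteFlag N V)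
  refine le_trans ?_ (h b (hb ▸ F.2))
  have hf : Topology.IsOpenEmbedding (Z.restrictPreimage (flagChart b)) :=
    (isOpenEmbedding_flagChart b).restrictPreimage Z
  let z : Zar (LowerIdx N → ℂ) := (0 : LowerIdx N → ℂ)
  have hF0 : flagChart b z = F := by
    rw [← hb]
    refine congrArg CompleteFlag.ofBasis (Basis.eq_of_apply_eq fun j => ?_)
    rw [chartBasis_apply]
    change ∑ i, uniMat (0 : LowerIdx N → ℂ) i j • b i = b j
    rw [uniMat_zero]
    simp [Matrix.one_apply]
  have hne : ∀ i, (Z.restrictPreimage (flagChart b) ⁻¹' (l i : Set Z)).Nonempty := fun i =>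
    ⟨⟨z, by rw [Set.mem_preimage, hF0]; exact F.2⟩, by
      have : Z.restrictPreimage (flagChart b) ⟨z, by rw [Set.mem_preimage, hF0]; exact F.2⟩ = F :=
        Subtype.ext hF0
      rw [Set.mem_preimage, this]
      exact l.monotone (Fin.zero_le i) hF⟩
  -- a chain whose first member meets the chart restricts to a chain of the same length
  let e := IrreducibleCloseds.orderIsoOfIsOpenEmbedding _ hf
  let l' : LTSeries (IrreducibleCloseds (flagChart b ⁻¹' Z)) :=
    { length := l.length
      toFun := fun i => e.symm ⟨l i, hne i⟩
      step := fun i => e.symm.strictMono (l.step i) }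
  exact Order.LTSeries.length_le_krullDim l'

end Charts

/-! ### Jordan block counts of a nilpotent endomorphism -/

section KerRank

variable {K V : Type*} [Field K] [AddCommGroup V] [Module K V]

/-- The dimension of `ker x ∩ im x ^ j`. For nilpotent `x` it is the number of Jordan blocks of size
greater than `j`. -/
noncomputable def kerRank (x : End K V) (j : ℕ) : ℕ :=
  finrank K ↥(LinearMap.ker x ⊓ LinearMap.range (x ^ j))

/-- The number of pairs of Jordan blocks of size greater than `j`, summed over `j`. For nilpotent
`x` with block sizes `λ₁ ≥ λ₂ ≥ ⋯` it is `∑ (i - 1) λᵢ`, the dimension of the Springer fibre of `x`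
in the full flag variety. Larger `j` than the given range contribute nothing. -/
noncomputable def pairCount (x : End K V) : ℕ :=
  ∑ j ∈ Finset.range (finrank K V), (kerRank x j).choose 2

theorem range_pow_succ (x : End K V) (j : ℕ) :
    LinearMap.range (x ^ (j + 1)) = (LinearMap.range (x ^ j)).map x := by
  rw [pow_succ', Module.End.mul_eq_comp, LinearMap.range_comp]

theorem range_pow_le {x : End K V} {i j : ℕ} (h : i ≤ j) :
    LinearMap.range (x ^ j) ≤ LinearMap.range (x ^ i) := by
  obtain ⟨k, rfl⟩ := Nat.exists_eq_add_of_le h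
  rw [pow_add, Module.End.mul_eq_comp]
  exact LinearMap.range_comp_le_range _ _

/-- A nonzero vector `v` has a depth with respect to a nilpotent `x`: the largest `j` with
`v ∈ im x ^ j`. -/
theorem exists_depth {x : End K V} (hx : IsNilpotent x) {v : V} (hv : v ≠ 0) :
    ∃ j u, (x ^ j) u = v ∧ v ∉ LinearMap.range (x ^ (j + 1)) := by
  classical
  have hex : ∃ k, v ∉ LinearMap.range (x ^ k) := by
    obtain ⟨k, hk⟩ := hx
    exact ⟨k, by simpa [hk] using hv⟩
  have h0 : Nat.find hex ≠ 0 := by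
    intro h
    have h1 := Nat.find_spec hex
    rw [h] at h1
    simp at h1
  obtain ⟨j, hj⟩ := Nat.exists_eq_succ_of_ne_zero h0
  obtain ⟨u, hu⟩ := not_not.mp (Nat.find_min hex (m := j) (by omega))
  exact ⟨j, u, hu, by rw [← Nat.succ_eq_add_one, ← hj]; exact Nat.find_spec hex⟩

variable [FiniteDimensional K V]

theorem kerRank_anti (x : End K V) {i j : ℕ} (h : i ≤ j) : kerRank x j ≤ kerRank x i :=
  Submodule.finrank_mono (inf_le_inf_left _ (range_pow_le h))

theorem finrank_range_pow (x : End K V) (j : ℕ) :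
    finrank K (LinearMap.range (x ^ j))
      = finrank K (LinearMap.range (x ^ (j + 1))) + kerRank x j := by
  have h := LinearMap.finrank_range_add_finrank_ker (x.domRestrict (LinearMap.range (x ^ j)))
  rw [LinearMap.range_domRestrict, ← range_pow_succ, LinearMap.ker_domRestrict] at h
  rw [← h, kerRank]
  congr 1
  rw [← Submodule.finrank_map_subtype_eq, Submodule.map_comap_subtype, inf_comm]

theorem pow_finrank_eq_zero {x : End K V} (hx : IsNilpotent x) {M : ℕ} (hM : finrank K V ≤ M) :
    x ^ M = 0 := by
  have h := (IsNilpotent.charpoly_eq_X_pow_finrank hx)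
  have h2 := LinearMap.aeval_self_charpoly x
  rw [h, map_pow, Polynomial.aeval_X] at h2
  exact pow_eq_zero_of_le hM h2

theorem kerRank_eq_zero {x : End K V} (hx : IsNilpotent x) {M : ℕ} (hM : finrank K V ≤ M) :
    kerRank x M = 0 := by
  rw [kerRank, pow_finrank_eq_zero hx hM, LinearMap.range_zero, inf_bot_eq, finrank_bot]

theorem pairCount_eq_sum {x : End K V} (hx : IsNilpotent x) {M : ℕ} (hM : finrank K V ≤ M) :
    pairCount x = ∑ j ∈ Finset.range M, (kerRank x j).choose 2 := by
  refine Finset.sum_subset (Finset.range_mono hM) fun j _ hj => ?_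
  rw [kerRank_eq_zero hx (by simpa using hj), Nat.choose_zero_succ]

end KerRank

section Reduction

variable {K V V' : Type*} [Field K] [AddCommGroup V] [Module K V] [AddCommGroup V'] [Module K V']

/-- `V'`, with the form `B'`, is identified with the quotient `v^⊥ / v`. The map `s` is a section
with values in `v^⊥`, and `p` extends the quotient map to all of `V` (as the adjoint of `s`), so
that both are linear maps between the given spaces. -/
structure IsReduction (B : LinearMap.BilinForm K V) (B' : LinearMap.BilinForm K V') (v : V)
    (s : V' →ₗ[K] V) (p : V →ₗ[K] V') : Prop where
  ps : ∀ a, p (s a) = a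
  adj : ∀ a w, B (s a) w = B' a (p w)
  pv : p v = 0
  vs : ∀ a, B v (s a) = 0
  ker : ∀ w, p w = 0 → B v w = 0 → w ∈ Submodule.span K {v}
  finrank_eq : finrank K V' + 2 = finrank K V

/-- For isotropic `v ≠ 0` the quotient `v^⊥ / v` is realized by the orthogonal complement of a
hyperbolic plane through `v`. -/
theorem exists_isReduction [FiniteDimensional K V] {B : LinearMap.BilinForm K V} (hs : B.IsSymm)
    (hB : B.Nondegenerate) {v : V} (hv : v ≠ 0) (hvv : B v v = 0) :
    ∃ (H : Submodule K V) (B' : LinearMap.BilinForm K H) (s : H →ₗ[K] V) (p : V →ₗ[K] H),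
      IsReduction B B' v s p := by
  have hsy : ∀ a b, B a b = B b a := fun a b => hs.eq a b
  obtain ⟨w0, hw0⟩ : ∃ w, B v w ≠ 0 := by
    by_contra! h
    exact hv (hB.1 v h)
  let w : V := (B v w0)⁻¹ • w0
  have hw : B v w = 1 := by simp [w, hw0]
  let f : V →ₗ[K] K × K := (B v).prod (B w)
  have hf : LinearMap.range f = ⊤ := by
    rw [LinearMap.range_eq_top]
    rintro ⟨a, b⟩
    refine ⟨a • w + (b - a * B w w) • v, ?_⟩
    simp [f, hw, hvv, hsy w v]
  -- `g` is the projection to the orthogonal complement of the plane of `v` and `w`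
  let g : V →ₗ[K] V := LinearMap.id - (B v).smulRight w
    - ((B w).smulRight v - (B v).smulRight (B w w • v))
  have hg : ∀ a, g a = a - B v a • w - (B w a • v - B v a • B w w • v) := fun a => rfl
  have hgf : ∀ a, g a ∈ LinearMap.ker f := by
    intro a
    simp [f, hg, hw, hvv, hsy w v]
  have hkf : ∀ a : LinearMap.ker f, B v a = 0 ∧ B w a = 0 := fun a => by
    have h := LinearMap.mem_ker.mp a.2
    exact ⟨congrArg Prod.fst h, congrArg Prod.snd h⟩
  refine ⟨LinearMap.ker f, B.restrict _, (LinearMap.ker f).subtype, g.codRestrict _ hgf, ?_⟩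
  refine ⟨fun a => ?_, fun a c => ?_, ?_, fun a => (hkf a).1, fun a h1 h2 => ?_, ?_⟩
  · ext
    simp [hg, (hkf a).1, (hkf a).2]
  · have h1 := (hkf a).1
    have h2 := (hkf a).2
    rw [hsy] at h1 h2
    simp [hg, LinearMap.BilinForm.restrict, LinearMap.domRestrict₁₂_apply, h1, h2]
  · ext
    simp [hg, hvv, hsy w v, hw]
  · have h3 : g a = 0 := congrArg Subtype.val h1
    rw [hg, h2, zero_smul, zero_smul, sub_zero, sub_zero, sub_eq_zero] at h3
    rw [h3]
    exact Submodule.smul_mem _ _ (Submodule.mem_span_singleton_self v)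
  · have h := LinearMap.finrank_range_add_finrank_ker f
    rw [hf, finrank_top, finrank_prod, finrank_self] at h
    omega

end Reduction

/-! ### Passage to the quotient of the orthogonal complement of an isotropic vector -/

section SelfAdjoint

variable {K V V' : Type*} [Field K] [AddCommGroup V] [Module K V] [AddCommGroup V'] [Module K V']

theorem finrank_map_add_finrank_inf_ker [FiniteDimensional K V] (f : V →ₗ[K] V')
    (W : Submodule K V) :
    finrank K (W.map f) + finrank K ↥(W ⊓ LinearMap.ker f) = finrank K W := by
  have h := LinearMap.finrank_range_add_finrank_ker (f.domRestrict W)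
  rw [LinearMap.range_domRestrict, LinearMap.ker_domRestrict] at h
  rw [← h]
  congr 1
  rw [← Submodule.finrank_map_subtype_eq, Submodule.map_comap_subtype]

theorem finrank_add_one_le_of_mem [FiniteDimensional K V] [FiniteDimensional K V']
    (f : V →ₗ[K] V') {U : Submodule K V'} (hU : ∀ w, f w ∈ U) {v : V'} (hv : v ≠ 0) (hvU : v ∈ U) :
    finrank K V + 1 ≤ finrank K ((Submodule.span K {v}).comap f) + finrank K U := by
  have h1 := LinearMap.finrank_range_add_finrank_ker ((Submodule.span K {v}).mkQ ∘ₗ f)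
  rw [LinearMap.ker_comp, Submodule.ker_mkQ] at h1
  have h2 := finrank_map_add_finrank_inf_ker (Submodule.span K {v}).mkQ U
  rw [Submodule.ker_mkQ, inf_eq_right.mpr ((Submodule.span_singleton_le_iff_mem v U).mpr hvU),
    finrank_span_singleton hv] at h2
  have h3 : LinearMap.range ((Submodule.span K {v}).mkQ ∘ₗ f)
      ≤ U.map (Submodule.span K {v}).mkQ := by
    rintro _ ⟨w, rfl⟩
    exact Submodule.mem_map_of_mem (hU w)
  have h4 := Submodule.finrank_mono h3
  omega

/-- The sum of the spaces `im x ^ k ∩ ker x ^ k`. For self-adjoint nilpotent `x` with Jordan type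
`(2 p₁ + 1, 2 p₂, …)` it is spanned by the lower halves of the Jordan strings, and is the only
candidate for the middle space `V_n` of the flags in a component of top dimension. -/
def coreSpace (x : End K V) : Submodule K V :=
  ⨆ k, LinearMap.range (x ^ k) ⊓ LinearMap.ker (x ^ k)

variable {B : LinearMap.BilinForm K V} {x : End K V}

theorem pow_adjoint (hx : ∀ v w, B (x v) w = B v (x w)) (k : ℕ) (v w : V) :
    B ((x ^ k) v) w = B v ((x ^ k) w) := by
  induction k generalizing v with
  | zero => rfl
  | succ k ih => rw [pow_succ, Module.End.mul_apply, ih, hx, ← Module.End.mul_apply,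
      ← pow_succ', pow_succ]

/-- For self-adjoint `x` the image of `x ^ k` is the orthogonal of its kernel. -/
theorem mem_range_pow_iff [FiniteDimensional K V] (hs : B.IsSymm) (hB : B.Nondegenerate)
    (hx : ∀ v w, B (x v) w = B v (x w)) (k : ℕ) (v : V) :
    v ∈ LinearMap.range (x ^ k) ↔ ∀ z, (x ^ k) z = 0 → B v z = 0 := by
  have h1 : LinearMap.range (x ^ k) ≤ B.orthogonal (LinearMap.ker (x ^ k)) := by
    rintro _ ⟨w, rfl⟩ z hz
    rw [← pow_adjoint hx, LinearMap.mem_ker.mp hz, map_zero,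
      LinearMap.zero_apply]
  have h2 : LinearMap.range (x ^ k) = B.orthogonal (LinearMap.ker (x ^ k)) := by
    refine Submodule.eq_of_le_of_finrank_eq h1 ?_
    rw [LinearMap.BilinForm.finrank_orthogonal hB]
    have := LinearMap.finrank_range_add_finrank_ker (x ^ k)
    omega
  rw [h2, LinearMap.BilinForm.mem_orthogonal_iff]
  refine forall_congr' fun z => ?_
  rw [LinearMap.mem_ker, ← hs.eq v z]

variable {B' : LinearMap.BilinForm K V'} {v : V} {s : V' →ₗ[K] V} {p : V →ₗ[K] V'}

namespace IsReduction

theorem sub_mem (h : IsReduction B B' v s p) {w : V} (hw : B v w = 0) :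
    w - s (p w) ∈ Submodule.span K {v} :=
  h.ker _ (by rw [map_sub, h.ps, sub_self]) (by rw [map_sub, hw, h.vs, sub_zero])

theorem symm (h : IsReduction B B' v s p) (hs : B.IsSymm) : B'.IsSymm :=
  ⟨fun a b => by
    have h1 := h.adj a (s b)
    have h2 := h.adj b (s a)
    rw [h.ps] at h1 h2
    rw [← h1, ← h2]
    exact hs.eq _ _⟩

theorem nondegenerate [FiniteDimensional K V'] (h : IsReduction B B' v s p) (hs : B.IsSymm)
    (hB : B.Nondegenerate) :
    B'.Nondegenerate := by
  have h1 : ∀ a, (∀ b, B' a b = 0) → a = 0 := fun a ha => by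
    rw [← h.ps a, hB.1 (s a) fun w => by rw [h.adj, ha], map_zero]
  exact ⟨h1, fun a ha => h1 a fun b => by exact ((h.symm hs).eq a b).trans (ha b)⟩

theorem adjoint (h : IsReduction B B' v s p) (hs : B.IsSymm)
    (hx : ∀ v w, B (x v) w = B v (x w)) (a b : V') :
    B' ((p ∘ₗ x ∘ₗ s) a) b = B' a ((p ∘ₗ x ∘ₗ s) b) := by
  rw [LinearMap.comp_apply, LinearMap.comp_apply, LinearMap.comp_apply, LinearMap.comp_apply,
    ← h.adj, ← hx]
  refine ((h.symm hs).eq b _).symm.trans ?_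
  refine (h.adj b _).symm.trans ?_
  exact hs.eq (s b) _

variable (h : IsReduction B B' v s p) (hx : ∀ v w, B (x v) w = B v (x w)) (hxv : x v = 0)
include h hxv

theorem map_apply {w : V} (hw : B v w = 0) : p (x (s (p w))) = p (x w) := by
  obtain ⟨c, hc⟩ := Submodule.mem_span_singleton.mp (h.sub_mem hw)
  have h1 : w = s (p w) + c • v := by rw [hc]; abel
  conv_rhs => rw [h1]
  rw [map_add, map_smul, hxv, smul_zero, add_zero]

include hx

omit h in
theorem bilin_apply (w : V) : B v (x w) = 0 := by
  rw [← hx, hxv, map_zero, LinearMap.zero_apply]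

/-- On `v^⊥` the endomorphism induced by `x` on `v^⊥ / v` is compatible with the quotient map, and
so are its powers. -/
theorem pow_apply {w : V} (hw : B v w = 0) (i : ℕ) :
    ((p ∘ₗ x ∘ₗ s : End K V') ^ i) (p w) = p ((x ^ i) w) := by
  induction i generalizing w with
  | zero => rfl
  | succ i ih =>
    rw [pow_succ, Module.End.mul_apply, LinearMap.comp_apply, LinearMap.comp_apply,
      h.map_apply hxv hw, ih (bilin_apply hx hxv w), pow_succ, Module.End.mul_apply]

theorem isNilpotent (hn : IsNilpotent x) : IsNilpotent (p ∘ₗ x ∘ₗ s : End K V') := by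
  obtain ⟨k, hk⟩ := hn
  refine ⟨k, LinearMap.ext fun a => ?_⟩
  rw [← h.ps a, h.pow_apply hx hxv (h.vs a), hk, LinearMap.zero_apply, map_zero,
    LinearMap.zero_apply]

theorem range_pow (i : ℕ) : LinearMap.range ((p ∘ₗ x ∘ₗ s : End K V') ^ i)
    = ((LinearMap.ker (B v)).map (x ^ i)).map p := by
  ext a
  constructor
  · rintro ⟨b, rfl⟩
    rw [← h.ps b, h.pow_apply hx hxv (h.vs b)]
    exact ⟨_, ⟨s b, h.vs b, rfl⟩, rfl⟩
  · rintro ⟨_, ⟨w, hw, rfl⟩, rfl⟩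
    exact ⟨p w, h.pow_apply hx hxv hw i⟩

variable [FiniteDimensional K V] (hs : B.IsSymm) (hB : B.Nondegenerate) (hv : v ≠ 0)
include hs hB hv

omit h hxv in
/-- The rank of `x ^ i` drops on the hyperplane `v^⊥` exactly when `v` is in the image of
`x ^ i`. -/
theorem finrank_map_ker (i : ℕ) :
    (v ∈ LinearMap.range (x ^ i) →
      finrank K ((LinearMap.ker (B v)).map (x ^ i)) + 1 = finrank K (LinearMap.range (x ^ i))) ∧
    (v ∉ LinearMap.range (x ^ i) →
      finrank K ((LinearMap.ker (B v)).map (x ^ i)) = finrank K (LinearMap.range (x ^ i))) := by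
  have hBv : B v ≠ 0 := fun h0 => hv (hB.1 v fun w => by rw [h0, LinearMap.zero_apply])
  have h1 := finrank_map_add_finrank_inf_ker (x ^ i) (LinearMap.ker (B v))
  have h2 := Module.Dual.finrank_ker_add_one_of_ne_zero hBv
  have h3 := LinearMap.finrank_range_add_finrank_ker (x ^ i)
  have h4 := finrank_map_add_finrank_inf_ker (B v) (LinearMap.ker (x ^ i))
  rw [inf_comm] at h4
  constructor
  · intro hr
    rw [mem_range_pow_iff hs hB hx] at hr
    rw [inf_eq_right.mpr fun z hz => hr z hz] at h1
    omega
  · intro hr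
    rw [mem_range_pow_iff hs hB hx] at hr
    push Not at hr
    obtain ⟨z, hz, hz0⟩ := hr
    have h5 : (LinearMap.ker (x ^ i)).map (B v) = ⊤ := by
      rw [eq_top_iff]
      intro c _
      exact ⟨(c / B v z) • z, Submodule.smul_mem _ _ hz, by simp [hz0]⟩
    rw [h5, finrank_top, finrank_self] at h4
    omega

/-- How the ranks of the powers change in the passage from `x` to the endomorphism of `v^⊥ / v`. -/
theorem finrank_range_pow_eq (i : ℕ) :
    (v ∈ (LinearMap.ker (B v)).map (x ^ i) →
      finrank K (LinearMap.range ((p ∘ₗ x ∘ₗ s : End K V') ^ i)) + 2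
        = finrank K (LinearMap.range (x ^ i))) ∧
    (v ∈ LinearMap.range (x ^ i) → v ∉ (LinearMap.ker (B v)).map (x ^ i) →
      finrank K (LinearMap.range ((p ∘ₗ x ∘ₗ s : End K V') ^ i)) + 1
        = finrank K (LinearMap.range (x ^ i))) ∧
    (v ∉ LinearMap.range (x ^ i) →
      finrank K (LinearMap.range ((p ∘ₗ x ∘ₗ s : End K V') ^ i))
        = finrank K (LinearMap.range (x ^ i))) := by
  obtain ⟨h1, h2⟩ := finrank_map_ker hx hs hB hv i
  rw [h.range_pow hx hxv]
  have h3 := finrank_map_add_finrank_inf_ker p ((LinearMap.ker (B v)).map (x ^ i))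
  have hle : (LinearMap.ker (B v)).map (x ^ i) ≤ LinearMap.ker (B v) := by
    rintro _ ⟨w, hw, rfl⟩
    rcases i with _ | i
    · exact hw
    · rw [pow_succ']
      exact bilin_apply hx hxv _
  have hk : ∀ w ∈ (LinearMap.ker (B v)).map (x ^ i) ⊓ LinearMap.ker p,
      w ∈ Submodule.span K {v} := fun w hw => h.ker w hw.2 (hle hw.1)
  have hin : v ∈ (LinearMap.ker (B v)).map (x ^ i) →
      finrank K ((LinearMap.ker (B v)).map (x ^ i) ⊓ LinearMap.ker p : Submodule K V) = 1 := by
    intro hm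
    rw [le_antisymm hk ((Submodule.span_singleton_le_iff_mem v _).mpr
      (Submodule.mem_inf.mpr ⟨hm, h.pv⟩)),
      finrank_span_singleton hv]
  have hout : v ∉ (LinearMap.ker (B v)).map (x ^ i) →
      finrank K ((LinearMap.ker (B v)).map (x ^ i) ⊓ LinearMap.ker p : Submodule K V) = 0 := by
    intro hm
    rw [Submodule.finrank_eq_zero, eq_bot_iff]
    intro w hw
    obtain ⟨c, rfl⟩ := Submodule.mem_span_singleton.mp (hk w hw)
    rcases eq_or_ne c 0 with rfl | hc
    · simp
    · exact absurd ((Submodule.smul_mem_iff _ hc).mp hw.1) hm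
  have hsub : v ∈ (LinearMap.ker (B v)).map (x ^ i) → v ∈ LinearMap.range (x ^ i) :=
    fun hm => LinearMap.map_le_range hm
  refine ⟨fun hm => ?_, fun hr hm => ?_, fun hr => ?_⟩
  · have := hin hm; have := h1 (hsub hm); omega
  · have := hout hm; have := h1 hr; omega
  · have := hout fun hm => hr (hsub hm); have := h2 hr; omega

variable {j : ℕ} {u : V} (hu : (x ^ j) u = v) (hvj : v ∉ LinearMap.range (x ^ (j + 1)))
include hu hvj

omit h hB hv hxv hs hvj [FiniteDimensional K V] in
theorem mem_map_iff {i : ℕ} (hi : i ≤ j) :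
    v ∈ (LinearMap.ker (B v)).map (x ^ i) ↔ B v ((x ^ (j - i)) u) = 0 := by
  have hpow : (x ^ i) ((x ^ (j - i)) u) = v := by
    rw [← Module.End.mul_apply, ← pow_add, Nat.add_sub_cancel' hi, hu]
  constructor
  · rintro ⟨w, hw, hwv⟩
    have h1 : B v ((x ^ (j - i)) u - w) = 0 := by
      conv_lhs => rw [← hpow]
      rw [pow_adjoint hx, map_sub, hpow, hwv, sub_self, map_zero]
    rw [map_sub, LinearMap.mem_ker.mp hw, sub_zero] at h1
    exact h1
  · exact fun h0 => ⟨_, h0, hpow⟩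

theorem finrank_range_pow_of_ne :
    (∀ i < j, finrank K (LinearMap.range ((p ∘ₗ x ∘ₗ s : End K V') ^ i)) + 2
        = finrank K (LinearMap.range (x ^ i))) ∧
    (∀ i > j, finrank K (LinearMap.range ((p ∘ₗ x ∘ₗ s : End K V') ^ i))
        = finrank K (LinearMap.range (x ^ i))) := by
  refine ⟨fun i hi => ?_, fun i hi => ?_⟩
  · refine (h.finrank_range_pow_eq hx hxv hs hB hv i).1 ?_
    rw [mem_map_iff hx hu hi.le, ← pow_adjoint hx]
    obtain ⟨k, hk⟩ := Nat.exists_eq_add_of_lt hi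
    rw [hk, show i + k + 1 - i = k + 1 by omega, pow_succ, Module.End.mul_apply, hxv, map_zero,
      map_zero, LinearMap.zero_apply]
  · exact (h.finrank_range_pow_eq hx hxv hs hB hv i).2.2 fun hm => hvj (range_pow_le hi hm)

/-- Let `v = x ^ j u` have depth `j`. If `⟨v, u⟩ = 0`, the passage to `v^⊥ / v` shortens two blocks
of size `j + 1` by one. -/
theorem kerRank_eq_of_bilin_eq_zero [FiniteDimensional K V'] (hvu : B v u = 0) :
    kerRank (p ∘ₗ x ∘ₗ s) j + 2 = kerRank x j ∧
      ∀ i ≠ j, kerRank (p ∘ₗ x ∘ₗ s) i = kerRank x i := by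
  obtain ⟨hlt, hgt⟩ := h.finrank_range_pow_of_ne hx hxv hs hB hv hu hvj
  have heq := (h.finrank_range_pow_eq hx hxv hs hB hv j).1 (by
    rw [mem_map_iff hx hu le_rfl, Nat.sub_self, pow_zero, Module.End.one_apply, hvu])
  have hle : ∀ i ≤ j, finrank K (LinearMap.range ((p ∘ₗ x ∘ₗ s : End K V') ^ i)) + 2
      = finrank K (LinearMap.range (x ^ i)) := fun i hi => by
    rcases hi.lt_or_eq with hi | rfl
    exacts [hlt i hi, heq]
  have hr := finrank_range_pow x
  have hr' := finrank_range_pow (p ∘ₗ x ∘ₗ s : End K V')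
  refine ⟨?_, fun i hi => ?_⟩
  · have := hgt (j + 1) (Nat.lt_succ_self j); have := hr j; have := hr' j; omega
  · have := hr i
    have := hr' i
    rcases lt_or_gt_of_ne hi with hi | hi
    · have := hle i hi.le; have := hle (i + 1) hi; omega
    · have := hgt i hi; have := hgt (i + 1) (by omega); omega

/-- Let `v = x ^ j u` have depth `j`. If `⟨v, u⟩ ≠ 0`, the passage to `v^⊥ / v` shortens one block
of size `j + 1` by two. -/
theorem kerRank_eq_of_bilin_ne_zero [FiniteDimensional K V'] (hvv : B v v = 0) (hvu : B v u ≠ 0) :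
    ∃ k, j = k + 1 ∧ kerRank (p ∘ₗ x ∘ₗ s) j + 1 = kerRank x j ∧
      kerRank (p ∘ₗ x ∘ₗ s) k + 1 = kerRank x k ∧
      ∀ i ≠ j, i ≠ k → kerRank (p ∘ₗ x ∘ₗ s) i = kerRank x i := by
  obtain ⟨hlt, hgt⟩ := h.finrank_range_pow_of_ne hx hxv hs hB hv hu hvj
  have heq := (h.finrank_range_pow_eq hx hxv hs hB hv j).2.1 ⟨u, hu⟩ (by
    rwa [mem_map_iff hx hu le_rfl, Nat.sub_self, pow_zero, Module.End.one_apply])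
  have hr := finrank_range_pow x
  have hr' := finrank_range_pow (p ∘ₗ x ∘ₗ s : End K V')
  obtain ⟨k, rfl⟩ : ∃ k, j = k + 1 := by
    refine Nat.exists_eq_succ_of_ne_zero ?_
    rintro rfl
    rw [pow_zero, Module.End.one_apply] at hu
    exact hvu (hu ▸ hvv)
  refine ⟨k, rfl, ?_, ?_, fun i hi hik => ?_⟩
  · have := hgt (k + 1 + 1) (by omega); have := hr (k + 1); have := hr' (k + 1); omega
  · have := hlt k (by omega); have := hr k; have := hr' k; omega
  · have := hr i
    have := hr' i
    rcases lt_or_gt_of_ne hi with hi | hi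
    · have := hlt i hi; have := hlt (i + 1) (by omega); omega
    · have := hgt i hi; have := hgt (i + 1) (by omega); omega

end IsReduction
end SelfAdjoint

/-! ### Connections that preserve a form and a self-adjoint operator -/

section Connection

variable {K V V' E : Type*} [Field K] [AddCommGroup V] [Module K V] [AddCommGroup V'] [Module K V']
  [AddCommGroup E] [Module K E]

/-- A space `E` of operators `nab D` on `V`, additive and satisfying the Leibniz rule for `δ D`,
which commute with `x` and preserve `B`. In the application `E` consists of the derivations of the
field `K`, acting on the coordinates of vectors of `K ^ N`, and `x` and `B` have constant
coefficients; for a generic flag of a subvariety these operators are its tangent vectors. -/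
structure IsConnection (B : LinearMap.BilinForm K V) (x : End K V) (δ : E →ₗ[K] (K → K))
    (nab : E →ₗ[K] (V → V)) : Prop where
  nab_add : ∀ D v w, nab D (v + w) = nab D v + nab D w
  leibniz : ∀ D c v, nab D (c • v) = δ D c • v + c • nab D v
  comm : ∀ D v, nab D (x v) = x (nab D v)
  compat : ∀ D v w, δ D (B v w) = B (nab D v) w + B v (nab D w)

/-- The isotropic half of a flag in the fibre over `x`: subspaces `F i` of dimension `i`, for
`i ≤ n`, with `x F (i + 1) ⊆ F i`, and `F n` isotropic. The values of `F` beyond `n` play no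
role. -/
structure IsIsotropicFlag (B : LinearMap.BilinForm K V) (x : End K V) (n : ℕ)
    (F : ℕ → Submodule K V) : Prop where
  mono : ∀ i < n, F i ≤ F (i + 1)
  finrank_eq : ∀ i ≤ n, finrank K (F i) = i
  isotropic : ∀ v ∈ F n, ∀ w ∈ F n, B v w = 0
  map_mem : ∀ i < n, ∀ v ∈ F (i + 1), x v ∈ F i

theorem IsIsotropicFlag.le {B : LinearMap.BilinForm K V} {x : End K V} {n : ℕ}
    {F : ℕ → Submodule K V} (h : IsIsotropicFlag B x n F) {i j : ℕ} (hij : i ≤ j) (hj : j ≤ n) :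
    F i ≤ F j := by
  induction j, hij using Nat.le_induction with
  | base => exact le_rfl
  | succ j hij ih => exact (ih (by omega)).trans (h.mono j (by omega))

section Step

variable {B : LinearMap.BilinForm K V} {x : End K V} {B' : LinearMap.BilinForm K V'} {v : V}
  {s : V' →ₗ[K] V} {p : V →ₗ[K] V'} {δ : E →ₗ[K] (K → K)} {nab : E →ₗ[K] (V → V)}

/-- The operators that preserve the line of `v`. -/
def stabDir (nab : E →ₗ[K] (V → V)) (v : V) : Submodule K E :=
  (Submodule.span K {v}).comap (LinearMap.proj v ∘ₗ nab)

/-- The operators induced on `v^⊥ / v` by those that preserve the line of `v`. -/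
def reducedNab (nab : E →ₗ[K] (V → V)) (v : V) (s : V' →ₗ[K] V) (p : V →ₗ[K] V') :
    stabDir nab v →ₗ[K] (V' → V') where
  toFun D a := p (nab D (s a))
  map_add' D D' := by ext a; simp
  map_smul' c D := by ext a; simp

theorem reducedNab_apply (D : stabDir nab v) (a : V') :
    reducedNab nab v s p D a = p (nab D (s a)) := rfl

theorem IsConnection.mem_span (hc : IsConnection B x δ nab) {D : E} (hD : D ∈ stabDir nab v)
    {w : V} (hw : w ∈ Submodule.span K {v}) : nab D w ∈ Submodule.span K {v} := by
  obtain ⟨c, rfl⟩ := Submodule.mem_span_singleton.mp hw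
  rw [hc.leibniz]
  exact add_mem (Submodule.smul_mem _ _ (Submodule.mem_span_singleton_self v))
    (Submodule.smul_mem _ _ hD)

theorem IsConnection.delta_zero (hc : IsConnection B x δ nab) (D : E) : δ D 0 = 0 := by
  simpa using hc.compat D 0 0

theorem IsReduction.p_eq_zero (h : IsReduction B B' v s p) {w : V}
    (hw : w ∈ Submodule.span K {v}) : p w = 0 := by
  obtain ⟨c, rfl⟩ := Submodule.mem_span_singleton.mp hw
  rw [_root_.map_smul, h.pv, smul_zero]

theorem IsConnection.bilin_nab_eq_zero (hc : IsConnection B x δ nab) {D : E}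
    (hD : D ∈ stabDir nab v) {w : V} (hw : B v w = 0) : B v (nab D w) = 0 := by
  have h1 := hc.compat D v w
  obtain ⟨c, hcv⟩ := Submodule.mem_span_singleton.mp hD
  have hcv' : c • v = nab D v := hcv
  rwa [hw, hc.delta_zero, ← hcv', map_smul, LinearMap.smul_apply, hw, smul_zero, zero_add,
    eq_comm] at h1

theorem IsConnection.p_nab (hc : IsConnection B x δ nab) (h : IsReduction B B' v s p)
    {D : E} (hD : D ∈ stabDir nab v) {w : V} (hw : B v w = 0) :
    p (nab D w) = p (nab D (s (p w))) := by
  have h1 : w = (w - s (p w)) + s (p w) := by abel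
  conv_lhs => rw [h1]
  rw [hc.nab_add, map_add, h.p_eq_zero (hc.mem_span hD (h.sub_mem hw)), zero_add]

theorem IsConnection.reduced (hc : IsConnection B x δ nab) (h : IsReduction B B' v s p)
    (hs : B.IsSymm) (hx : ∀ v w, B (x v) w = B v (x w)) (hxv : x v = 0) :
    IsConnection B' (p ∘ₗ x ∘ₗ s : End K V') (δ ∘ₗ (stabDir nab v).subtype)
      (reducedNab nab v s p) := by
  refine ⟨fun D a b => ?_, fun D c a => ?_, fun D a => ?_, fun D a b => ?_⟩
  · simp [reducedNab_apply, hc.nab_add]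
  · simp [reducedNab_apply, hc.leibniz, h.ps]
  · simp only [reducedNab_apply, LinearMap.comp_apply]
    rw [← hc.p_nab h D.2 (IsReduction.bilin_apply hx hxv _), hc.comm,
      h.map_apply hxv (hc.bilin_nab_eq_zero D.2 (h.vs a))]
  · have h1 := hc.compat D (s a) (s b)
    have h2 : B (nab D (s a)) (s b) = B' (p (nab D (s a))) b :=
      ((hs.eq _ _).symm.trans (h.adj b _)).trans ((h.symm hs).eq _ _)
    rwa [h2, h.adj, h.adj, h.ps] at h1

/-- The flag induced on `v^⊥ / v`, for `v` spanning the first space of the flag. -/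
def reducedFlag (p : V →ₗ[K] V') (F : ℕ → Submodule K V) (i : ℕ) : Submodule K V' :=
  (F (i + 1)).map p

theorem IsConnection.nab_zero (hc : IsConnection B x δ nab) (D : E) : nab D 0 = 0 := by
  simpa using hc.nab_add D 0 0

theorem IsConnection.comm_pow (hc : IsConnection B x δ nab) (D : E) (j : ℕ) (w : V) :
    nab D ((x ^ j) w) = (x ^ j) (nab D w) := by
  induction j generalizing w with
  | zero => rfl
  | succ j ih =>
    rw [pow_succ', Module.End.mul_apply, hc.comm, ih, Module.End.mul_apply]

/-- The first line of the flag can only move inside `ker x ∩ im x ^ j`, with `j` the depth of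
`v`. -/
theorem IsConnection.nab_mem (hc : IsConnection B x δ nab) (hxv : x v = 0)
    {j : ℕ} {u : V} (hu : (x ^ j) u = v) (D : E) :
    nab D v ∈ LinearMap.ker x ⊓ LinearMap.range (x ^ j) := by
  refine Submodule.mem_inf.mpr ⟨?_, nab D u, ?_⟩
  · rw [LinearMap.mem_ker, ← hc.comm, hxv, hc.nab_zero]
  · rw [← hc.comm_pow, hu]

theorem IsIsotropicFlag.bilin_eq_zero {n : ℕ} {F : ℕ → Submodule K V}
    (hF : IsIsotropicFlag B x (n + 1) F) (hv : v ∈ F 1) {i : ℕ} (hi : i ≤ n + 1) {w : V}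
    (hw : w ∈ F i) : B v w = 0 :=
  hF.isotropic v (hF.le (by omega) le_rfl hv) w (hF.le hi le_rfl hw)

/-- If `v = x ^ j u` with `⟨v, u⟩ ≠ 0`, the core space of `x` is orthogonal to `v` and maps into the
core space of the endomorphism of `v^⊥ / v`. -/
theorem coreSpace_le (hx : ∀ v w, B (x v) w = B v (x w)) (h : IsReduction B B' v s p)
    (hxv : x v = 0) {j : ℕ} {u : V} (hu : (x ^ j) u = v) (hvu : B v u ≠ 0) :
    coreSpace x ≤ (coreSpace (p ∘ₗ x ∘ₗ s)).comap p ⊓ LinearMap.ker (B v) := by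
  refine iSup_le fun k w => ?_
  rintro ⟨⟨a, rfl⟩, hk⟩
  rcases k with _ | k
  · have h0 : (x ^ 0) a = 0 := hk
    rw [h0]
    exact zero_mem _
  have hk' : (x ^ (k + 1)) ((x ^ (k + 1)) a) = 0 := hk
  refine ⟨?_, ?_⟩
  · let c := B v a / B v u
    -- correct `a` by a multiple of `u` so as to lie in `v^⊥`
    have hva : B v (a - c • u) = 0 := by simp [c, hvu]
    have hxu : B v (x u) = 0 := IsReduction.bilin_apply hx hxv u
    have hxj : ∀ i, j < i → (x ^ i) u = 0 := by
      intro i hi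
      obtain ⟨l, rfl⟩ := Nat.exists_eq_add_of_lt hi
      rw [show j + l + 1 = l + 1 + j by omega, pow_add, Module.End.mul_apply, hu, pow_succ,
        Module.End.mul_apply, hxv, map_zero]
    -- the coefficient `c` vanishes when `x ^ (2k)` does not kill `u`
    have hc : c • (x ^ (k + 1)) ((x ^ (k + 1)) u) = 0 := by
      rw [← Module.End.mul_apply, ← pow_add]
      rcases lt_or_ge j (k + 1 + (k + 1)) with hj | hj
      · rw [hxj _ hj, smul_zero]
      · have h1 : B v a = 0 := by
          obtain ⟨l, hl⟩ := Nat.exists_eq_add_of_le hj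
          rw [← hu, pow_adjoint hx, hl, add_comm, pow_add, Module.End.mul_apply, pow_add,
            Module.End.mul_apply, hk', map_zero, map_zero]
        simp [c, h1]
    have hsplit : (x ^ (k + 1)) a = (x ^ (k + 1)) (a - c • u) + c • (x ^ k) (x u) := by
      rw [map_sub, map_smul, ← Module.End.mul_apply _ x, ← pow_succ]
      abel
    change p ((x ^ (k + 1)) a) ∈ coreSpace (p ∘ₗ x ∘ₗ s)
    rw [hsplit, map_add]
    refine add_mem ?_ ?_
    · refine Submodule.mem_iSup_of_mem (k + 1) (Submodule.mem_inf.mpr ⟨⟨p (a - c • u), ?_⟩, ?_⟩)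
      · rw [h.pow_apply hx hxv hva]
      · rw [LinearMap.mem_ker, ← h.pow_apply hx hxv hva, h.pow_apply hx hxv hva,
          h.pow_apply hx hxv]
        · rw [map_sub, map_sub, hk', map_smul, map_smul, hc, sub_zero, map_zero]
        · rw [pow_succ', Module.End.mul_apply]
          exact IsReduction.bilin_apply hx hxv _
    · rw [map_smul, ← h.pow_apply hx hxv hxu]
      by_cases hc0 : c = 0
      · rw [hc0, zero_smul]
        exact zero_mem _
      refine Submodule.smul_mem _ _
        (Submodule.mem_iSup_of_mem k (Submodule.mem_inf.mpr ⟨⟨_, rfl⟩, ?_⟩))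
      have h2 := (smul_eq_zero.mp hc).resolve_left hc0
      rw [← Module.End.mul_apply, ← pow_add] at h2
      rw [LinearMap.mem_ker, ← Module.End.mul_apply, ← pow_add, h.pow_apply hx hxv hxu,
        ← Module.End.mul_apply, ← pow_succ]
      -- `x ^ (2k + 1) u` is killed by `x`, and so lies on the line of `v` or vanishes
      rcases lt_trichotomy j (k + k + 1) with hj | hj | hj
      · rw [hxj _ hj, map_zero]
      · rw [← hj, hu, h.pv]
      · exfalso
        obtain ⟨l, hl⟩ := Nat.exists_eq_add_of_lt hj
        have h3 : v = 0 := by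
          rw [← hu, hl, show k + k + 1 + l + 1 = l + (k + 1 + (k + 1)) by omega, pow_add,
            Module.End.mul_apply, h2, map_zero]
        rw [h3] at hvu
        simp at hvu
  · change B v ((x ^ (k + 1)) a) = 0
    rw [pow_succ', Module.End.mul_apply]
    exact IsReduction.bilin_apply hx hxv _

variable [FiniteDimensional K V]

theorem IsIsotropicFlag.span_eq {n : ℕ} {F : ℕ → Submodule K V}
    (hF : IsIsotropicFlag B x (n + 1) F) (hv : v ∈ F 1) (hv0 : v ≠ 0) :
    F 1 = Submodule.span K {v} := by
  refine (Submodule.eq_of_le_of_finrank_eq ((Submodule.span_singleton_le_iff_mem v _).mpr hv)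
    ?_).symm
  rw [finrank_span_singleton hv0, hF.finrank_eq 1 (by omega)]

theorem IsIsotropicFlag.reduced {n : ℕ} {F : ℕ → Submodule K V}
    (hF : IsIsotropicFlag B x (n + 1) F) (h : IsReduction B B' v s p) (hv : v ∈ F 1)
    (hv0 : v ≠ 0) (hxv : x v = 0) :
    IsIsotropicFlag B' (p ∘ₗ x ∘ₗ s) n (reducedFlag p F) := by
  have h1 : ∀ {i}, 1 ≤ i → i ≤ n + 1 → v ∈ F i := fun h1 h2 => hF.le h1 h2 hv
  refine ⟨fun i hi => Submodule.map_mono (hF.mono _ (by omega)), fun i hi => ?_, ?_,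
    fun i hi => ?_⟩
  · have h2 := finrank_map_add_finrank_inf_ker p (F (i + 1))
    have h3 : F (i + 1) ⊓ LinearMap.ker p = Submodule.span K {v} := by
      refine le_antisymm (fun w hw => h.ker w hw.2 (hF.bilin_eq_zero hv (by omega) hw.1)) ?_
      exact (Submodule.span_singleton_le_iff_mem v _).mpr
        (Submodule.mem_inf.mpr ⟨h1 (by omega) (by omega), h.pv⟩)
    rw [h3, finrank_span_singleton hv0, hF.finrank_eq _ (by omega)] at h2
    exact Nat.add_right_cancel h2
  · rintro _ ⟨w, hw, rfl⟩ _ ⟨w', hw', rfl⟩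
    rw [← h.adj]
    obtain ⟨c, hcv⟩ := Submodule.mem_span_singleton.mp
      (h.sub_mem (hF.bilin_eq_zero hv le_rfl hw))
    have h2 : s (p w) = w - c • v := by rw [hcv]; abel
    rw [h2, map_sub, map_smul, LinearMap.sub_apply, LinearMap.smul_apply,
      hF.isotropic _ hw _ hw', hF.bilin_eq_zero hv le_rfl hw', smul_zero, sub_zero]
  · rintro _ ⟨w, hw, rfl⟩
    refine ⟨x w, hF.map_mem (i + 1) (by omega) w hw, ?_⟩
    rw [LinearMap.comp_apply, LinearMap.comp_apply,
      h.map_apply hxv (hF.bilin_eq_zero hv (by omega) hw)]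

/-- An operator that preserves the line of `v` and the flag induced on `v^⊥ / v` preserves the
flag. -/
theorem IsConnection.reduced_faithful {n : ℕ} {F : ℕ → Submodule K V}
    (hc : IsConnection B x δ nab) (hF : IsIsotropicFlag B x (n + 1) F)
    (h : IsReduction B B' v s p) (hv : v ∈ F 1) (hv0 : v ≠ 0)
    (hE : ∀ D : E, (∀ i ≤ n + 1, ∀ w ∈ F i, nab D w ∈ F i) → D = 0) (D : stabDir nab v)
    (hD : ∀ i ≤ n, ∀ w ∈ reducedFlag p F i, reducedNab nab v s p D w ∈ reducedFlag p F i) :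
    D = 0 := by
  have hspan := hF.span_eq hv hv0
  refine Subtype.ext (hE D fun i hi w hw => ?_)
  rcases i with _ | i
  · have h0 : F 0 = ⊥ := Submodule.finrank_eq_zero.mp (hF.finrank_eq 0 (by omega))
    rw [h0, Submodule.mem_bot] at hw ⊢
    have h1 := hc.nab_add D 0 0
    rw [hw]
    simpa using h1
  · have hvw := hF.bilin_eq_zero hv hi hw
    obtain ⟨f, hf, hfe⟩ := hD i (by omega) (p w) (Submodule.mem_map_of_mem hw)
    rw [reducedNab_apply, ← hc.p_nab h D.2 hvw] at hfe
    have h1 : nab D w - f ∈ Submodule.span K {v} := by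
      refine h.ker _ (by rw [map_sub, hfe, sub_self]) ?_
      rw [map_sub, hF.bilin_eq_zero hv hi hf, sub_zero]
      exact hc.bilin_nab_eq_zero D.2 hvw
    rw [← hspan] at h1
    have h2 := add_mem (hF.le (j := i + 1) (by omega) hi h1) hf
    rwa [sub_add_cancel] at h2

variable [FiniteDimensional K E]

/-- The first line of the flag has at most `kerRank x j - 1` directions in which to move, those of
the projective space of `ker x ∩ im x ^ j`. -/
theorem finrank_le_stabDir_add (hc : IsConnection B x δ nab) (hxv : x v = 0) (hv0 : v ≠ 0)
    {j : ℕ} {u : V} (hu : (x ^ j) u = v) :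
    finrank K E + 1 ≤ finrank K (stabDir nab v) + kerRank x j := by
  have h := finrank_add_one_le_of_mem (LinearMap.proj v ∘ₗ nab)
    (U := LinearMap.ker x ⊓ LinearMap.range (x ^ j)) (v := v)
    (fun D => hc.nab_mem hxv hu D) hv0 (Submodule.mem_inf.mpr ⟨hxv, u, hu⟩)
  exact h

/-- If `⟨v, u⟩ = 0` the first line of the flag moves on a quadric: differentiating `⟨v, u⟩ = 0`
gives the additional condition `⟨u, nab D v⟩ = 0`, which is not trivial on `ker x ∩ im x ^ j`. -/
theorem finrank_le_stabDir_add_of_bilin_eq_zero [NeZero (2 : K)] (hs : B.IsSymm)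
    (hB : B.Nondegenerate)
    (hx : ∀ v w, B (x v) w = B v (x w)) (hc : IsConnection B x δ nab) (hxv : x v = 0) (hv0 : v ≠ 0)
    {j : ℕ} {u : V} (hu : (x ^ j) u = v) (hvj : v ∉ LinearMap.range (x ^ (j + 1)))
    (hvu : B v u = 0) :
    finrank K E + 2 ≤ finrank K (stabDir nab v) + kerRank x j := by
  have h1 := finrank_map_add_finrank_inf_ker (B u) (LinearMap.ker x ⊓ LinearMap.range (x ^ j))
  have h2 : (LinearMap.ker x ⊓ LinearMap.range (x ^ j)).map (B u) = ⊤ := by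
    rw [mem_range_pow_iff hs hB hx] at hvj
    push Not at hvj
    obtain ⟨z, hz, hvz⟩ := hvj
    rw [pow_succ', Module.End.mul_apply] at hz
    rw [← hu, pow_adjoint hx] at hvz
    rw [eq_top_iff]
    intro c _
    refine ⟨(c / B u ((x ^ j) z)) • (x ^ j) z,
      Submodule.smul_mem _ _ (Submodule.mem_inf.mpr ⟨hz, z, rfl⟩), ?_⟩
    simp [hvz]
  rw [h2, finrank_top, finrank_self] at h1
  have hvu' : B u v = 0 := (hs.eq u v).trans hvu
  have h3 := finrank_add_one_le_of_mem (LinearMap.proj v ∘ₗ nab)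
    (U := (LinearMap.ker x ⊓ LinearMap.range (x ^ j)) ⊓ LinearMap.ker (B u)) (fun D => ?_) hv0 ?_
  · rw [kerRank]
    have : finrank K (stabDir nab v)
      = finrank K ((Submodule.span K {v}).comap (LinearMap.proj v ∘ₗ nab)) := rfl
    omega
  · refine Submodule.mem_inf.mpr ⟨hc.nab_mem hxv hu D, ?_⟩
    have h4 := hc.compat D v u
    have h5 : B v (nab D u) = B u (nab D v) := by
      conv_lhs => rw [← hu]
      rw [pow_adjoint hx, ← hc.comm_pow, hu]
    have h6 : B (nab D v) u = B u (nab D v) := hs.eq _ u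
    rw [hvu, hc.delta_zero, h5, h6, ← two_mul, eq_comm] at h4
    exact (mul_eq_zero.mp h4).resolve_left two_ne_zero
  · exact Submodule.mem_inf.mpr ⟨Submodule.mem_inf.mpr ⟨hxv, u, hu⟩, hvu'⟩

end Step

end Connection

/-! ### The infinitesimal bound for isotropic flags -/

section Sums

theorem choose_two_succ (m : ℕ) : (m + 1).choose 2 = m.choose 2 + m := by
  rw [Nat.choose_succ_succ' m 1, Nat.choose_one_right, add_comm]

theorem sum_choose_two_of_sub_two {M j : ℕ} {l l' : ℕ → ℕ} (hj : j < M) (h : l' j + 2 = l j)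
    (h' : ∀ i ≠ j, l' i = l i) :
    ∑ i ∈ Finset.range M, (l i).choose 2
      = ∑ i ∈ Finset.range M, (l' i).choose 2 + (2 * l' j + 1) := by
  have h1 : ∀ i ∈ Finset.range M, (l i).choose 2
      = (l' i).choose 2 + if i = j then 2 * l' j + 1 else 0 := by
    intro i _
    by_cases hi : i = j
    · subst hi
      rw [if_pos rfl, ← h, choose_two_succ, choose_two_succ]
      omega
    · rw [if_neg hi, h' i hi, add_zero]
  rw [Finset.sum_congr rfl h1, Finset.sum_add_distrib, Finset.sum_ite_eq' ,
    if_pos (Finset.mem_range.mpr hj)]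

theorem sum_choose_two_of_sub_one {M j : ℕ} {l l' : ℕ → ℕ} (hj : j < M) (h : l' j + 1 = l j)
    (h' : ∀ i ≠ j, l' i = l i) :
    ∑ i ∈ Finset.range M, (l i).choose 2
      = ∑ i ∈ Finset.range M, (l' i).choose 2 + l' j := by
  have h1 : ∀ i ∈ Finset.range M, (l i).choose 2
      = (l' i).choose 2 + if i = j then l' j else 0 := by
    intro i _
    by_cases hi : i = j
    · subst hi
      rw [if_pos rfl, ← h, choose_two_succ]
    · rw [if_neg hi, h' i hi, add_zero]
  rw [Finset.sum_congr rfl h1, Finset.sum_add_distrib, Finset.sum_ite_eq' ,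
    if_pos (Finset.mem_range.mpr hj)]

theorem sum_choose_two_of_sub_one_sub_one {M k : ℕ} {l l' : ℕ → ℕ} (hk : k + 1 < M)
    (h : l' (k + 1) + 1 = l (k + 1)) (h2 : l' k + 1 = l k)
    (h' : ∀ i ≠ k + 1, i ≠ k → l' i = l i) :
    ∑ i ∈ Finset.range M, (l i).choose 2
      = ∑ i ∈ Finset.range M, (l' i).choose 2 + (l' k + l' (k + 1)) := by
  let l'' : ℕ → ℕ := fun i => if i = k then l' k else l i
  rw [sum_choose_two_of_sub_one (l' := l'') (j := k) (by omega) (by simp [l'', h2])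
      (fun i hi => if_neg hi),
    sum_choose_two_of_sub_one (l := l'') (l' := l') (j := k + 1) hk (by simp [l'', h])
      (fun i hi => ?_)]
  · simp [l'']
    omega
  · by_cases hik : i = k
    · simp [l'', hik]
    · simp [l'', hik, h' i hi hik]

end Sums

/-- The function `l` counts, for each `j`, the parts greater than `j` of a partition of the form
`(2 m + 1, 2 p₂, 2 p₃, …)` with `2 m + 1` its largest part. -/
def IsDoubled (l : ℕ → ℕ) : Prop :=
  ∃ m, l (2 * m) = 1 ∧ l (2 * m + 1) = 0 ∧ ∀ i < m, l (2 * i) = l (2 * i + 1)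

/-- Shortening a part of size `k + 2` by two preserves the shape `(2 m + 1, 2 p₂, …)`, provided the
result is a partition with as many parts greater than `k` as greater than `k + 1`. -/
theorem IsDoubled.of_sub {l l' : ℕ → ℕ} {k : ℕ} (hl : IsDoubled l) (hla : Antitone l)
    (hla' : Antitone l') (h : l' (k + 1) + 1 = l (k + 1)) (h2 : l' k + 1 = l k)
    (h' : ∀ i ≠ k + 1, i ≠ k → l' i = l i) (heq : l' k = l' (k + 1)) : IsDoubled l' := by
  obtain ⟨m, h1, h0, hd⟩ := hl
  have hkm : k + 1 ≤ 2 * m := by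
    by_contra hlt
    have := hla (show 2 * m + 1 ≤ k + 1 by omega)
    omega
  rcases hkm.eq_or_lt with hkm | hkm
  · -- the last block of `l` is used up
    obtain ⟨r, rfl⟩ : ∃ r, m = r + 1 := ⟨m - 1, by omega⟩
    obtain rfl : k = 2 * r + 1 := by omega
    have h3 := hd r (by omega)
    have e : 2 * (r + 1) = 2 * r + 1 + 1 := by ring
    rw [e] at h1
    refine ⟨r, ?_, ?_, fun i hi => ?_⟩
    · rw [h' _ (by omega) (by omega)]; omega
    · omega
    · rw [h' _ (by omega) (by omega), h' _ (by omega) (by omega), hd i (by omega)]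
  · rcases Nat.even_or_odd' k with ⟨r, rfl | rfl⟩
    · refine ⟨m, ?_, ?_, fun i hi => ?_⟩
      · rw [h' _ (by omega) (by omega), h1]
      · rw [h' _ (by omega) (by omega), h0]
      · by_cases hir : i = r
        · subst hir; exact heq
        · rw [h' _ (by omega) (by omega), h' _ (by omega) (by omega), hd i hi]
    · exfalso
      have h3 := hd (r + 1) (by omega)
      have e : 2 * (r + 1) = 2 * r + 1 + 1 := by ring
      rw [e] at h3
      have h4 := h' (2 * r + 1 + 1 + 1) (by omega) (by omega)
      have := hla' (show 2 * r + 1 + 1 ≤ 2 * r + 1 + 1 + 1 by omega)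
      omega

/-- The infinitesimal bound for the dimension of the fibre: if no operator preserves the flag `F`,
the space of operators has at most half the dimension of `pairCount x`, and equality for `x` of
doubled type forces the middle space of the flag to contain the core space. By induction on the
dimension of `V`: with `v` spanning `F 1`, the operators that preserve the line of `v` act on
`v^⊥ / v`, and the others are counted by the possible motions of `v`. If `⟨v, u⟩ = 0` for
`v = x ^ j u`, with `j` the depth of `v`, the bound is strict in this step. -/
theorem two_mul_finrank_le_pairCount {K : Type*} [Field K] [NeZero (2 : K)] (n : ℕ) :
    ∀ {V E : Type*} [AddCommGroup V] [Module K V] [FiniteDimensional K V] [AddCommGroup E]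
      [Module K E] [FiniteDimensional K E] (_ : finrank K V = 2 * n + 1)
      {B : LinearMap.BilinForm K V} (_ : B.IsSymm) (_ : B.Nondegenerate) {x : End K V}
      (_ : ∀ v w, B (x v) w = B v (x w)) (_ : IsNilpotent x) {δ : E →ₗ[K] (K → K)}
      {nab : E →ₗ[K] (V → V)} (_ : IsConnection B x δ nab) {F : ℕ → Submodule K V}
      (_ : IsIsotropicFlag B x n F)
      (_ : ∀ D : E, (∀ i ≤ n, ∀ w ∈ F i, nab D w ∈ F i) → D = 0),
      2 * finrank K E ≤ pairCount x ∧
        (IsDoubled (kerRank x) → pairCount x ≤ 2 * finrank K E → coreSpace x ≤ F n) := by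
  induction n with
  | zero =>
    intro V E _ _ _ _ _ _ hV B hs hB x hx hn δ nab hc F hF hE
    have h0 : F 0 = ⊥ := Submodule.finrank_eq_zero.mp (hF.finrank_eq 0 le_rfl)
    have hE0 : ∀ D : E, D = 0 := fun D => hE D fun i hi w hw => by
      obtain rfl := Nat.le_zero.mp hi
      rw [h0, Submodule.mem_bot] at hw ⊢
      rw [hw, hc.nab_zero]
    have hsub : Subsingleton E := ⟨fun a b => (hE0 a).trans (hE0 b).symm⟩
    refine ⟨by rw [finrank_zero_of_subsingleton]; omega, fun _ _ => ?_⟩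
    refine iSup_le fun k => ?_
    rcases k with _ | k
    · rw [pow_zero, Module.End.one_eq_id, LinearMap.ker_id, inf_bot_eq]
      exact bot_le
    · rw [pow_finrank_eq_zero hn (by omega), LinearMap.range_zero, bot_inf_eq]
      exact bot_le
  | succ n ih =>
    intro V E _ _ _ _ _ _ hV B hs hB x hx hn δ nab hc F hF hE
    obtain ⟨⟨v, hv⟩, hv0'⟩ := finrank_pos_iff_exists_ne_zero.mp
      (show 0 < finrank K (F 1) by rw [hF.finrank_eq 1 (by omega)]; exact one_pos)
    have hv0 : v ≠ 0 := fun h => hv0' (Subtype.ext h)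
    have hxv : x v = 0 := by
      have h1 := hF.map_mem 0 (by omega) v hv
      rwa [Submodule.finrank_eq_zero.mp (hF.finrank_eq 0 (by omega)), Submodule.mem_bot] at h1
    have hvv : B v v = 0 := hF.bilin_eq_zero hv (by omega) hv
    obtain ⟨j, u, hu, hvj⟩ := exists_depth hn hv0
    obtain ⟨H, B', s, p, h⟩ := exists_isReduction hs hB hv0 hvv
    have hn' := h.isNilpotent hx hxv hn
    obtain ⟨ih1, ih2⟩ := ih (V := H) (E := stabDir nab v)
      (by have := h.finrank_eq; omega) (h.symm hs) (h.nondegenerate hs hB) (h.adjoint hs hx)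
      hn' (hc.reduced h hs hx hxv) (hF.reduced h hv hv0 hxv)
      (hc.reduced_faithful hF h hv hv0 hE)
    have hM : finrank K H ≤ finrank K V := by have := h.finrank_eq; omega
    rw [pairCount_eq_sum hn' hM] at ih1 ih2
    have hjM : j < finrank K V := by
      by_contra hlt
      rw [pow_finrank_eq_zero hn (not_lt.mp hlt)] at hu
      exact hv0 hu.symm
    by_cases hvu : B v u = 0
    · obtain ⟨h1, h2⟩ := h.kerRank_eq_of_bilin_eq_zero hx hxv hs hB hv0 hu hvj hvu
      have h3 := finrank_le_stabDir_add_of_bilin_eq_zero hs hB hx hc hxv hv0 hu hvj hvu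
      have h4 := sum_choose_two_of_sub_two hjM h1 h2
      rw [← pairCount] at h4
      refine ⟨by omega, fun _ hle => ?_⟩
      omega
    · obtain ⟨k, rfl, h1, h2, h3⟩ := h.kerRank_eq_of_bilin_ne_zero hx hxv hs hB hv0 hu hvj hvv hvu
      have h4 := finrank_le_stabDir_add hc hxv hv0 hu
      have h5 := sum_choose_two_of_sub_one_sub_one hjM h1 h2 h3
      rw [← pairCount] at h5
      have h6 := kerRank_anti x (Nat.le_succ k)
      have h7 := kerRank_anti (p ∘ₗ x ∘ₗ s) (Nat.le_succ k)
      simp only [Nat.succ_eq_add_one] at h6 h7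
      refine ⟨by omega, fun hd hle => ?_⟩
      have h8 : kerRank (p ∘ₗ x ∘ₗ s) k = kerRank (p ∘ₗ x ∘ₗ s) (k + 1) := by omega
      have h9 := ih2 (hd.of_sub (fun _ _ => kerRank_anti x) (fun _ _ => kerRank_anti _)
        h1 h2 h3 h8) (by omega)
      intro w hw
      obtain ⟨hw1, hw2⟩ := coreSpace_le hx h hxv hu hvu hw
      obtain ⟨f, hf, hfe⟩ := h9 hw1
      have h10 : w - f ∈ F 1 := by
        rw [hF.span_eq hv hv0]
        refine h.ker _ (by rw [map_sub, hfe, sub_self]) ?_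
        rw [map_sub, hF.bilin_eq_zero hv le_rfl hf, sub_zero]
        exact hw2
      have h11 := add_mem (hF.le (by omega) le_rfl h10) hf
      rwa [sub_add_cancel] at h11

/-! ### Ranks under field extensions -/

section Rank

variable {m n K L : Type*} [Fintype n] [Field K] [Field L]

/-- A matrix of rank `r` factors through `K ^ r`, and is invertible on suitable `r`-dimensional
spaces; both are equations, and so survive a change of field. -/
theorem exists_rank_factorization [Fintype m] [DecidableEq m] [DecidableEq n] {A : Matrix m n K}
    {r : ℕ} (hr : A.rank = r) :
    ∃ (C : Matrix m (Fin r) K) (D : Matrix (Fin r) n K) (P : Matrix (Fin r) m K)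
      (Q : Matrix n (Fin r) K), A = C * D ∧ P * A * Q = 1 := by
  let f := A.mulVecLin
  let e : LinearMap.range f ≃ₗ[K] (Fin r → K) :=
    (finBasisOfFinrankEq K (LinearMap.range f) hr).equivFun
  let c : (Fin r → K) →ₗ[K] (m → K) := (LinearMap.range f).subtype ∘ₗ e.symm.toLinearMap
  let d : (n → K) →ₗ[K] (Fin r → K) := e.toLinearMap ∘ₗ f.rangeRestrict
  obtain ⟨p, hp⟩ := c.exists_leftInverse_of_injective
    (LinearMap.ker_eq_bot.mpr (Subtype.val_injective.comp e.symm.injective))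
  obtain ⟨q, hq⟩ := d.exists_rightInverse_of_surjective
    (LinearMap.range_eq_top.mpr (e.surjective.comp f.surjective_rangeRestrict))
  refine ⟨LinearMap.toMatrix' c, LinearMap.toMatrix' d, LinearMap.toMatrix' p,
    LinearMap.toMatrix' q, ?_⟩
  have hcd : c ∘ₗ d = f := by
    ext v
    simp [c, d]
  have hA : A = LinearMap.toMatrix' f := (LinearMap.toMatrix'_toLin' A).symm
  rw [hA, ← LinearMap.toMatrix'_comp, ← LinearMap.toMatrix'_comp, ← LinearMap.toMatrix'_comp, hcd]
  refine ⟨rfl, ?_⟩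
  rw [← hcd, ← LinearMap.comp_assoc, hp, LinearMap.id_comp, hq, LinearMap.toMatrix'_id]

theorem le_rank_of_mul_mul_eq_one [Fintype m] {r : ℕ} {A : Matrix m n K} {P : Matrix (Fin r) m K}
    {Q : Matrix n (Fin r) K} (h : P * A * Q = 1) : r ≤ A.rank := by
  have h1 := Matrix.rank_one (n := Fin r) (R := K)
  rw [← h, Fintype.card_fin] at h1
  rw [← h1]
  exact (Matrix.rank_mul_le_left _ _).trans (Matrix.rank_mul_le_right _ _)

theorem rank_mul_le_of_fin {r : ℕ} (C : Matrix m (Fin r) K) (D : Matrix (Fin r) n K) :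
    (C * D).rank ≤ r := by
  have h := Matrix.rank_le_card_width C
  rw [Fintype.card_fin] at h
  exact (Matrix.rank_mul_le_left _ _).trans h

theorem rank_map [Fintype m] (f : K →+* L) (A : Matrix m n K) : (A.map f).rank = A.rank := by
  classical
  obtain ⟨C, D, P, Q, hA, h⟩ := exists_rank_factorization (A := A) rfl
  apply le_antisymm
  · conv_lhs => rw [hA, Matrix.map_mul]
    exact rank_mul_le_of_fin _ _
  · refine le_rank_of_mul_mul_eq_one (P := P.map f) (Q := Q.map f) ?_
    rw [← Matrix.map_mul, ← Matrix.map_mul, h, Matrix.map_one f (map_zero f) (map_one f)]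

end Rank

section KerRank

variable {N : ℕ} {K L V : Type*} [Field K] [Field L] [AddCommGroup V] [Module K V]

theorem finrank_range_pow_eq_rank (b : Basis (Fin N) K V) (x : End K V) (j : ℕ) :
    finrank K (LinearMap.range (x ^ j)) = (LinearMap.toMatrix b b x ^ j).rank := by
  have h : LinearMap.toMatrix b b x ^ j = LinearMap.toMatrix b b (x ^ j) :=
    (map_pow (LinearMap.toMatrixAlgEquiv b) x j).symm
  rw [h, Matrix.rank_eq_finrank_range_toLin _ b b, Matrix.toLin_toMatrix]

theorem kerRank_eq_of_toMatrix {W : Type*} [AddCommGroup W] [Module L W] (f : K →+* L)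
    (b : Basis (Fin N) K V) (c : Basis (Fin N) L W) {x : End K V} {y : End L W}
    (h : LinearMap.toMatrix c c y = (LinearMap.toMatrix b b x).map f) (j : ℕ) :
    kerRank y j = kerRank x j := by
  have hK := Module.Finite.of_basis b
  have hL := Module.Finite.of_basis c
  have h1 : ∀ i, finrank L (LinearMap.range (y ^ i)) = finrank K (LinearMap.range (x ^ i)) := by
    intro i
    rw [finrank_range_pow_eq_rank b, finrank_range_pow_eq_rank c, h, ← rank_map f]
    congr 1
    exact (map_pow (f.mapMatrix (m := Fin N)) _ i).symm
  have h2 := finrank_range_pow x j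
  have h3 := finrank_range_pow y j
  rw [h1, h1] at h3
  omega

end KerRank

/-! ### Generic points and extension of scalars -/

section FlagConditions

variable {N : ℕ} {K V : Type*} [Field K] [AddCommGroup V] [Module K V] {c : Basis (Fin N) K V}

theorem map_mem_basisFlag {x : End K V}
    (h : ∀ k j : Fin N, j ≤ k → LinearMap.toMatrix c c x k j = 0) {i : ℕ} {v : V}
    (hv : v ∈ basisFlag c (i + 1)) : x v ∈ basisFlag c i := by
  have h1 : basisFlag c (i + 1) ≤ (basisFlag c i).comap x := by
    refine mem_of_mem_basisFlag fun j hj k hk => ?_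
    rw [← LinearMap.toMatrix_apply]
    exact h k j (Fin.le_def.mpr (by omega))
  exact h1 hv

theorem bilin_eq_zero_of_mem_basisFlag {B : LinearMap.BilinForm K V}
    (h : ∀ i j : Fin N, (i : ℕ) + j + 2 ≤ N → LinearMap.BilinForm.toMatrix c B i j = 0) {i j : ℕ}
    (hij : i + j ≤ N) {v w : V} (hv : v ∈ basisFlag c i) (hw : w ∈ basisFlag c j) :
    B v w = 0 := by
  have h1 : basisFlag c j ≤ B.orthogonal (basisFlag c i) := by
    refine mem_of_mem_basisFlag fun l hl => ?_
    have h2 : basisFlag c i ≤ LinearMap.ker (B.flip (c l)) := by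
      refine mem_of_mem_basisFlag fun k hk => ?_
      have h3 := h k l (by omega)
      rwa [LinearMap.BilinForm.toMatrix_apply] at h3
    exact fun u hu => h2 hu
  exact h1 hw v hv

end FlagConditions

section GenericPoint

variable {σ : Type*} {K : Type*} [Field K] [Algebra ℂ K]

/-- A point `y` with coordinates in an extension field is generic for `S` if a polynomial with
complex coefficients vanishes at `y` exactly when it vanishes on `S`. -/
def IsGenericPoint (S : Set (σ → ℂ)) (y : σ → K) : Prop :=
  ∀ p : MvPolynomial σ ℂ, aeval y p = 0 ↔ ∀ a ∈ S, aeval a p = 0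

end GenericPoint

section Polynomials

variable {N : ℕ} {L : Type*} [CommRing L] [Algebra ℂ L]

theorem mapMatrix_uniMat_X (a : LowerIdx N → L) :
    (aeval a).toRingHom.mapMatrix (uniMat (X : LowerIdx N → MvPolynomial (LowerIdx N) ℂ))
      = uniMat a := by
  rw [RingHom.mapMatrix_apply, map_uniMat]
  congr 1
  funext i
  exact aeval_X a i

theorem mapMatrix_map_C (a : LowerIdx N → L) (M : Matrix (Fin N) (Fin N) ℂ) :
    (aeval a).toRingHom.mapMatrix (M.map (C : ℂ →+* MvPolynomial (LowerIdx N) ℂ))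
      = M.map (algebraMap ℂ L) := by
  ext i j
  exact aeval_C a (M i j)

theorem aeval_conj (a : LowerIdx N → L) (M : Matrix (Fin N) (Fin N) ℂ) (i j : Fin N) :
    aeval a (((uniMat (X : LowerIdx N → MvPolynomial (LowerIdx N) ℂ)).adjugate *
      M.map (C : ℂ →+* MvPolynomial (LowerIdx N) ℂ) * uniMat X : Matrix (Fin N) (Fin N) _) i j)
      = ((uniMat a).adjugate * M.map (algebraMap ℂ L) * uniMat a) i j := by
  rw [← mapMatrix_map_C a M, ← mapMatrix_uniMat_X a, ← RingHom.map_adjugate, ← map_mul, ← map_mul]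
  rfl

theorem aeval_gram (a : LowerIdx N → L) (M : Matrix (Fin N) (Fin N) ℂ) (i j : Fin N) :
    aeval a (((uniMat (X : LowerIdx N → MvPolynomial (LowerIdx N) ℂ)).transpose *
      M.map (C : ℂ →+* MvPolynomial (LowerIdx N) ℂ) * uniMat X : Matrix (Fin N) (Fin N) _) i j)
      = ((uniMat a).transpose * M.map (algebraMap ℂ L) * uniMat a) i j := by
  have h : (uniMat a).transpose = (aeval a).toRingHom.mapMatrix
      (uniMat (X : LowerIdx N → MvPolynomial (LowerIdx N) ℂ)).transpose := by
    rw [← mapMatrix_uniMat_X a, RingHom.mapMatrix_apply, RingHom.mapMatrix_apply,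
      Matrix.transpose_map]
  rw [h, ← mapMatrix_map_C a M, ← mapMatrix_uniMat_X a, ← map_mul, ← map_mul]
  rfl

theorem aeval_coord (a : LowerIdx N → L) (w : Fin N → ℂ) (i : Fin N) :
    aeval a ((uniMat (X : LowerIdx N → MvPolynomial (LowerIdx N) ℂ)).adjugate.mulVec
      (fun j => C (w j)) i) = (uniMat a).adjugate.mulVec (fun j => algebraMap ℂ L (w j)) i := by
  rw [← mapMatrix_uniMat_X a, ← RingHom.map_adjugate, Matrix.mulVec, dotProduct, map_sum,
    Matrix.mulVec, dotProduct]
  refine Finset.sum_congr rfl fun j _ => ?_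
  rw [map_mul, aeval_C]
  rfl

end Polynomials

section BaseChange

variable {N : ℕ} {V : Type*} [AddCommGroup V] [Module ℂ V] (b : Basis (Fin N) ℂ V)
  (K : Type*) [Field K] [Algebra ℂ K]

/-- The extension of an endomorphism of `V` to `K ^ N`, in the coordinates of the basis `b`. -/
noncomputable def extendEnd (x : End ℂ V) : End K (Fin N → K) :=
  Matrix.toLin' ((LinearMap.toMatrix b b x).map (algebraMap ℂ K))

/-- The extension of a bilinear form on `V` to `K ^ N`, in the coordinates of the basis `b`. -/
noncomputable def extendBilin (B : LinearMap.BilinForm ℂ V) : LinearMap.BilinForm K (Fin N → K) :=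
  Matrix.toBilin' ((LinearMap.BilinForm.toMatrix b B).map (algebraMap ℂ K))

/-- The vector `v`, seen in `K ^ N` in the coordinates of the basis `b`. -/
noncomputable def extendVec (v : V) : Fin N → K := fun i => algebraMap ℂ K (b.repr v i)

theorem toMatrix_extendEnd (x : End ℂ V) :
    LinearMap.toMatrix (Pi.basisFun K (Fin N)) (Pi.basisFun K (Fin N)) (extendEnd b K x)
      = (LinearMap.toMatrix b b x).map (algebraMap ℂ K) := by
  rw [LinearMap.toMatrix_eq_toMatrix', extendEnd, LinearMap.toMatrix'_toLin']

theorem toMatrix_extendBilin (B : LinearMap.BilinForm ℂ V) :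
    LinearMap.BilinForm.toMatrix (Pi.basisFun K (Fin N)) (extendBilin b K B)
      = (LinearMap.BilinForm.toMatrix b B).map (algebraMap ℂ K) := by
  rw [LinearMap.BilinForm.toMatrix_basisFun, extendBilin, LinearMap.BilinForm.toMatrix'_toBilin']

theorem extendEnd_extendVec (x : End ℂ V) (v : V) :
    extendEnd b K x (extendVec b K v) = extendVec b K (x v) := by
  ext i
  rw [extendEnd, Matrix.toLin'_apply, extendVec, ← LinearMap.toMatrix_mulVec_repr b b x v]
  simp [Matrix.mulVec, dotProduct, extendVec]

theorem extendEnd_pow_extendVec (x : End ℂ V) (k : ℕ) (v : V) :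
    (extendEnd b K x ^ k) (extendVec b K v) = extendVec b K ((x ^ k) v) := by
  induction k with
  | zero => rfl
  | succ k ih => rw [pow_succ', pow_succ', Module.End.mul_apply, ih, extendEnd_extendVec,
      Module.End.mul_apply]

theorem extendBilin_extendVec (B : LinearMap.BilinForm ℂ V) (v w : V) :
    extendBilin b K B (extendVec b K v) (extendVec b K w) = algebraMap ℂ K (B v w) := by
  rw [extendBilin, Matrix.toBilin'_apply',
    LinearMap.BilinForm.apply_eq_dotProduct_toMatrix_mulVec b,
    RingHom.map_dotProduct]
  congr 1
  funext i
  exact (RingHom.map_mulVec (algebraMap ℂ K) _ _ i).symm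

theorem extendVec_add (v w : V) :
    extendVec b K (v + w) = extendVec b K v + extendVec b K w := by
  ext i
  simp [extendVec]

theorem extendVec_zero : extendVec b K 0 = 0 := by
  ext i
  simp [extendVec]

theorem extendVec_basis (i : Fin N) : extendVec b K (b i) = Pi.basisFun K (Fin N) i := by
  ext j
  simp [extendVec, Finsupp.single_apply, Pi.single_apply, eq_comm]

theorem extendVec_mem_coreSpace {x : End ℂ V} {w : V} (hw : w ∈ coreSpace x) :
    extendVec b K w ∈ coreSpace (extendEnd b K x) := by
  refine Submodule.iSup_induction _ (motive := fun w => extendVec b K w ∈ _) hw ?_ ?_ ?_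
  · rintro k _ ⟨⟨u, rfl⟩, hu⟩
    refine Submodule.mem_iSup_of_mem k (Submodule.mem_inf.mpr ⟨⟨extendVec b K u, ?_⟩, ?_⟩)
    · rw [extendEnd_pow_extendVec]
    · have hu' : (x ^ k) ((x ^ k) u) = 0 := hu
      rw [LinearMap.mem_ker, extendEnd_pow_extendVec, hu', extendVec_zero]
  · rw [extendVec_zero]
    exact zero_mem _
  · intro v w hv hw
    rw [extendVec_add]
    exact add_mem hv hw

theorem extendBilin_isSymm {B : LinearMap.BilinForm ℂ V} (hs : B.IsSymm) :
    (extendBilin b K B).IsSymm := by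
  refine ⟨fun v w => ?_⟩
  have h : extendBilin b K B = (extendBilin b K B).flip := by
    refine LinearMap.BilinForm.ext_basis (Pi.basisFun K (Fin N)) fun i j => ?_
    change _ = extendBilin b K B (Pi.basisFun K (Fin N) j) (Pi.basisFun K (Fin N) i)
    rw [← extendVec_basis b, ← extendVec_basis b, extendBilin_extendVec,
      extendBilin_extendVec]
    exact congrArg _ (hs.eq _ _)
  exact congrArg (fun B : LinearMap.BilinForm K (Fin N → K) => B v w) h

theorem extendBilin_nondegenerate {B : LinearMap.BilinForm ℂ V} (hB : B.Nondegenerate) :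
    (extendBilin b K B).Nondegenerate := by
  rw [LinearMap.BilinForm.nondegenerate_iff_det_ne_zero (Pi.basisFun K (Fin N)),
    toMatrix_extendBilin]
  rw [LinearMap.BilinForm.nondegenerate_iff_det_ne_zero b] at hB
  rw [← RingHom.mapMatrix_apply, ← RingHom.map_det]
  exact (map_ne_zero _).mpr hB

theorem extend_adjoint {B : LinearMap.BilinForm ℂ V} {x : End ℂ V}
    (hx : ∀ v w, B (x v) w = B v (x w)) (v w : Fin N → K) :
    extendBilin b K B (extendEnd b K x v) w = extendBilin b K B v (extendEnd b K x w) := by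
  have h : (extendBilin b K B).compLeft (extendEnd b K x)
      = (extendBilin b K B).compRight (extendEnd b K x) := by
    refine LinearMap.BilinForm.ext_basis (Pi.basisFun K (Fin N)) fun i j => ?_
    rw [LinearMap.BilinForm.compLeft_apply, LinearMap.BilinForm.compRight_apply,
      ← extendVec_basis b, ← extendVec_basis b, extendEnd_extendVec, extendEnd_extendVec,
      extendBilin_extendVec, extendBilin_extendVec, hx]
  exact congrArg (fun B : LinearMap.BilinForm K (Fin N → K) => B v w) h

theorem extendEnd_isNilpotent {x : End ℂ V} (hx : IsNilpotent x) :
    IsNilpotent (extendEnd b K x) := by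
  obtain ⟨k, hk⟩ := hx
  refine ⟨k, (Pi.basisFun K (Fin N)).ext fun i => ?_⟩
  rw [← extendVec_basis b, extendEnd_pow_extendVec, hk, LinearMap.zero_apply, extendVec_zero,
    LinearMap.zero_apply]

theorem kerRank_extendEnd (x : End ℂ V) (j : ℕ) : kerRank (extendEnd b K x) j = kerRank x j :=
  kerRank_eq_of_toMatrix (algebraMap ℂ K) b (Pi.basisFun K (Fin N)) (toMatrix_extendEnd b K x) j

theorem pairCount_extendEnd (x : End ℂ V) : pairCount (extendEnd b K x) = pairCount x := by
  rw [pairCount, pairCount, finrank_eq_card_basis (Pi.basisFun K (Fin N)),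
    finrank_eq_card_basis b]
  exact Finset.sum_congr rfl fun j _ => by rw [kerRank_extendEnd]

/-- A derivation of `K` acts on `K ^ N` coordinate by coordinate. -/
def coordDer : Derivation ℂ K K →ₗ[K] ((Fin N → K) → (Fin N → K)) where
  toFun D w i := D (w i)
  map_add' _ _ := rfl
  map_smul' _ _ := rfl

/-- The functions underlying the derivations of `K`. -/
def derFun : Derivation ℂ K K →ₗ[K] (K → K) where
  toFun D := D
  map_add' _ _ := rfl
  map_smul' _ _ := rfl

/-- Endomorphisms and forms with constant coefficients are compatible with the coordinatewise action
of derivations. -/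
theorem isConnection_coordDer (B : LinearMap.BilinForm ℂ V) (x : End ℂ V) :
    IsConnection (extendBilin b K B) (extendEnd b K x) (derFun K) (coordDer K) where
  nab_add D v w := by
    funext i
    exact map_add D _ _
  leibniz D c v := by
    funext i
    change D (c * v i) = D c * v i + c * D (v i)
    rw [Derivation.leibniz, smul_eq_mul, smul_eq_mul]
    ring
  comm D v := by
    funext i
    change D (extendEnd b K x v i) = extendEnd b K x (fun i => D (v i)) i
    rw [extendEnd, Matrix.toLin'_apply, Matrix.toLin'_apply, Matrix.mulVec, Matrix.mulVec,
      dotProduct, dotProduct, map_sum]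
    refine Finset.sum_congr rfl fun j _ => ?_
    rw [Matrix.map_apply, ← Algebra.smul_def, ← Algebra.smul_def, D.map_smul]
  compat D v w := by
    change D (extendBilin b K B v w) = extendBilin b K B (fun i => D (v i)) w +
      extendBilin b K B v (fun i => D (w i))
    simp only [extendBilin, Matrix.toBilin'_apply, map_sum, ← Finset.sum_add_distrib]
    refine Finset.sum_congr rfl fun i _ => Finset.sum_congr rfl fun j _ => ?_
    rw [Matrix.map_apply, mul_right_comm, mul_comm _ (algebraMap ℂ K _), ← Algebra.smul_def,
      D.map_smul, Derivation.leibniz, Algebra.smul_def, smul_eq_mul, smul_eq_mul]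
    ring

end BaseChange

/-! ### The upper bound for the dimension of the fibre -/

section FibreConditions

variable {N : ℕ} {V : Type*} [AddCommGroup V] [Module ℂ V]

theorem toMatrix_eq_zero_of_mem_springerFiber {x : End ℂ V} {c : Basis (Fin N) ℂ V}
    (h : CompleteFlag.ofBasis c ∈ springerFiber N x) {k j : Fin N} (hjk : j ≤ k) :
    LinearMap.toMatrix c c x k j = 0 := by
  have h1 := h j
  rw [ofBasis_sub_eq_basisFlag, ofBasis_sub_eq_basisFlag] at h1
  rw [LinearMap.toMatrix_apply]
  exact h1 (Submodule.mem_map_of_mem (self_mem_basisFlag c j)) k hjk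

theorem toMatrix_eq_zero_of_mem_isotropicFlags {B : LinearMap.BilinForm ℂ V}
    {c : Basis (Fin N) ℂ V} (h : CompleteFlag.ofBasis c ∈ isotropicFlags N B) {i j : Fin N}
    (hij : (i : ℕ) + j + 2 ≤ N) : LinearMap.BilinForm.toMatrix c B i j = 0 := by
  have h1 := h i.succ
  rw [ofBasis_sub_eq_basisFlag, ofBasis_sub_eq_basisFlag] at h1
  have h2 : c j ∈ basisFlag c (i.succ.rev : ℕ) := by
    refine basisFlag_mono c ?_ (self_mem_basisFlag c j)
    rw [Fin.val_rev, Fin.val_succ]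
    omega
  rw [h1] at h2
  rw [LinearMap.BilinForm.toMatrix_apply]
  exact h2 _ (self_mem_basisFlag c i)

end FibreConditions

section GenericPoint

variable {n : ℕ} {V : Type*} [AddCommGroup V] [Module ℂ V] {K : Type*} [Field K] [Algebra ℂ K]

/-- A derivation whose coordinatewise action preserves the generic flag kills the coordinates of
that flag: the frame of the flag is normalized, so its derivatives can only vanish. -/
theorem derivation_eq_zero_of_coordDer {N : ℕ} {y : LowerIdx N → K}
    (hD : ∀ D : Derivation ℂ K K, (∀ i, D (y i) = 0) → D = 0) {D : Derivation ℂ K K}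
    (h : ∀ i ≤ N, ∀ w ∈ basisFlag (chartBasis (Pi.basisFun K (Fin N)) y) i,
      coordDer K D w ∈ basisFlag (chartBasis (Pi.basisFun K (Fin N)) y) i) : D = 0 := by
  refine hD D fun ⟨(i, j), hij⟩ => ?_
  let c := chartBasis (Pi.basisFun K (Fin N)) y
  have hc : ∀ k, c j k = uniMat y k j := fun k =>
    repr_chartBasis (Pi.basisFun K (Fin N)) y k j
  have h1 : coordDer K D (c j) = 0 := by
    refine eq_zero_of_mem_basisFlag (Pi.basisFun K (Fin N)) y
      (h (j + 1) j.2 _ (self_mem_basisFlag c j)) fun k hk => ?_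
    change D (c j k) = 0
    rw [hc]
    rcases (Nat.lt_succ_iff.mp hk).lt_or_eq with h2 | h2
    · rw [uniMat_of_gt y h2, map_zero]
    · rw [Fin.ext h2, uniMat_self, Derivation.map_one_eq_zero]
  have h2 := congrFun h1 i
  change D (c j i) = 0 at h2
  rwa [hc, uniMat_of_lt y hij] at h2

/-- The infinitesimal bound at the generic point `y` of a set `S` of chart coordinates of flags in
the fibre. The equations of the fibre hold at `y`, which gives a flag over `K` in the fibre of the
extended data; the conclusion about the core space is specialized back to the points of `S`. -/
theorem two_mul_finrank_derivation_le [Module.Finite K (Derivation ℂ K K)]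
    {B : LinearMap.BilinForm ℂ V} (hs : B.IsSymm) (hB : B.Nondegenerate) {x : End ℂ V}
    (hx : ∀ v w, B (x v) w = B v (x w)) (hn : IsNilpotent x) (b : Basis (Fin (2 * n + 1)) ℂ V)
    {S : Set (LowerIdx (2 * n + 1) → ℂ)}
    (hS : ∀ a ∈ S, flagChart b a ∈ resolutionFiber (2 * n + 1) B x)
    {y : LowerIdx (2 * n + 1) → K} (hy : IsGenericPoint S y)
    (hD : ∀ D : Derivation ℂ K K, (∀ i, D (y i) = 0) → D = 0) :
    2 * finrank K (Derivation ℂ K K) ≤ pairCount x ∧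
      (IsDoubled (kerRank x) → pairCount x ≤ 2 * finrank K (Derivation ℂ K K) →
        ∀ a ∈ S, coreSpace x ≤ basisFlag (chartBasis b a) n) := by
  have : CharZero K := charZero_of_injective_algebraMap (algebraMap ℂ K).injective
  let e := Pi.basisFun K (Fin (2 * n + 1))
  let c := chartBasis e y
  have hxc : ∀ k j : Fin (2 * n + 1), j ≤ k → LinearMap.toMatrix c c (extendEnd b K x) k j = 0 := by
    intro k j hjk
    rw [toMatrix_chartBasis_end, toMatrix_extendEnd, ← aeval_conj, hy]
    intro a ha
    rw [aeval_conj]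
    have h1 := toMatrix_eq_zero_of_mem_springerFiber (c := chartBasis b a) (hS a ha).2.2 hjk
    rw [toMatrix_chartBasis_end] at h1
    rw [← h1]
    rfl
  have hBc : ∀ i j : Fin (2 * n + 1), (i : ℕ) + j + 2 ≤ 2 * n + 1 →
      LinearMap.BilinForm.toMatrix c (extendBilin b K B) i j = 0 := by
    intro i j hij
    rw [toMatrix_chartBasis_bilin, toMatrix_extendBilin, ← aeval_gram, hy]
    intro a ha
    rw [aeval_gram]
    have h1 := toMatrix_eq_zero_of_mem_isotropicFlags (c := chartBasis b a) (hS a ha).2.1 hij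
    rw [toMatrix_chartBasis_bilin] at h1
    rw [← h1]
    rfl
  have hcon := isConnection_coordDer b K B x
  have hsK := extendBilin_isSymm b K hs
  have hBK := extendBilin_nondegenerate b K hB
  have hF : IsIsotropicFlag (extendBilin b K B) (extendEnd b K x) n (basisFlag c) :=
    { mono := fun i _ => basisFlag_mono c (Nat.le_succ i)
      finrank_eq := fun i hi => finrank_basisFlag c (by omega)
      isotropic := fun v hv w hw => bilin_eq_zero_of_mem_basisFlag hBc (by omega) hv hw
      map_mem := fun i _ v hv => map_mem_basisFlag hxc hv }
  have hE : ∀ D : Derivation ℂ K K,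
      (∀ i ≤ n, ∀ w ∈ basisFlag c i, coordDer K D w ∈ basisFlag c i) → D = 0 := by
    intro D h
    refine derivation_eq_zero_of_coordDer hD fun i hi w hw => ?_
    rcases le_or_gt i n with hin | hin
    · exact h i hin w hw
    · -- for `i > n`, the subspace `F i` is the orthogonal of `F (2n + 1 - i)`
      have h1 : basisFlag c i
          = (extendBilin b K B).orthogonal (basisFlag c (2 * n + 1 - i)) := by
        refine Submodule.eq_of_le_of_finrank_eq (fun v hv u hu => ?_) ?_
        · exact bilin_eq_zero_of_mem_basisFlag hBc (by omega) hu hv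
        · rw [LinearMap.BilinForm.finrank_orthogonal hBK, finrank_basisFlag c hi,
            finrank_basisFlag c (by omega), finrank_eq_card_basis e, Fintype.card_fin]
          omega
      change coordDer K D w ∈ basisFlag c i
      rw [h1]
      intro u hu
      have h2 := hcon.compat D u w
      rw [bilin_eq_zero_of_mem_basisFlag hBc (by omega) hu hw, hcon.delta_zero,
        bilin_eq_zero_of_mem_basisFlag hBc (i := 2 * n + 1 - i) (by omega) (h _ (by omega) u hu) hw,
        zero_add] at h2
      exact h2.symm
  obtain ⟨h1, h2⟩ := two_mul_finrank_le_pairCount (K := K) n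
    (by rw [finrank_eq_card_basis e, Fintype.card_fin]) hsK hBK (extend_adjoint b K hx)
    (extendEnd_isNilpotent b K hn) hcon hF hE
  rw [pairCount_extendEnd] at h1 h2
  refine ⟨h1, fun hd hle a ha w hw k hk => ?_⟩
  have h3 := h2 (by rwa [funext (kerRank_extendEnd b K x)]) hle (extendVec_mem_coreSpace b K hw)
  have h4 := h3 k hk
  have h5 : ⇑(e.repr (extendVec b K w)) = fun j => algebraMap ℂ K (b.repr w j) := rfl
  rw [repr_chartBasis_eq_mulVec, h5, ← aeval_coord, hy] at h4
  have h6 := h4 a ha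
  rw [aeval_coord] at h6
  rw [repr_chartBasis_eq_mulVec]
  exact h6

end GenericPoint

section FunctionField

theorem derivation_aeval_eq_zero {σ K : Type*} [Field K] [Algebra ℂ K] {y : σ → K}
    {D : Derivation ℂ K K} (h : ∀ i, D (y i) = 0) (p : MvPolynomial σ ℂ) : D (aeval y p) = 0 := by
  induction p using MvPolynomial.induction_on with
  | C a => rw [aeval_C, D.map_algebraMap]
  | add p q hp hq => rw [map_add, map_add, hp, hq, add_zero]
  | mul_X p i hp => rw [map_mul, aeval_X, D.leibniz, hp, h, smul_zero, smul_zero, add_zero]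

/-- The function field of an irreducible set and its generic point. -/
theorem exists_isGenericPoint {σ : Type u} [Finite σ] {S : Set (Zar (σ → ℂ))}
    (hS : IsIrreducible S) :
    ∃ (K : Type u) (_ : Field K) (_ : Algebra ℂ K) (y : σ → K),
      IsGenericPoint (S : Set (σ → ℂ)) y ∧ Module.Finite K (Derivation ℂ K K) ∧
      (∀ D : Derivation ℂ K K, (∀ i, D (y i) = 0) → D = 0) ∧
      topologicalKrullDim S ≤ (finrank K (Derivation ℂ K K) : ℕ) := by
  have hp := zar_isIrreducible_vanishingIdeal hS
  let A := MvPolynomial σ ℂ ⧸ vanishingIdeal ℂ (S : Set (σ → ℂ))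
  let K := FractionRing A
  let y : σ → K := fun i => algebraMap A K (Ideal.Quotient.mk _ (X i))
  have hy : ∀ p : MvPolynomial σ ℂ, aeval y p = algebraMap A K (Ideal.Quotient.mk _ p) := by
    intro p
    have h : aeval y = ((Algebra.ofId A K).restrictScalars ℂ).comp
        (Ideal.Quotient.mkₐ ℂ (vanishingIdeal ℂ (S : Set (σ → ℂ)))) := by
      ext i
      rw [aeval_X]
      rfl
    rw [h]
    rfl
  refine ⟨K, inferInstance, inferInstance, y, fun p => ?_, ?_, fun D hD => ?_,
    topologicalKrullDim_le_finrank_derivation S hp⟩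
  · rw [hy, FaithfulSMul.algebraMap_eq_zero_iff, Ideal.Quotient.eq_zero_iff_mem]
    exact Iff.rfl
  · obtain ⟨s, -, x, hx⟩ := exists_ringKrullDim_eq_transcendenceBasis A K
    exact (finrank_derivation hx).1
  · ext z
    obtain ⟨a, b, hb, rfl⟩ := IsFractionRing.div_surjective (A := A) z
    obtain ⟨p, rfl⟩ := Ideal.Quotient.mk_surjective a
    obtain ⟨q, rfl⟩ := Ideal.Quotient.mk_surjective b
    have hb' : algebraMap A K (Ideal.Quotient.mk _ q) ≠ 0 :=
      IsFractionRing.to_map_ne_zero_of_mem_nonZeroDivisors hb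
    have h1 := D.leibniz (algebraMap A K (Ideal.Quotient.mk _ p) /
      algebraMap A K (Ideal.Quotient.mk _ q)) (algebraMap A K (Ideal.Quotient.mk _ q))
    rw [div_mul_cancel₀ _ hb', ← hy, ← hy, derivation_aeval_eq_zero hD,
      derivation_aeval_eq_zero hD, smul_zero, zero_add, smul_eq_mul, eq_comm, mul_eq_zero, hy,
      hy] at h1
    exact h1.resolve_left hb'

end FunctionField

section FibreDimension

variable {N n : ℕ} {V : Type*} [AddCommGroup V] [Module ℂ V]

theorem isIrreducible_preimage_flagChart [FiniteDimensional ℂ V] (b : Basis (Fin N) ℂ V)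
    {Z : Set (CompleteFlag N V)} (hZ : IsIrreducible Z)
    (hb : (flagChart b ⁻¹' Z).Nonempty) : IsIrreducible (flagChart b ⁻¹' Z) :=
  ⟨hb, hZ.2.preimage (isOpenEmbedding_flagChart b)⟩

theorem flagChart_zero (b : Basis (Fin N) ℂ V) :
    flagChart b (0 : LowerIdx N → ℂ) = CompleteFlag.ofBasis b := by
  refine congrArg CompleteFlag.ofBasis (Basis.eq_of_apply_eq fun j => ?_)
  rw [chartBasis_apply, uniMat_zero]
  simp [Matrix.one_apply]

theorem isClosed_le_sub (W : Submodule ℂ V) (i : Fin (N + 1)) :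
    IsClosed {F : CompleteFlag N V | W ≤ F.sub i} := by
  rw [← isOpen_compl_iff, flag_isOpen_iff]
  intro b hb
  rw [Set.mem_compl_iff, Set.mem_ofPred_eq, SetLike.not_le_iff_exists] at hb
  obtain ⟨w, hw, hwi⟩ := hb
  rw [mem_ofBasis_sub_iff] at hwi
  push Not at hwi
  obtain ⟨k, hk, hwk⟩ := hwi
  let P : (Fin N → V) → ℂ := fun v => ∑ l, (b.toMatrix v).adjugate k l * b.repr w l
  have hP : ∀ c : Basis (Fin N) ℂ V, P c = (b.toMatrix c).det * c.repr w k := by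
    intro c
    have h1 : (b.toMatrix c).mulVec ⇑(c.repr w) = ⇑(b.repr w) := c.toMatrix_mulVec_repr b w
    change (b.toMatrix c).adjugate.mulVec ⇑(b.repr w) k = _
    rw [← h1, Matrix.mulVec_mulVec, Matrix.adjugate_mul, Matrix.smul_mulVec, Matrix.one_mulVec]
    rfl
  refine ⟨P, sum_mem_polyFun _ fun l _ => mul_mem (adjugate_mem_polyFun (fun i j => ?_) _ _)
    (const_mem_polyFun _), ?_, fun c hc hcW => hc ?_⟩
  · exact polyFun_repr b (LinearMap.proj j : (Fin N → V) →ₗ[ℂ] V) i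
  · rw [hP, Basis.toMatrix_self, Matrix.det_one, one_mul]
    exact hwk
  · rw [hP, mem_ofBasis_sub_iff.mp (hcW hw) k hk, mul_zero]

/-- An irreducible subset of the fibre over `x` has at most half the dimension of `pairCount x`, and
in the case of equality, for `x` of doubled type, the middle spaces of all its flags contain the
core space. -/
theorem topologicalKrullDim_le_of_subset_resolutionFiber [FiniteDimensional ℂ V]
    (hV : finrank ℂ V = 2 * n + 1)
    {B : LinearMap.BilinForm ℂ V} (hs : B.IsSymm) (hB : B.Nondegenerate) {x : End ℂ V}
    (hx : ∀ v w, B (x v) w = B v (x w)) (hn : IsNilpotent x)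
    {Z : Set (CompleteFlag (2 * n + 1) V)} (hZ : IsIrreducible Z)
    (hZx : Z ⊆ resolutionFiber (2 * n + 1) B x) {d : ℕ} (hd : pairCount x = 2 * d) :
    topologicalKrullDim Z ≤ d ∧ (IsDoubled (kerRank x) → topologicalKrullDim Z = d →
      ∀ F ∈ Z, coreSpace x ≤ F.sub ⟨n, by omega⟩) := by
  have key : ∀ b : Basis (Fin (2 * n + 1)) ℂ V, CompleteFlag.ofBasis b ∈ Z → ∃ e : ℕ, e ≤ d ∧
      topologicalKrullDim (flagChart b ⁻¹' Z) ≤ e ∧ (IsDoubled (kerRank x) → d ≤ e →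
        ∀ F ∈ Z ∩ Set.range (flagChart b), coreSpace x ≤ F.sub ⟨n, by omega⟩) := by
    intro b hb
    obtain ⟨K, _, _, y, hy, _, hD, hdim⟩ := exists_isGenericPoint
      (isIrreducible_preimage_flagChart b hZ ⟨_, (flagChart_zero b).symm ▸ hb⟩)
    obtain ⟨h1, h2⟩ := two_mul_finrank_derivation_le hs hB hx hn b (fun a ha => hZx ha) hy hD
    refine ⟨_, by omega, hdim, fun hd' hle => ?_⟩
    rintro F ⟨hFZ, a, rfl⟩
    have h3 := h2 hd' (by omega) a hFZ
    change _ ≤ (CompleteFlag.ofBasis (chartBasis b a)).sub _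
    rwa [ofBasis_sub_eq_basisFlag]
  refine ⟨topologicalKrullDim_le_of_charts hV fun b hb => ?_, fun hd' hdim F hF => ?_⟩
  · obtain ⟨e, he, h1, -⟩ := key b hb
    exact h1.trans (by exact_mod_cast he)
  by_contra hFn
  have hlt : ∀ b : Basis (Fin (2 * n + 1)) ℂ V, CompleteFlag.ofBasis b ∈ Z → ∃ e < d,
      topologicalKrullDim (flagChart b ⁻¹' Z) ≤ e := by
    intro b hb
    obtain ⟨e, he, h1, h2⟩ := key b hb
    refine ⟨e, lt_of_not_ge fun hle => ?_, h1⟩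
    -- the chart and the flags whose middle space does not contain the core space both meet `Z` in a
    -- dense open subset
    obtain ⟨F', hF', hb', hW⟩ := hZ.2 _ _ (isOpenEmbedding_flagChart b).isOpen_range
      (isClosed_le_sub (coreSpace x) ⟨n, by omega⟩).isOpen_compl
      ⟨_, hb, _, flagChart_zero b⟩ ⟨F, hF, hFn⟩
    exact hW (h2 hd' hle F' ⟨hF', hb'⟩)
  obtain ⟨b, hb⟩ := exists_ofBasis_eq hV F
  obtain ⟨e, he, -⟩ := hlt b (hb ▸ hF)
  have h3 : topologicalKrullDim Z ≤ (d - 1 : ℕ) :=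
    topologicalKrullDim_le_of_charts hV fun b hb => by
    obtain ⟨e, he, h1⟩ := hlt b hb
    exact h1.trans (by exact_mod_cast Nat.le_sub_one_of_lt he)
  rw [hdim] at h3
  have h4 : d ≤ d - 1 := by exact_mod_cast h3
  omega

end FibreDimension

/-! ### Sweeping irreducible sets of flags -/

section FlagTopology

variable {N : ℕ} {V : Type*} [AddCommGroup V] [Module ℂ V]

theorem isClosed_setOf_map_le (x : End ℂ V) (i j : Fin (N + 1)) :
    IsClosed {F : CompleteFlag N V | (F.sub i).map x ≤ F.sub j} := by
  rw [← isOpen_compl_iff, flag_isOpen_iff]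
  intro b hb
  have hb' : ∃ m k : Fin N, (m : ℕ) < i ∧ (j : ℕ) ≤ k ∧ b.repr (x (b m)) k ≠ 0 := by
    by_contra! h
    refine hb ?_
    rw [Set.mem_ofPred_eq, Submodule.map_le_iff_le_comap, ofBasis_sub_eq_basisFlag,
      ofBasis_sub_eq_basisFlag]
    exact mem_of_mem_basisFlag fun m hm k hk => h m k hm hk
  obtain ⟨m, k, hm, hk, hwk⟩ := hb'
  let P : (Fin N → V) → ℂ := fun v => ∑ l, (b.toMatrix v).adjugate k l * b.repr (x (v m)) l
  have hP : ∀ c : Basis (Fin N) ℂ V, P c = (b.toMatrix c).det * c.repr (x (c m)) k := by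
    intro c
    have h1 : (b.toMatrix c).mulVec ⇑(c.repr (x (c m))) = ⇑(b.repr (x (c m))) :=
      c.toMatrix_mulVec_repr b _
    change (b.toMatrix c).adjugate.mulVec ⇑(b.repr (x (c m))) k = _
    rw [← h1, Matrix.mulVec_mulVec, Matrix.adjugate_mul, Matrix.smul_mulVec, Matrix.one_mulVec]
    rfl
  refine ⟨P, sum_mem_polyFun _ fun l _ => mul_mem (adjugate_mem_polyFun (fun i j => ?_) _ _)
    ?_, ?_, fun c hc hcx => hc ?_⟩
  · exact polyFun_repr b (LinearMap.proj j : (Fin N → V) →ₗ[ℂ] V) i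
  · exact polyFun_repr b (x ∘ₗ (LinearMap.proj m : (Fin N → V) →ₗ[ℂ] V)) l
  · rw [hP, Basis.toMatrix_self, Matrix.det_one, one_mul]
    exact hwk
  · have h1 : x (c m) ∈ (CompleteFlag.ofBasis c).sub j := hcx (Submodule.mem_map_of_mem (by
      rw [ofBasis_sub_eq_basisFlag]
      exact basisFlag_mono c hm (self_mem_basisFlag c m)))
    rw [hP, mem_ofBasis_sub_iff.mp h1 k hk, mul_zero]

theorem isClosed_springerFiber (x : End ℂ V) : IsClosed (springerFiber N x) := by
  have h : springerFiber N x = ⋂ i : Fin N, {F | (F.sub i.succ).map x ≤ F.sub i.castSucc} := by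
    ext F
    simp [springerFiber]
  rw [h]
  exact isClosed_iInter fun i => isClosed_setOf_map_le x _ _

theorem isClosed_sub_le (U : Submodule ℂ V) (i : Fin (N + 1)) :
    IsClosed {F : CompleteFlag N V | F.sub i ≤ U} := by
  rw [← isOpen_compl_iff, flag_isOpen_iff]
  intro b hb
  have hb' : ∃ m : Fin N, (m : ℕ) < i ∧ b m ∉ U := by
    by_contra! h
    refine hb ?_
    rw [Set.mem_ofPred_eq, ofBasis_sub_eq_basisFlag]
    exact mem_of_mem_basisFlag h
  obtain ⟨m, hm, hmU⟩ := hb'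
  obtain ⟨φ, hφ, hφU⟩ := U.exists_le_ker_of_notMem hmU
  refine ⟨_, dual_mem_polyFun (φ ∘ₗ (LinearMap.proj m : (Fin N → V) →ₗ[ℂ] V)), hφ,
    fun c hc hcU => hc ?_⟩
  refine hφU (hcU ?_)
  rw [ofBasis_sub_eq_basisFlag]
  exact basisFlag_mono c hm (self_mem_basisFlag c m)

/-- The action of linear automorphisms on complete flags. -/
def CompleteFlag.map (g : V ≃ₗ[ℂ] V) (F : CompleteFlag N V) : CompleteFlag N V where
  sub i := (F.sub i).map g.toLinearMap
  mono _ _ h := Submodule.map_mono (F.mono h)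
  finrank_sub i := (LinearEquiv.finrank_map_eq g _).trans (F.finrank_sub i)

theorem map_ofBasis (g : V ≃ₗ[ℂ] V) (b : Basis (Fin N) ℂ V) :
    (CompleteFlag.ofBasis b).map g = CompleteFlag.ofBasis (b.map g) := by
  ext i v
  rw [mem_ofBasis_sub_iff]
  constructor
  · rintro ⟨w, hw, rfl⟩
    simpa [mem_ofBasis_sub_iff] using mem_ofBasis_sub_iff.mp hw
  · intro h
    refine ⟨g.symm v, mem_ofBasis_sub_iff.mpr fun k hk => ?_, g.apply_symm_apply v⟩
    exact h k hk

theorem continuous_flagMap (g : V ≃ₗ[ℂ] V) :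
    Continuous (CompleteFlag.map (N := N) g) := by
  refine continuous_coinduced_dom.mpr ?_
  have h : CompleteFlag.map (N := N) g ∘ CompleteFlag.ofBasis
      = CompleteFlag.ofBasis ∘ fun b : Basis (Fin N) ℂ V => b.map g := funext (map_ofBasis g)
  rw [h]
  refine continuous_ofBasis.comp (continuous_induced_rng.mpr ?_)
  have h2 : Continuous fun b : Basis (Fin N) ℂ V => (show Zar (Fin N → V) from ⇑b) :=
    continuous_induced_dom
  exact (PolyMap.linear (LinearMap.compLeft g.toLinearMap (Fin N))).continuous.comp h2

end FlagTopology

section OneParameter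

variable {N : ℕ} {V : Type*} [AddCommGroup V] [Module ℂ V] [FiniteDimensional ℂ V]

theorem isIrreducible_univ_zar_unit : IsIrreducible (Set.univ : Set (Zar (Unit → ℂ))) := by
  refine zar_isIrreducible_of_vanishingIdeal ?_
  have h : vanishingIdeal ℂ (Set.univ : Set (Unit → ℂ)) = ⊥ := by
    refine eq_bot_iff.mpr fun p hp => ?_
    exact MvPolynomial.funext fun v => (hp v trivial).trans (map_zero _).symm
  exact h ▸ Ideal.isPrime_bot

/-- The line of endomorphisms `1 + c A`. The parameter `c` is a point of `Unit → ℂ`, so that results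
about the Zariski topology of coordinate spaces apply to it. -/
def lineEnd (A : End ℂ V) (c : Unit → ℂ) : End ℂ V := 1 + c () • A

/-- The parameters `c` for which `1 + c A` is invertible. -/
def unitLocus (A : End ℂ V) : Set (Zar (Unit → ℂ)) :=
  {c : Unit → ℂ | LinearMap.det (lineEnd A c) ≠ 0}

theorem isOpen_unitLocus (A : End ℂ V) : IsOpen (unitLocus A) := by
  let b := finBasis ℂ V
  have h : (fun c => LinearMap.det (lineEnd A c))
      = fun c : Unit → ℂ => (LinearMap.toMatrix b b (lineEnd A c)).det := by
    funext c
    rw [LinearMap.det_toMatrix]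
  refine zar_isOpen_ne_zero (M := Unit → ℂ) (P := fun c => LinearMap.det (lineEnd A c)) ?_
  rw [h]
  refine det_mem_polyFun fun i j => ?_
  have h2 : (fun c : Unit → ℂ => LinearMap.toMatrix b b (lineEnd A c) i j)
      = fun c => LinearMap.toMatrix b b 1 i j + c () * LinearMap.toMatrix b b A i j := by
    funext c
    simp [lineEnd]
  rw [h2]
  exact add_mem (const_mem_polyFun _) (mul_mem (dual_mem_polyFun
    (LinearMap.proj () : Dual ℂ (Unit → ℂ))) (const_mem_polyFun _))

open Classical in
/-- The automorphism `1 + c A`, for `c` such that this is invertible, and the identity for other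
`c`. -/
noncomputable def lineEquiv (A : End ℂ V) (c : Unit → ℂ) : V ≃ₗ[ℂ] V :=
  if h : LinearMap.det (lineEnd A c) ≠ 0 then (lineEnd A c).equivOfDetNeZero h
  else LinearEquiv.refl ℂ V

theorem lineEquiv_apply {A : End ℂ V} {c : Unit → ℂ} (h : LinearMap.det (lineEnd A c) ≠ 0) (v : V) :
    lineEquiv A c v = v + c () • A v := by
  rw [lineEquiv, dif_pos h]
  simp [LinearMap.equivOfDetNeZero, lineEnd]

omit [FiniteDimensional ℂ V] in
theorem zero_mem_unitLocus (A : End ℂ V) : (0 : Unit → ℂ) ∈ unitLocus A := by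
  change LinearMap.det (lineEnd A 0) ≠ 0
  simp [lineEnd]

theorem exists_mem_unitLocus_ne_zero (A : End ℂ V) : ∃ c : Unit → ℂ,
    c ∈ unitLocus A ∧ c () ≠ 0 := by
  have h1 : IsOpen ({c : Unit → ℂ | c () ≠ 0} : Set (Zar (Unit → ℂ))) :=
    zar_isOpen_ne_zero (dual_mem_polyFun (LinearMap.proj () : Dual ℂ (Unit → ℂ)))
  obtain ⟨c, -, hc⟩ := isIrreducible_univ_zar_unit.2 _ _ (isOpen_unitLocus A) h1
    ⟨_, trivial, zero_mem_unitLocus A⟩ ⟨(1 : Unit → ℂ), trivial, one_ne_zero⟩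
  exact ⟨c, hc⟩

/-- Sweeping an irreducible set of flags along the line of automorphisms `1 + c A` gives an
irreducible set. -/
theorem isIrreducible_line (hV : finrank ℂ V = N) (A : End ℂ V)
    {Z : Set (CompleteFlag N V)} (hZ : IsIrreducible Z) :
    IsIrreducible (Set.image2 (fun (c : Zar (Unit → ℂ)) F => CompleteFlag.map (lineEquiv A c) F)
      (unitLocus A) Z) := by
  refine IsIrreducible.image2_of_separatelyContinuous ?_ hZ
    (fun F _ => ?_) (fun c _ => (continuous_flagMap _).continuousOn)
  · exact ⟨⟨_, zero_mem_unitLocus A⟩, isIrreducible_univ_zar_unit.2.open_subset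
      (isOpen_unitLocus A) (Set.subset_univ _)⟩
  · obtain ⟨b, rfl⟩ := exists_ofBasis_eq hV F
    rw [continuousOn_iff_continuous_domRestrict]
    have h : (unitLocus A).domRestrict (fun c => (CompleteFlag.ofBasis b).map (lineEquiv A c))
        = CompleteFlag.ofBasis ∘ fun c : unitLocus A => b.map (lineEquiv A c.1) :=
      funext fun c => map_ofBasis _ b
    rw [h]
    refine continuous_ofBasis.comp (continuous_induced_rng.mpr ?_)
    have h2 : PolyMap fun (c : Unit → ℂ) (i : Fin N) => b i + c () • A (b i) := by
      refine PolyMap.of_dual fun φ => ?_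
      have h3 : (fun c : Unit → ℂ => φ fun i => b i + c () • A (b i))
          = fun c => φ b + c () * φ fun i => A (b i) := by
        funext c
        rw [← smul_eq_mul, ← map_smul, ← map_add]
        rfl
      rw [h3]
      exact add_mem (const_mem_polyFun _) (mul_mem (dual_mem_polyFun
        (LinearMap.proj () : Dual ℂ (Unit → ℂ))) (const_mem_polyFun _))
    have h4 := h2.continuous.comp (continuous_subtype_val (p := fun c => c ∈ unitLocus A))
    refine h4.congr fun c => ?_
    funext i
    exact (lineEquiv_apply c.2 (b i)).symm

end OneParameter

section Chains

variable {N : ℕ} {V : Type*} [AddCommGroup V] [Module ℂ V] [FiniteDimensional ℂ V]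

theorem map_mem_springerFiber {x A : End ℂ V} (hA : ∀ v, A (x v) = x (A v)) {c : Unit → ℂ}
    (hc : c ∈ unitLocus A) {F : CompleteFlag N V} (hF : F ∈ springerFiber N x) :
    F.map (lineEquiv A c) ∈ springerFiber N x := by
  rintro i _ ⟨_, ⟨w, hw, rfl⟩, rfl⟩
  refine ⟨x w, hF i (Submodule.mem_map_of_mem hw), ?_⟩
  change lineEquiv A c (x w) = x (lineEquiv A c w)
  rw [lineEquiv_apply hc, lineEquiv_apply hc, hA, map_add, map_smul]

/-- A chain of irreducible closed subsets of the Springer fibre, all of whose flags have their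
`i`-th space in `U`, can be extended by sweeping its last member along `1 + c A`, for `A` commuting
with `x`, as soon as the `i`-th space of some flag `F` is not sent into `U` by `A`. -/
theorem exists_longer_chain (hV : finrank ℂ V = N) {x A : End ℂ V}
    (hA : ∀ v, A (x v) = x (A v)) {i : Fin (N + 1)}
    (l : LTSeries (IrreducibleCloseds (CompleteFlag N V))) {F : CompleteFlag N V}
    (hF : F ∈ (l.last : Set (CompleteFlag N V)))
    (hl : (l.last : Set (CompleteFlag N V)) ⊆ springerFiber N x) {U U' : Submodule ℂ V}
    (hU : ∀ G ∈ (l.last : Set (CompleteFlag N V)), G.sub i ≤ U) (hUU : U ≤ U')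
    (hAU : U ≤ U'.comap A) {v : V} (hv : v ∈ F.sub i) (hAv : A v ∉ U) :
    ∃ l' : LTSeries (IrreducibleCloseds (CompleteFlag N V)), l'.length = l.length + 1 ∧
      F ∈ (l'.last : Set (CompleteFlag N V)) ∧
      (l'.last : Set (CompleteFlag N V)) ⊆ springerFiber N x ∧
      ∀ G ∈ (l'.last : Set (CompleteFlag N V)), G.sub i ≤ U' := by
  let T := Set.image2 (fun (c : Zar (Unit → ℂ)) F => CompleteFlag.map (lineEquiv A c) F)
      (unitLocus A) (l.last : Set (CompleteFlag N V))
  have hT : IsIrreducible T := isIrreducible_line hV A l.last.isIrreducible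
  have h0 : ∀ G : CompleteFlag N V, G.map (lineEquiv A (0 : Unit → ℂ)) = G := by
    intro G
    ext j w
    constructor
    · rintro ⟨z, hz, rfl⟩
      change lineEquiv A (0 : Unit → ℂ) z ∈ _
      rw [lineEquiv_apply (zero_mem_unitLocus A)]
      simpa using hz
    · intro hw
      refine ⟨w, hw, ?_⟩
      change lineEquiv A (0 : Unit → ℂ) w = w
      rw [lineEquiv_apply (zero_mem_unitLocus A)]
      simp
  have hlT : (l.last : Set (CompleteFlag N V)) ⊆ T := fun G hG =>
    ⟨_, zero_mem_unitLocus A, G, hG, h0 G⟩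
  have hlt : l.last < (⟨closure T, hT.closure, isClosed_closure⟩ : IrreducibleCloseds _) := by
    refine lt_of_le_of_ne (hlT.trans subset_closure) fun heq => ?_
    -- for `c ≠ 0` the flag `(1 + c A) F` is not in the last member, as its `i`-th space is not
    -- contained in `U`
    obtain ⟨c, hc, hc0⟩ := exists_mem_unitLocus_ne_zero A
    have h1 : F.map (lineEquiv A c) ∈ (l.last : Set (CompleteFlag N V)) := by
      rw [heq]
      exact subset_closure ⟨c, hc, F, hF, rfl⟩
    have h2 : lineEquiv A c v ∈ U := hU _ h1 (Submodule.mem_map_of_mem hv)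
    rw [lineEquiv_apply hc] at h2
    have h3 := (Submodule.add_mem_iff_right _ (hU F hF hv)).mp h2
    exact hAv ((Submodule.smul_mem_iff _ hc0).mp h3)
  refine ⟨l.snoc _ hlt, rfl, ?_, ?_, ?_⟩
  · rw [RelSeries.last_snoc]
    exact subset_closure (hlT hF)
  · rw [RelSeries.last_snoc]
    refine closure_minimal ?_ (isClosed_springerFiber x)
    rintro _ ⟨c, hc, G, hG, rfl⟩
    exact map_mem_springerFiber hA hc (hl hG)
  · rw [RelSeries.last_snoc]
    refine closure_minimal ?_ (isClosed_sub_le U' i)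
    rintro _ ⟨c, hc, G, hG, rfl⟩ _ ⟨w, hw, rfl⟩
    change lineEquiv A c w ∈ U'
    rw [lineEquiv_apply hc]
    exact add_mem (hUU (hU G hG hw)) (Submodule.smul_mem _ _ (hAU (hU G hG hw)))

/-- A vector `v` of depth at most `j` can be moved in the direction of any `w ∈ ker x ∩ im x ^ j` by
an endomorphism that commutes with `x`: with `w = x ^ j u` and `φ` vanishing on `im x ^ (j + 1)`, it
is `z ↦ ∑ φ (x ^ (j - i) z) x ^ i u`, a sum over `i ≤ j`. -/
theorem exists_commuting {K W : Type*} [Field K] [AddCommGroup W] [Module K W] {x : End K W}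
    {v w : W} {j : ℕ} (hvj : v ∉ LinearMap.range (x ^ (j + 1)))
    (hw : w ∈ LinearMap.ker x ⊓ LinearMap.range (x ^ j)) :
    ∃ (A : End K W) (φ : Dual K W), (∀ z, A (x z) = x (A z)) ∧ φ v = 1 ∧
      ∀ z, x z = 0 → A z = φ z • w := by
  obtain ⟨hxw, u, rfl⟩ := hw
  obtain ⟨φ₀, hφ₀, hker⟩ := (LinearMap.range (x ^ (j + 1))).exists_le_ker_of_notMem hvj
  let φ := (φ₀ v)⁻¹ • φ₀
  have hφ : ∀ z, φ ((x ^ (j + 1)) z) = 0 := fun z => by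
    have h : φ₀ ((x ^ (j + 1)) z) = 0 := hker ⟨z, rfl⟩
    rw [LinearMap.smul_apply, h, smul_zero]
  have hxu : (x ^ (j + 1)) u = 0 := by rw [pow_succ', Module.End.mul_apply]; exact hxw
  refine ⟨∑ i ∈ Finset.range (j + 1), (φ ∘ₗ (x ^ (j - i))).smulRight ((x ^ i) u), φ, fun z => ?_,
    by simp [φ, hφ₀], fun z hz => ?_⟩
  · simp only [LinearMap.sum_apply, LinearMap.smulRight_apply, LinearMap.comp_apply, map_sum,
      map_smul]
    rw [Finset.sum_range_succ', Finset.sum_range_succ (fun i => _ • x ((x ^ i) u))]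
    rw [← Module.End.mul_apply x (x ^ j), ← pow_succ', hxu, smul_zero, Nat.sub_zero,
      ← Module.End.mul_apply (x ^ j) x, ← pow_succ, hφ, zero_smul]
    congr 1
    refine Finset.sum_congr rfl fun i hi => ?_
    have hi' := Finset.mem_range.mp hi
    rw [← Module.End.mul_apply x (x ^ i), ← pow_succ', ← Module.End.mul_apply _ x, ← pow_succ,
      show j - (i + 1) + 1 = j - i by omega]
  · simp only [LinearMap.sum_apply, LinearMap.smulRight_apply, LinearMap.comp_apply]
    rw [Finset.sum_range_succ, Nat.sub_self, pow_zero, Module.End.one_apply,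
      Finset.sum_eq_zero fun i hi => ?_, zero_add]
    have hi' := Finset.mem_range.mp hi
    obtain ⟨k, hk⟩ := Nat.exists_eq_add_of_lt hi'
    rw [show j - i = k + 1 by omega, pow_succ, Module.End.mul_apply, hz, map_zero, map_zero,
      zero_smul]

/-- Suppose that the flags in the last member of a chain all have the line of `v` as their `i`-th
space, and that `v ∈ ker x` has depth `j`. The line can be swept over larger and larger subspaces of
`ker x ∩ im x ^ j`, which makes the chain longer by `kerRank x j - 1`. -/
theorem exists_chain_of_depth (hV : finrank ℂ V = N) {x : End ℂ V} {i : Fin (N + 1)} {j : ℕ} {v : V}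
    (hxv : x v = 0) (hv0 : v ≠ 0) (hvr : v ∈ LinearMap.range (x ^ j))
    (hvj : v ∉ LinearMap.range (x ^ (j + 1)))
    (l : LTSeries (IrreducibleCloseds (CompleteFlag N V))) {F : CompleteFlag N V}
    (hF : F ∈ (l.last : Set (CompleteFlag N V)))
    (hl : (l.last : Set (CompleteFlag N V)) ⊆ springerFiber N x)
    (hU : ∀ G ∈ (l.last : Set (CompleteFlag N V)), G.sub i ≤ Submodule.span ℂ {v})
    (hv : v ∈ F.sub i) :
    ∃ l' : LTSeries (IrreducibleCloseds (CompleteFlag N V)), l'.length + 1 =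
      l.length + kerRank x j ∧
      F ∈ (l'.last : Set (CompleteFlag N V)) ∧
      (l'.last : Set (CompleteFlag N V)) ⊆ springerFiber N x := by
  have hvU : v ∈ LinearMap.ker x ⊓ LinearMap.range (x ^ j) := Submodule.mem_inf.mpr ⟨hxv, hvr⟩
  have key : ∀ k < kerRank x j, ∃ (U : Submodule ℂ V)
      (l' : LTSeries (IrreducibleCloseds (CompleteFlag N V))),
      U ≤ LinearMap.ker x ⊓ LinearMap.range (x ^ j) ∧ finrank ℂ U = k + 1 ∧
      l'.length = l.length + k ∧ F ∈ (l'.last : Set (CompleteFlag N V)) ∧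
      (l'.last : Set (CompleteFlag N V)) ⊆ springerFiber N x ∧
      ∀ G ∈ (l'.last : Set (CompleteFlag N V)), G.sub i ≤ U := by
    intro k hk
    induction k with
    | zero =>
      exact ⟨_, l, (Submodule.span_singleton_le_iff_mem v _).mpr hvU, finrank_span_singleton hv0,
        rfl, hF, hl, hU⟩
    | succ k ih =>
      obtain ⟨U, l', hUle, hUk, hlen, hF', hl', hU'⟩ := ih (by omega)
      have hlt : U < LinearMap.ker x ⊓ LinearMap.range (x ^ j) := by
        refine lt_of_le_of_ne hUle fun h => ?_
        rw [h] at hUk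
        rw [kerRank] at hk
        omega
      obtain ⟨w, hw, hwU⟩ := SetLike.exists_of_lt hlt
      obtain ⟨A, φ, hA, hφ, hAz⟩ := exists_commuting hvj hw
      have hAU : U ≤ (U ⊔ Submodule.span ℂ {w}).comap A := fun z hz => by
        rw [Submodule.mem_comap, hAz z (hUle hz).1]
        exact Submodule.mem_sup_right (Submodule.smul_mem _ _ (Submodule.mem_span_singleton_self w))
      obtain ⟨l'', h1, h2, h3, h4⟩ := exists_longer_chain hV hA l' hF' hl' hU'
        (U' := U ⊔ Submodule.span ℂ {w}) le_sup_left hAU hv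
        (by rwa [hAz v hxv, hφ, one_smul])
      exact ⟨_, l'', sup_le hUle ((Submodule.span_singleton_le_iff_mem w _).mpr hw),
        by rw [Submodule.finrank_sup_span_singleton hwU, hUk], by omega, h2, h3, h4⟩
  have hpos : 0 < kerRank x j := by
    rw [kerRank, finrank_pos_iff_exists_ne_zero]
    exact ⟨⟨v, hvU⟩, fun h => hv0 (congrArg Subtype.val h)⟩
  obtain ⟨U, l', -, -, h1, h2, h3, -⟩ := key (kerRank x j - 1) (by omega)
  exact ⟨l', by omega, h2, h3⟩

end Chains

/-! ### Flags with a given first line -/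

section PolyMap

variable {M M' : Type*} [AddCommGroup M] [Module ℂ M] [AddCommGroup M'] [Module ℂ M']

theorem PolyMap.dual {f : M → M'} (hf : PolyMap f) (φ : Dual ℂ M') :
    (fun v => φ (f v)) ∈ polyFun M := hf _ (dual_mem_polyFun φ)

theorem PolyMap.pi {ι : Type*} [Finite ι] {f : M → ι → M'} (h : ∀ i, PolyMap fun v => f v i) :
    PolyMap f := by
  classical
  have := Fintype.ofFinite ι
  refine PolyMap.of_dual fun φ => ?_
  have h1 : (fun v => φ (f v)) = fun v => ∑ i,
    (φ ∘ₗ LinearMap.single ℂ (fun _ => M') i) (f v i) := by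
    funext v
    conv_lhs => rw [← Finset.univ_sum_single (f v), map_sum]
    rfl
  rw [h1]
  exact sum_mem_polyFun _ fun i _ => (h i).dual _

theorem PolyMap.smul {P : M → ℂ} {f : M → M'} (hP : P ∈ polyFun M) (hf : PolyMap f) :
    PolyMap fun v => P v • f v := by
  refine PolyMap.of_dual fun φ => ?_
  simp only [map_smul, smul_eq_mul]
  exact mul_mem hP (hf.dual φ)

theorem PolyMap.sub {f g : M → M'} (hf : PolyMap f) (hg : PolyMap g) :
    PolyMap fun v => f v - g v := by
  refine PolyMap.of_dual fun φ => ?_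
  simp only [map_sub]
  exact sub_mem (hf.dual φ) (hg.dual φ)

theorem PolyMap.const (w : M') : PolyMap fun _ : M => w :=
  PolyMap.of_dual fun φ => const_mem_polyFun (φ w)

end PolyMap

section Extend

variable {N : ℕ} {V W : Type*} [AddCommGroup V] [Module ℂ V] [AddCommGroup W] [Module ℂ W]

/-- `W` is identified with the quotient of `V` by the line of `v`, by means of a projection `p`,
whose section `s` has image `ker ψ`, for a linear functional `ψ` with `ψ v = 1`. -/
structure IsProjAlong (ψ : Dual ℂ V) (v : V) (s : W →ₗ[ℂ] V) (p : V →ₗ[ℂ] W) : Prop where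
  psi_v : ψ v = 1
  psi_s : ∀ w, ψ (s w) = 0
  ps : ∀ w, p (s w) = w
  sp : ∀ z, s (p z) = z - ψ z • v

variable {ψ : Dual ℂ V} {v : V} {s : W →ₗ[ℂ] V} {p : V →ₗ[ℂ] W}

namespace IsProjAlong

theorem p_v (h : IsProjAlong ψ v s p) : p v = 0 := by
  rw [← h.ps (p v), h.sp, h.psi_v, one_smul, sub_self, map_zero]

theorem ne_zero (h : IsProjAlong ψ v s p) : v ≠ 0 := by
  rintro rfl
  simpa using h.psi_v

theorem ker_p (h : IsProjAlong ψ v s p) : LinearMap.ker p = Submodule.span ℂ {v} := by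
  refine le_antisymm (fun z hz => ?_) ?_
  · have h1 := h.sp z
    rw [LinearMap.mem_ker.mp hz, map_zero, eq_comm, sub_eq_zero] at h1
    rw [h1]
    exact Submodule.smul_mem _ _ (Submodule.mem_span_singleton_self v)
  · rw [Submodule.span_singleton_le_iff_mem]
    exact h.p_v

theorem finrank_eq [FiniteDimensional ℂ V] (h : IsProjAlong ψ v s p) :
    finrank ℂ W + 1 = finrank ℂ V := by
  have h1 := LinearMap.finrank_range_add_finrank_ker p
  rw [h.ker_p, finrank_span_singleton h.ne_zero,
    LinearMap.range_eq_top.mpr fun w => ⟨s w, h.ps w⟩, finrank_top] at h1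
  exact h1

/-- A frame of `W` is lifted to `V` and preceded by `v`. -/
theorem linearIndependent_cons (h : IsProjAlong ψ v s p) {w : Fin N → W}
    (hw : LinearIndependent ℂ w) :
    LinearIndependent ℂ (Fin.cons v (fun i => s (w i)) : Fin (N + 1) → V) := by
  rw [Fintype.linearIndependent_iff] at hw ⊢
  intro c hc
  rw [Fin.sum_univ_succ] at hc
  simp only [Fin.cons_zero, Fin.cons_succ] at hc
  have h1 := congrArg p hc
  rw [map_add, map_smul, h.p_v, smul_zero, zero_add, map_zero, map_sum] at h1
  simp only [map_smul, h.ps] at h1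
  have h2 := hw _ h1
  have h3 := congrArg ψ hc
  simp only [map_add, map_smul, map_sum, h.psi_v, h.psi_s, map_zero, smul_eq_mul, mul_one,
    mul_zero, Finset.sum_const_zero, add_zero] at h3
  exact fun i => Fin.cases h3 h2 i

end IsProjAlong

/-- The flag of `V` that begins with the line of `v` and induces the flag `F` on the quotient
`W`. -/
def extendFlag [FiniteDimensional ℂ V] (h : IsProjAlong ψ v s p) (F : CompleteFlag N W) :
    CompleteFlag (N + 1) V where
  sub := Fin.cases ⊥ fun i => (F.sub i).comap p
  mono := by
    intro i j
    refine Fin.cases (fun _ => bot_le) (fun i => ?_) i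
    refine Fin.cases (fun hij => absurd hij (by simp)) (fun j hij => ?_) j
    exact Submodule.comap_mono (F.mono (Fin.succ_le_succ_iff.mp hij))
  finrank_sub i := by
    refine Fin.cases (finrank_bot ℂ V) (fun i => ?_) i
    have h1 := finrank_map_add_finrank_inf_ker p ((F.sub i).comap p)
    rw [Submodule.map_comap_eq_of_surjective fun w => ⟨s w, h.ps w⟩, F.finrank_sub,
      inf_eq_right.mpr (LinearMap.ker_le_comap p), h.ker_p, finrank_span_singleton h.ne_zero] at h1
    rw [Fin.cases_succ, ← h1, Fin.val_succ]

variable [FiniteDimensional ℂ V] (h : IsProjAlong ψ v s p)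

theorem extendFlag_sub_succ (F : CompleteFlag N W) (i : Fin (N + 1)) :
    (extendFlag h F).sub i.succ = (F.sub i).comap p := rfl

theorem isFrameMap_extendFlag : IsFrameMap (extendFlag h (N := N)) Set.univ
    (fun w => (Fin.cons v (fun i => s (w i)) : Fin (N + 1) → V)) where
  poly := by
    refine PolyMap.pi fun i => Fin.cases ?_ (fun i => ?_) i
    · exact PolyMap.const v
    · exact PolyMap.linear (s ∘ₗ (LinearMap.proj i : (Fin N → W) →ₗ[ℂ] W))
  mem_iff b := iff_of_true trivial (h.linearIndependent_cons b.linearIndependent)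
  mem_sub b _ i := by
    rw [extendFlag_sub_succ, ofBasis_sub_eq_basisFlag]
    refine Fin.cases ?_ (fun i => ?_) i
    · rw [Fin.cons_zero, Submodule.mem_comap, h.p_v]
      exact zero_mem _
    · rw [Fin.cons_succ, Submodule.mem_comap, h.ps]
      exact self_mem_basisFlag b i

theorem continuous_extendFlag (hV : finrank ℂ V = N + 1) : Continuous (extendFlag h (N := N)) := by
  rw [← continuousOn_univ]
  exact (isFrameMap_extendFlag h).continuousOn hV

/-- Given a frame `b` of `V` with `ψ (b 0) ≠ 0`, the vectors `b (i + 1)` are corrected by multiples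
of `b 0` so as to lie in `ker ψ`. The denominator `ψ (b 0)` is cleared; the additional factor
`ψ (b 0)` makes the result `0` when `ψ (b 0) = 0`, so that the result is a frame only for
`ψ (b 0) ≠ 0`. -/
def restrictFrame (ψ : Dual ℂ V) (p : V →ₗ[ℂ] W) (b : Fin (N + 1) → V) (i : Fin N) : W :=
  p (ψ (b 0) • (ψ (b 0) • b i.succ - ψ (b i.succ) • b 0))

open Classical in
/-- The flag of intersections of `G` with `ker ψ`, transported to `W`, where these intersections
form a complete flag (with the index shifted by one); the flag `F₀` otherwise. This is a retraction
of `extendFlag`. -/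
noncomputable def restrictFlag (s : W →ₗ[ℂ] V) (F₀ : CompleteFlag N W)
    (G : CompleteFlag (N + 1) V) : CompleteFlag N W :=
  if hG : ∃ F : CompleteFlag N W, ∀ i, F.sub i = (G.sub i.succ).comap s then hG.choose else F₀

omit [FiniteDimensional ℂ V] in
include h in
theorem repr_restrictFrame (b : Basis (Fin (N + 1)) ℂ V) (i k : Fin N) :
    b.repr (s (restrictFrame ψ p b i)) k.succ = if i = k then ψ (b 0) * ψ (b 0) else 0 := by
  rw [restrictFrame, h.sp]
  simp only [map_smul, map_sub, smul_eq_mul, mul_comm (ψ (b i.succ)), sub_self, mul_zero, zero_smul,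
    Finsupp.smul_apply, Finsupp.sub_apply, b.repr_self, Finsupp.single_apply,
    Fin.succ_inj, (Fin.succ_ne_zero k).symm, if_false, sub_zero]
  split_ifs <;> simp

omit [FiniteDimensional ℂ V] in
include h in
theorem repr_sum_restrictFrame (b : Basis (Fin (N + 1)) ℂ V) (c : Fin N → ℂ) (k : Fin N) :
    b.repr (s (∑ i, c i • restrictFrame ψ p b i)) k.succ = c k * (ψ (b 0) * ψ (b 0)) := by
  simp only [map_sum, map_smul, Finsupp.finsetSum_apply, Finsupp.smul_apply,
    repr_restrictFrame h, smul_eq_mul, mul_ite, mul_zero, Finset.sum_ite_eq', Finset.mem_univ,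
    if_true]

omit [FiniteDimensional ℂ V] in
include h in
theorem linearIndependent_restrictFrame {b : Basis (Fin (N + 1)) ℂ V} (hb : ψ (b 0) ≠ 0) :
    LinearIndependent ℂ (restrictFrame ψ p b) := by
  rw [Fintype.linearIndependent_iff]
  intro c hc k
  have h1 := repr_sum_restrictFrame h b c k
  rw [hc, map_zero, map_zero, Finsupp.zero_apply, eq_comm] at h1
  exact (mul_eq_zero.mp h1).resolve_right (mul_ne_zero hb hb)

omit [FiniteDimensional ℂ V] in
theorem ofBasis_sub_one_le_ker_iff (b : Basis (Fin (N + 1)) ℂ V) :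
    (CompleteFlag.ofBasis b).sub 1 ≤ LinearMap.ker ψ ↔ ψ (b 0) = 0 := by
  rw [ofBasis_sub_eq_basisFlag]
  constructor
  · intro hle
    refine hle (basisFlag_mono b ?_ (self_mem_basisFlag b 0))
    simp
  · intro hb
    refine mem_of_mem_basisFlag fun k hk => ?_
    have hk0 : k = 0 := Fin.ext (by simpa using hk)
    rw [hk0]
    exact hb

include h in
theorem isFrameMap_restrictFlag (hW : finrank ℂ W = N) (F₀ : CompleteFlag N W) :
    IsFrameMap (restrictFlag s F₀) {G | ¬ G.sub 1 ≤ LinearMap.ker ψ} (restrictFrame ψ p) where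
  poly := by
    have hb : ∀ i : Fin (N + 1), (fun b : Fin (N + 1) → V => ψ (b i)) ∈ polyFun (Fin (N + 1) → V) :=
      fun i => dual_mem_polyFun (ψ ∘ₗ (LinearMap.proj i : (Fin (N + 1) → V) →ₗ[ℂ] V))
    have hp : ∀ i : Fin (N + 1), PolyMap fun b : Fin (N + 1) → V => b i := fun i =>
      PolyMap.linear (LinearMap.proj i : (Fin (N + 1) → V) →ₗ[ℂ] V)
    exact PolyMap.pi fun i => (PolyMap.linear p).comp
      (PolyMap.smul (hb 0) ((PolyMap.smul (hb 0) (hp _)).sub (PolyMap.smul (hb _) (hp 0))))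
  mem_iff b := by
    change ¬ _ ↔ _
    rw [ofBasis_sub_one_le_ker_iff]
    refine ⟨linearIndependent_restrictFrame h, fun hli hb => ?_⟩
    rcases N with _ | N
    -- the empty family is a frame of `W = 0`, but then `ψ (b 0) = 0` is absurd
    · have h1 : ψ = 0 := b.ext fun i => by
        rw [show i = 0 from Fin.ext (by omega), hb, LinearMap.zero_apply]
      have h2 := h.psi_v
      rw [h1] at h2
      exact zero_ne_one h2
    · refine hli.ne_zero 0 ?_
      rw [restrictFrame, hb, zero_smul, map_zero]
  mem_sub b hb i := by
    change ¬ _ at hb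
    rw [ofBasis_sub_one_le_ker_iff] at hb
    have := Module.Finite.of_surjective p fun w => ⟨s w, h.ps w⟩
    obtain ⟨b', hb'⟩ := exists_basis_of_linearIndependent hW (linearIndependent_restrictFrame h hb)
    have h1 : ∀ w : W, ∀ k : Fin N, b.repr (s w) k.succ = b'.repr w k * (ψ (b 0) * ψ (b 0)) := by
      intro w k
      rw [← repr_sum_restrictFrame h b, ← hb', b'.sum_repr]
    have h2 : ∀ i, (CompleteFlag.ofBasis b').sub i
        = ((CompleteFlag.ofBasis b).sub i.succ).comap s := by
      intro i
      ext w
      rw [Submodule.mem_comap, mem_ofBasis_sub_iff, mem_ofBasis_sub_iff]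
      constructor
      · intro hw k
        refine Fin.cases (fun hk => absurd hk (by simp)) (fun k hk => ?_) k
        rw [h1, hw k (by simpa using hk), zero_mul]
      · intro hw k hk
        have h3 := hw k.succ (by simpa using hk)
        rw [h1] at h3
        exact (mul_eq_zero.mp h3).resolve_right (mul_ne_zero hb hb)
    have h3 : ∃ F : CompleteFlag N W, ∀ i, F.sub i =
      ((CompleteFlag.ofBasis b).sub i.succ).comap s :=
      ⟨_, h2⟩
    rw [restrictFlag, dif_pos h3, h3.choose_spec, ← h2, ofBasis_sub_eq_basisFlag, ← hb']
    exact self_mem_basisFlag b' i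

theorem restrictFlag_extendFlag (F₀ F : CompleteFlag N W) :
    restrictFlag s F₀ (extendFlag h F) = F := by
  have h1 : ∀ i, F.sub i = ((extendFlag h F).sub i.succ).comap s := by
    intro i
    ext w
    rw [extendFlag_sub_succ, Submodule.mem_comap, Submodule.mem_comap, h.ps]
  have h2 : ∃ F' : CompleteFlag N W, ∀ i, F'.sub i = ((extendFlag h F).sub i.succ).comap s :=
    ⟨F, h1⟩
  rw [restrictFlag, dif_pos h2]
  exact CompleteFlag.ext (funext fun i => (h2.choose_spec i).trans (h1 i).symm)

end Extend

/-! ### Chains of irreducible closed subsets of Springer fibres -/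

section Step

variable {N : ℕ} {V W : Type*} [AddCommGroup V] [Module ℂ V] [AddCommGroup W] [Module ℂ W]
  {ψ : Dual ℂ V} {v : V} {s : W →ₗ[ℂ] V} {p : V →ₗ[ℂ] W} {x : End ℂ V}

theorem exists_isProjAlong {v : V} (hv : v ≠ 0) : ∃ (ψ : Dual ℂ V)
    (p : V →ₗ[ℂ] LinearMap.ker ψ), IsProjAlong ψ v (LinearMap.ker ψ).subtype p := by
  obtain ⟨ψ₀, hψ₀, -⟩ := (⊥ : Submodule ℂ V).exists_le_ker_of_notMem (v := v) (by simpa using hv)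
  let ψ : Dual ℂ V := (ψ₀ v)⁻¹ • ψ₀
  have hψ : ψ v = 1 := by simp [ψ, hψ₀]
  refine ⟨ψ, (LinearMap.id - ψ.smulRight v).codRestrict _ fun z => ?_, hψ, fun w => w.2,
    fun w => ?_,
    fun z => rfl⟩
  · ext
    have : ψ w = 0 := w.2
    simp [this]
  · simp [hψ]

namespace IsProjAlong

variable (h : IsProjAlong ψ v s p) (hxv : x v = 0)
include h hxv

theorem map_apply (z : V) : p (x (s (p z))) = p (x z) := by
  rw [h.sp, map_sub, map_smul, hxv, smul_zero, sub_zero]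

theorem pow_apply (z : V) (i : ℕ) :
    ((p ∘ₗ x ∘ₗ s : End ℂ W) ^ i) (p z) = p ((x ^ i) z) := by
  induction i generalizing z with
  | zero => rfl
  | succ i ih =>
    rw [pow_succ, Module.End.mul_apply, LinearMap.comp_apply, LinearMap.comp_apply,
      h.map_apply hxv, ih, pow_succ, Module.End.mul_apply]

theorem isNilpotent (hx : IsNilpotent x) : IsNilpotent (p ∘ₗ x ∘ₗ s : End ℂ W) := by
  obtain ⟨k, hk⟩ := hx
  refine ⟨k, LinearMap.ext fun a => ?_⟩
  rw [← h.ps a, h.pow_apply hxv, hk, LinearMap.zero_apply, map_zero, LinearMap.zero_apply]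

theorem range_pow (i : ℕ) : LinearMap.range ((p ∘ₗ x ∘ₗ s : End ℂ W) ^ i)
    = (LinearMap.range (x ^ i)).map p := by
  ext a
  constructor
  · rintro ⟨b, rfl⟩
    rw [← h.ps b, h.pow_apply hxv]
    exact ⟨_, ⟨s b, rfl⟩, rfl⟩
  · rintro ⟨_, ⟨w, rfl⟩, rfl⟩
    exact ⟨p w, h.pow_apply hxv w i⟩

variable [FiniteDimensional ℂ V]

theorem finrank_range_pow_eq (i : ℕ) :
    (v ∈ LinearMap.range (x ^ i) → finrank ℂ (LinearMap.range ((p ∘ₗ x ∘ₗ s : End ℂ W) ^ i)) + 1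
      = finrank ℂ (LinearMap.range (x ^ i))) ∧
    (v ∉ LinearMap.range (x ^ i) → finrank ℂ (LinearMap.range ((p ∘ₗ x ∘ₗ s : End ℂ W) ^ i))
      = finrank ℂ (LinearMap.range (x ^ i))) := by
  have h1 := finrank_map_add_finrank_inf_ker p (LinearMap.range (x ^ i))
  rw [h.ker_p, ← h.range_pow hxv] at h1
  constructor
  · intro hv
    rwa [inf_eq_right.mpr ((Submodule.span_singleton_le_iff_mem v _).mpr hv),
      finrank_span_singleton h.ne_zero] at h1
  · intro hv
    rwa [disjoint_iff.mp ((Submodule.disjoint_span_singleton' h.ne_zero).mpr hv), finrank_bot,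
      add_zero] at h1

/-- Passing to the quotient by the line of a vector in `ker x` of depth `j` shortens a Jordan block
of size `j + 1` by one. -/
theorem kerRank_eq [FiniteDimensional ℂ W] {j : ℕ} (hv : v ∈ LinearMap.range (x ^ j))
    (hvj : v ∉ LinearMap.range (x ^ (j + 1))) :
    kerRank (p ∘ₗ x ∘ₗ s) j + 1 = kerRank x j ∧
      ∀ i ≠ j, kerRank (p ∘ₗ x ∘ₗ s) i = kerRank x i := by
  have hle : ∀ i ≤ j, finrank ℂ (LinearMap.range ((p ∘ₗ x ∘ₗ s : End ℂ W) ^ i)) + 1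
      = finrank ℂ (LinearMap.range (x ^ i)) := fun i hi =>
    (h.finrank_range_pow_eq hxv i).1 (range_pow_le hi hv)
  have hgt : ∀ i > j, finrank ℂ (LinearMap.range ((p ∘ₗ x ∘ₗ s : End ℂ W) ^ i))
      = finrank ℂ (LinearMap.range (x ^ i)) := fun i hi =>
    (h.finrank_range_pow_eq hxv i).2 fun hm => hvj (range_pow_le hi hm)
  have hr := finrank_range_pow x
  have hr' := finrank_range_pow (p ∘ₗ x ∘ₗ s : End ℂ W)
  refine ⟨?_, fun i hi => ?_⟩
  · have := hle j le_rfl; have := hgt (j + 1) (Nat.lt_succ_self j); have := hr j; have := hr' j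
    omega
  · have := hr i
    have := hr' i
    rcases lt_or_gt_of_ne hi with hi | hi
    · have := hle i hi.le; have := hle (i + 1) hi; omega
    · have := hgt i hi; have := hgt (i + 1) (by omega); omega

theorem extendFlag_mem_springerFiber {G : CompleteFlag N W}
    (hG : G ∈ springerFiber N (p ∘ₗ x ∘ₗ s)) : extendFlag h G ∈ springerFiber (N + 1) x := by
  intro i
  refine Fin.cases ?_ (fun i => ?_) i
  · rintro _ ⟨z, hz, rfl⟩
    have := Module.Finite.of_surjective p fun w => ⟨s w, h.ps w⟩
    have h0 : G.sub 0 = ⊥ := Submodule.finrank_eq_zero.mp (G.finrank_sub 0)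
    have hz' : z ∈ (G.sub 0).comap p := hz
    rw [h0, ← LinearMap.ker, h.ker_p] at hz'
    obtain ⟨c, rfl⟩ := Submodule.mem_span_singleton.mp hz'
    rw [map_smul, hxv, smul_zero]
    exact zero_mem _
  · rintro _ ⟨z, hz, rfl⟩
    have hz' : p z ∈ G.sub i.succ := hz
    have h1 := hG i (Submodule.mem_map_of_mem hz')
    rw [LinearMap.comp_apply, LinearMap.comp_apply, h.map_apply hxv] at h1
    exact h1

theorem exists_extendFlag_eq {F : CompleteFlag (N + 1) V} (hF : F ∈ springerFiber (N + 1) x)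
    (hv : v ∈ F.sub 1) :
    ∃ G ∈ springerFiber N (p ∘ₗ x ∘ₗ s), extendFlag h G = F := by
  have hvi : ∀ i : Fin (N + 1), v ∈ F.sub i.succ := fun i => F.mono (by simp [Fin.le_def]) hv
  have hker : ∀ i : Fin (N + 1), LinearMap.ker p ≤ F.sub i.succ := fun i => by
    rw [h.ker_p, Submodule.span_singleton_le_iff_mem]
    exact hvi i
  let G : CompleteFlag N W :=
    { sub := fun i => (F.sub i.succ).map p
      mono := fun i j hij => Submodule.map_mono (F.mono (Fin.succ_le_succ_iff.mpr hij))
      finrank_sub := fun i => by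
        have h1 := finrank_map_add_finrank_inf_ker p (F.sub i.succ)
        rw [inf_eq_right.mpr (hker i), h.ker_p, finrank_span_singleton h.ne_zero,
          F.finrank_sub] at h1
        simpa using h1 }
  refine ⟨G, ?_, ?_⟩
  · rintro i _ ⟨_, ⟨z, hz, rfl⟩, rfl⟩
    rw [LinearMap.comp_apply, LinearMap.comp_apply, h.map_apply hxv]
    exact Submodule.mem_map_of_mem (hF i.succ (Submodule.mem_map_of_mem hz))
  · refine CompleteFlag.ext (funext fun i => ?_)
    refine Fin.cases ?_ (fun i => ?_) i
    · exact (Submodule.finrank_eq_zero.mp (F.finrank_sub 0)).symm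
    · change ((F.sub i.succ).map p).comap p = F.sub i.succ
      rw [Submodule.comap_map_eq, sup_eq_left.mpr (hker i)]

end IsProjAlong

variable [FiniteDimensional ℂ V]

/-- The closure of the image of an irreducible closed set of flags of `W` under `extendFlag`. -/
def extendClosed (hV : finrank ℂ V = N + 1) (h : IsProjAlong ψ v s p)
    (Z : IrreducibleCloseds (CompleteFlag N W)) : IrreducibleCloseds (CompleteFlag (N + 1) V) :=
  ⟨closure (extendFlag h '' Z), (Z.isIrreducible.image _
    (continuous_extendFlag h hV).continuousOn).closure, isClosed_closure⟩

/-- The map `extendFlag` is a closed embedding; all that is needed is that it has the continuous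
retraction `restrictFlag` on an open set containing its image. -/
theorem extendClosed_strictMono (hV : finrank ℂ V = N + 1) (h : IsProjAlong ψ v s p) :
    StrictMono (extendClosed (N := N) hV h) := by
  intro Z Z' hZ
  refine lt_of_le_of_ne (closure_mono (Set.image_mono hZ.le)) fun heq => ?_
  obtain ⟨F, hF, hFZ⟩ := SetLike.exists_of_lt hZ
  have hfW := Module.Finite.of_surjective p fun w => ⟨s w, h.ps w⟩
  have hW : finrank ℂ W = N := by have := h.finrank_eq; omega
  have hop := (isFrameMap_restrictFlag h hW F).isOpen_inter_preimage hW Z.isClosed.isOpen_compl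
  have hmem : extendFlag h F ∈ closure (extendFlag h '' Z) := by
    have h1 : extendFlag h F ∈ (extendClosed hV h Z' : Set (CompleteFlag (N + 1) V)) :=
      subset_closure ⟨F, hF, rfl⟩
    rw [← heq] at h1
    exact h1
  have hnhd : extendFlag h F ∈ {G : CompleteFlag (N + 1) V | ¬ G.sub 1 ≤ LinearMap.ker ψ} ∩
      restrictFlag s F ⁻¹' (Z : Set (CompleteFlag N W))ᶜ := by
    refine ⟨fun hle => ?_, ?_⟩
    · have h1 : v ∈ (extendFlag h F).sub 1 := by
        change v ∈ (F.sub 0).comap p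
        rw [Submodule.mem_comap, h.p_v]
        exact zero_mem _
      have h2 : ψ v = 0 := hle h1
      rw [h.psi_v] at h2
      exact one_ne_zero h2
    · rw [Set.mem_preimage, restrictFlag_extendFlag]
      exact hFZ
  obtain ⟨_, ⟨-, hG⟩, G, hGZ, rfl⟩ := mem_closure_iff.mp hmem _ hop hnhd
  rw [Set.mem_preimage, restrictFlag_extendFlag] at hG
  exact hG hGZ

end Step

/-- Each flag in the Springer fibre of `x` lies in the last member of a chain, of length
`pairCount x`, of irreducible closed subsets of the fibre. By induction: a chain for the quotient by
the first line of the flag is extended by sweeping this line. -/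
theorem exists_chain_springerFiber (N : ℕ) : ∀ {V : Type u} [AddCommGroup V] [Module ℂ V]
    [FiniteDimensional ℂ V] (_ : finrank ℂ V = N) {x : End ℂ V} (_ : IsNilpotent x)
    {F : CompleteFlag N V} (_ : F ∈ springerFiber N x),
    ∃ l : LTSeries (IrreducibleCloseds (CompleteFlag N V)), l.length = pairCount x ∧
      F ∈ (l.last : Set (CompleteFlag N V)) ∧
      (l.last : Set (CompleteFlag N V)) ⊆ springerFiber N x := by
  induction N with
  | zero =>
    intro V _ _ _ hV x hx F hF
    refine ⟨RelSeries.singleton _ ⟨closure {F}, isIrreducible_singleton.closure, isClosed_closure⟩,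
      ?_, ?_, ?_⟩
    · rw [pairCount, hV, Finset.range_zero, Finset.sum_empty]
      rfl
    · exact subset_closure rfl
    · exact closure_minimal (Set.singleton_subset_iff.mpr hF) (isClosed_springerFiber x)
  | succ N ih =>
    intro V _ _ _ hV x hx F hF
    obtain ⟨⟨v, hv⟩, hv0'⟩ := finrank_pos_iff_exists_ne_zero.mp
      (show 0 < finrank ℂ (F.sub 1) by rw [F.finrank_sub]; simp)
    have hv0 : v ≠ 0 := fun h => hv0' (Subtype.ext h)
    have hxv : x v = 0 := by
      have h1 := hF 0 (Submodule.mem_map_of_mem hv)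
      have h0 : F.sub (0 : Fin (N + 1)).castSucc = ⊥ :=
        Submodule.finrank_eq_zero.mp (F.finrank_sub 0)
      rwa [h0, Submodule.mem_bot] at h1
    obtain ⟨j, u, hu, hvj⟩ := exists_depth hx hv0
    obtain ⟨ψ, p, h⟩ := exists_isProjAlong hv0
    have hW : finrank ℂ (LinearMap.ker ψ) = N := by have := h.finrank_eq; omega
    obtain ⟨G, hG, rfl⟩ := h.exists_extendFlag_eq hxv hF hv
    obtain ⟨l, hl1, hl2, hl3⟩ := ih hW (h.isNilpotent hxv hx) hG
    obtain ⟨hj, hi⟩ := h.kerRank_eq hxv ⟨u, hu⟩ hvj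
    have hlast : (l.map (extendClosed hV h) (extendClosed_strictMono hV h)).last
        = extendClosed hV h l.last := rfl
    obtain ⟨l', h1, h2, h3⟩ := exists_chain_of_depth hV (i := 1) hxv hv0 ⟨u, hu⟩ hvj
      (l.map (extendClosed hV h) (extendClosed_strictMono hV h)) (F := extendFlag h G)
      (by rw [hlast]; exact subset_closure ⟨G, hl2, rfl⟩)
      (by
        rw [hlast]
        refine closure_minimal ?_ (isClosed_springerFiber x)
        rintro _ ⟨G', hG', rfl⟩
        exact h.extendFlag_mem_springerFiber hxv (hl3 hG'))
      (by
        rw [hlast]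
        refine closure_minimal ?_ (isClosed_sub_le _ 1)
        rintro _ ⟨G', hG', rfl⟩
        have h0 : G'.sub 0 = ⊥ := Submodule.finrank_eq_zero.mp (G'.finrank_sub 0)
        change (G'.sub 0).comap p ≤ _
        rw [h0, ← h.ker_p]
        exact le_rfl) hv
    refine ⟨l', ?_, h2, h3⟩
    have hjM : j < finrank ℂ V := by
      by_contra hlt
      rw [pow_finrank_eq_zero hx (not_lt.mp hlt)] at hu
      exact hv0 hu.symm
    have h4 := sum_choose_two_of_sub_one hjM hj hi
    rw [← pairCount, ← pairCount_eq_sum (h.isNilpotent hxv hx) (by omega), ← hl1] at h4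
    have h5 : (l.map (extendClosed hV h) (extendClosed_strictMono hV h)).length = l.length := rfl
    omega

/-! ### The core space -/

section Core

variable {V : Type*} [AddCommGroup V] [Module ℂ V]

/-- The core space is isotropic: for `v = x ^ k a ∈ ker x ^ k` and `w = x ^ l b ∈ ker x ^ l`, moving
the larger power to the other side kills `⟨v, w⟩`. -/
theorem coreSpace_isotropic {K V : Type*} [Field K] [AddCommGroup V] [Module K V]
    {B : LinearMap.BilinForm K V} (hs : B.IsSymm) {x : End K V}
    (hx : ∀ v w, B (x v) w = B v (x w)) {v w : V} (hv : v ∈ coreSpace x) (hw : w ∈ coreSpace x) :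
    B v w = 0 := by
  have key : ∀ k l, l ≤ k → ∀ a b, (x ^ l) ((x ^ l) b) = 0 → B ((x ^ k) a) ((x ^ l) b) = 0 := by
    intro k l hlk a b hb
    obtain ⟨m, rfl⟩ := Nat.exists_eq_add_of_le hlk
    rw [pow_adjoint hx, add_comm, pow_add, Module.End.mul_apply, hb, map_zero, map_zero]
  have h1 : coreSpace x ≤ B.orthogonal (coreSpace x) := by
    refine iSup_le fun l => ?_
    rintro _ ⟨⟨b, rfl⟩, hb⟩
    have h2 : coreSpace x ≤ LinearMap.ker (B.flip ((x ^ l) b)) := by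
      refine iSup_le fun k => ?_
      rintro _ ⟨⟨a, rfl⟩, ha⟩
      change B ((x ^ k) a) ((x ^ l) b) = 0
      rcases le_total l k with hlk | hlk
      · exact key k l hlk a b hb
      · exact (hs.eq _ _).symm.trans (key l k hlk b a ha)
    exact fun u hu => h2 hu
  exact h1 hw v hv

theorem pow_jordanBasis {s : ℕ} {x : End ℂ V} {lam : Fin s → ℕ}
    {b : Basis (Σ i, Fin (lam i)) ℂ V} (hb : ∀ (i : Fin s) (a : Fin (lam i)),
      x (b ⟨i, a⟩) = if h : (a : ℕ) + 1 < lam i then b ⟨i, ⟨a + 1, h⟩⟩ else 0)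
    (k : ℕ) (i : Fin s) (a : Fin (lam i)) :
    (x ^ k) (b ⟨i, a⟩) = if h : (a : ℕ) + k < lam i then b ⟨i, ⟨a + k, h⟩⟩ else 0 := by
  induction k with
  | zero => simp
  | succ k ih =>
    rw [pow_succ', Module.End.mul_apply, ih]
    split_ifs with h1 h2 h2
    · rw [hb, dif_pos (by simpa [add_assoc] using h2)]
      rfl
    · rw [hb, dif_neg (by simpa [add_assoc] using h2)]
    · omega
    · rw [map_zero]

theorem isNilpotent_of_hasJordanType {s : ℕ} {x : End ℂ V} {lam : Fin s → ℕ}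
    (h : HasJordanType x lam) : IsNilpotent x := by
  obtain ⟨b, hb⟩ := h
  refine ⟨∑ i, lam i, b.ext fun ⟨i, a⟩ => ?_⟩
  have h1 := Finset.single_le_sum (f := lam) (fun _ _ => Nat.zero_le _) (Finset.mem_univ i)
  rw [pow_jordanBasis hb, dif_neg (by omega), LinearMap.zero_apply]

/-- The Jordan strings of `x'`, of lengths `p i`, are embedded as the ends of the Jordan strings of
`x`, which lie in the core space since these are at least twice as long. -/
theorem exists_embedding {s n : ℕ} {x : End ℂ V} {lam p : Fin s → ℕ} (hlam : ∀ i, 2 * p i ≤ lam i)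
    (hx : HasJordanType x lam) {x' : End ℂ (Fin n → ℂ)} (hx' : HasJordanType x' p) :
    ∃ ι : (Fin n → ℂ) →ₗ[ℂ] V, Function.Injective ι ∧ (∀ w, x (ι w) = ι (x' w)) ∧
      LinearMap.range ι ≤ coreSpace x := by
  obtain ⟨b, hb⟩ := hx
  obtain ⟨b', hb'⟩ := hx'
  let e : (Σ i, Fin (p i)) → Σ i, Fin (lam i) :=
    fun q => ⟨q.1, ⟨q.2 + (lam q.1 - p q.1), by have := q.2.2; have := hlam q.1; omega⟩⟩
  have he : Function.Injective e := by
    rintro ⟨i, a⟩ ⟨j, a'⟩ h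
    simp only [e, Sigma.mk.injEq] at h
    obtain ⟨rfl, h2⟩ := h
    have h3 := congrArg Fin.val (eq_of_heq h2)
    simp only [add_left_inj] at h3
    rw [Fin.ext h3]
  let ι := b'.constr ℂ (b ∘ e)
  have hι : ∀ q, ι (b' q) = b (e q) := fun q => b'.constr_basis ℂ _ q
  refine ⟨ι, ?_, fun w => ?_, ?_⟩
  · exact b'.injective_constr_of_linearIndependent (b.linearIndependent.comp e he)
  · have h1 : x ∘ₗ ι = ι ∘ₗ x' := by
      refine b'.ext fun ⟨i, a⟩ => ?_
      rw [LinearMap.comp_apply, LinearMap.comp_apply, hι, hb, hb']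
      have := hlam i
      split_ifs with h1 h2 h2
      · rw [hι]
        congr 3
        simp; omega
      · simp only at h1; omega
      · simp only at h1; omega
      · rw [map_zero]
    exact LinearMap.congr_fun h1 w
  · rw [b'.constr_range, Submodule.span_le]
    rintro _ ⟨⟨i, a⟩, rfl⟩
    refine Submodule.mem_iSup_of_mem (lam i - p i) (Submodule.mem_inf.mpr
      ⟨⟨b ⟨i, ⟨a, by have := a.2; have := hlam i; omega⟩⟩, ?_⟩, ?_⟩)
    · rw [pow_jordanBasis hb, dif_pos]
      rfl
    · change (x ^ (lam i - p i)) (b _) = 0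
      rw [pow_jordanBasis hb, dif_neg]
      have := a.2; have := hlam i
      simp only; omega

end Core

section Linear

variable {n : ℕ} {V : Type*} [AddCommGroup V] [Module ℂ V] [FiniteDimensional ℂ V]
  {B : LinearMap.BilinForm ℂ V} {ι : (Fin n → ℂ) →ₗ[ℂ] V}

omit [FiniteDimensional ℂ V] in
theorem finrank_range_of_injective (hι : Function.Injective ι) :
    finrank ℂ (LinearMap.range ι) = n := by
  rw [LinearMap.finrank_range_of_inj hι, finrank_fin_fun]

/-- The core space is isotropic, so its dimension is at most `n`. -/
theorem range_eq_coreSpace (hV : finrank ℂ V = 2 * n + 1) (hs : B.IsSymm) (hB : B.Nondegenerate)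
    {x : End ℂ V} (hx : ∀ v w, B (x v) w = B v (x w)) (hι : Function.Injective ι)
    (hle : LinearMap.range ι ≤ coreSpace x) : LinearMap.range ι = coreSpace x := by
  refine Submodule.eq_of_le_of_finrank_le hle ?_
  have h1 : coreSpace x ≤ B.orthogonal (coreSpace x) := fun w hw v hv =>
    coreSpace_isotropic hs hx hv hw
  have h2 := Submodule.finrank_mono h1
  rw [LinearMap.BilinForm.finrank_orthogonal hB] at h2
  rw [finrank_range_of_injective hι]
  omega

/-- The form identifies the quotient of `V` by the orthogonal of the image of `ι` with the dual of
`ℂ ^ n`; this family lifts the dual basis. -/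
theorem exists_dual_family (hB : B.Nondegenerate) (hι : Function.Injective ι) :
    ∃ c : Fin n → V, ∀ i j, B (ι (Pi.single i 1)) (c j) = if i = j then 1 else 0 := by
  let g : V →ₗ[ℂ] (Fin n → ℂ) := LinearMap.pi fun i => B (ι (Pi.single i 1))
  have hg : ∀ v i, g v i = B (ι (Pi.single i 1)) v := fun _ _ => rfl
  have hle : LinearMap.ker g ≤ B.orthogonal (LinearMap.range ι) := by
    rintro v hv _ ⟨w, rfl⟩
    have h1 : B.flip v ∘ₗ ι = 0 := by
      refine (Pi.basisFun ℂ (Fin n)).ext fun i => ?_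
      rw [Pi.basisFun_apply]
      exact congrFun (LinearMap.mem_ker.mp hv) i
    exact LinearMap.congr_fun h1 w
  have h1 := Submodule.finrank_mono hle
  rw [LinearMap.BilinForm.finrank_orthogonal hB, finrank_range_of_injective hι] at h1
  have h2 := g.finrank_range_add_finrank_ker
  have h4 := (LinearMap.range ι).finrank_le
  rw [finrank_range_of_injective hι] at h4
  have h3 : LinearMap.range g = ⊤ := by
    refine Submodule.eq_top_of_finrank_eq (le_antisymm (Submodule.finrank_le _) ?_)
    rw [finrank_fin_fun]
    omega
  choose c hc using fun j => LinearMap.range_eq_top.mp h3 (Pi.single j 1)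
  refine ⟨c, fun i j => ?_⟩
  rw [← hg, hc, Pi.single_apply]

/-- A vector that spans, together with the image of `ι`, the orthogonal of this image. -/
theorem exists_middle (hV : finrank ℂ V = 2 * n + 1) (hB : B.Nondegenerate)
    (hι : Function.Injective ι) : ∃ e : V, e ∉ LinearMap.range ι ∧ ∀ w, B (ι w) e = 0 := by
  have h1 : finrank ℂ (B.orthogonal (LinearMap.range ι)) = n + 1 := by
    rw [LinearMap.BilinForm.finrank_orthogonal hB, finrank_range_of_injective hι]
    omega
  have h2 : ¬ B.orthogonal (LinearMap.range ι) ≤ LinearMap.range ι := fun h => by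
    have := Submodule.finrank_mono h
    rw [h1, finrank_range_of_injective hι] at this
    omega
  obtain ⟨e, he, hn⟩ := SetLike.not_le_iff_exists.mp h2
  exact ⟨e, hn, fun w => he _ ⟨w, rfl⟩⟩

end Linear

/-! ### The flags through the core space -/

section Frames

theorem PolyMap.sum {M M' : Type*} [AddCommGroup M] [Module ℂ M] [AddCommGroup M'] [Module ℂ M']
    {κ : Type*} {s : Finset κ} {f : κ → M → M'} (h : ∀ i, PolyMap (f i)) :
    PolyMap fun v => ∑ i ∈ s, f i v := by
  refine PolyMap.of_dual fun φ => ?_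
  simp only [map_sum]
  exact sum_mem_polyFun _ fun i _ => (h i).dual φ

/-- Vectors chosen one in each step of a flag, outside the preceding space, are independent. -/
theorem linearIndependent_of_notMem_flag {K V : Type*} [Field K] [AddCommGroup V] [Module K V]
    {N : ℕ} {S : Fin (N + 1) → Submodule K V} (hS : Monotone S) {w : Fin N → V}
    (hw : ∀ i, w i ∈ S i.succ) (hw' : ∀ i, w i ∉ S i.castSucc) : LinearIndependent K w := by
  induction N with
  | zero => exact linearIndependent_empty_type
  | succ N ih =>
    refine linearIndependent_finSucc'.mpr ⟨ih (S := fun i => S i.castSucc)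
      (fun i j h => hS (by simpa using h)) (fun i => hw i.castSucc) fun i => hw' i.castSucc,
      fun h => hw' (Fin.last N) ((Submodule.span_le.mpr ?_ : _ ≤ S _) h)⟩
    rintro _ ⟨i, rfl⟩
    refine hS ?_ (hw i.castSucc)
    rw [Fin.le_def]
    simp only [Fin.val_succ, Fin.val_castSucc, Fin.val_last]
    omega

end Frames

section Iso

variable {n : ℕ} {V : Type*} [AddCommGroup V] [Module ℂ V]
  {B : LinearMap.BilinForm ℂ V} {ι : (Fin n → ℂ) →ₗ[ℂ] V} {π : V →ₗ[ℂ] (Fin n → ℂ)}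

open Classical in
/-- The images under `π` of the first `n` spaces of a flag of `V`, where they form a complete flag
of `ℂ ^ n`; the standard flag otherwise. -/
noncomputable def halfFlag (π : V →ₗ[ℂ] (Fin n → ℂ)) (F : CompleteFlag (2 * n + 1) V) :
    CompleteFlag n (Fin n → ℂ) :=
  if h : ∃ G : CompleteFlag n (Fin n → ℂ),
      ∀ i : Fin (n + 1), G.sub i = (F.sub (i.castLE (by omega))).map π
  then h.choose else CompleteFlag.ofBasis (Pi.basisFun ℂ (Fin n))

theorem halfFlag_eq {F : CompleteFlag (2 * n + 1) V} {G : CompleteFlag n (Fin n → ℂ)}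
    (h : ∀ i : Fin (n + 1), G.sub i = (F.sub (i.castLE (by omega))).map π) : halfFlag π F = G := by
  have h2 : ∃ G : CompleteFlag n (Fin n → ℂ),
      ∀ i : Fin (n + 1), G.sub i = (F.sub (i.castLE (by omega))).map π := ⟨G, h⟩
  rw [halfFlag, dif_pos h2]
  exact CompleteFlag.ext (funext fun i => (h2.choose_spec i).trans (h i).symm)

theorem exists_halfFlag [FiniteDimensional ℂ V] {F : CompleteFlag (2 * n + 1) V}
    (hF : Disjoint (F.sub ⟨n, by omega⟩) (LinearMap.ker π)) : ∃ G : CompleteFlag n (Fin n → ℂ),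
      ∀ i : Fin (n + 1), G.sub i = (F.sub (i.castLE (by omega))).map π := by
  refine ⟨⟨fun i => (F.sub (i.castLE (by omega))).map π, fun i j h =>
    Submodule.map_mono (F.mono ?_), fun i => ?_⟩, fun i => rfl⟩
  · simpa using h
  · have h1 := finrank_map_add_finrank_inf_ker π (F.sub (i.castLE (by omega)))
    have h2 : F.sub (i.castLE (by omega)) ≤ F.sub ⟨n, by omega⟩ := F.mono (by
      rw [Fin.le_def, Fin.val_castLE]; exact Nat.lt_succ_iff.mp i.2)
    rw [(hF.mono_left h2).eq_bot, finrank_bot, F.finrank_sub, add_zero] at h1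
    exact h1

theorem isFrameMap_halfFlag [FiniteDimensional ℂ V] (π : V →ₗ[ℂ] (Fin n → ℂ)) :
    IsFrameMap (halfFlag π)
      {F : CompleteFlag (2 * n + 1) V | Disjoint (F.sub ⟨n, by omega⟩) (LinearMap.ker π)}
      (fun b i => π (b (i.castLE (by omega)))) where
  poly := PolyMap.pi fun i => (PolyMap.linear π).comp (PolyMap.linear
    (LinearMap.proj (i.castLE (by omega)) : (Fin (2 * n + 1) → V) →ₗ[ℂ] V))
  mem_iff b := by
    have hli : LinearIndependent ℂ fun i : Fin n => b (i.castLE (by omega : n ≤ 2 * n + 1)) :=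
      b.linearIndependent.comp _ (Fin.castLE_injective _)
    have hspan : (CompleteFlag.ofBasis b).sub ⟨n, by omega⟩
        = Submodule.span ℂ (Set.range
          fun i : Fin n => b (i.castLE (by omega : n ≤ 2 * n + 1))) := by
      refine (Submodule.eq_of_le_of_finrank_eq ?_ ?_).symm
      · rw [Submodule.span_le]
        rintro _ ⟨i, rfl⟩
        rw [ofBasis_sub_eq_basisFlag]
        exact basisFlag_mono b (by simp) (self_mem_basisFlag b _)
      · rw [CompleteFlag.finrank_sub, finrank_span_eq_card hli, Fintype.card_fin]
    rw [Set.mem_ofPred_eq, hspan]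
    constructor
    · intro h
      exact hli.map h
    · intro h
      rw [Submodule.disjoint_def]
      intro v hv hk
      obtain ⟨c, rfl⟩ := (Submodule.mem_span_range_iff_exists_fun ℂ).mp hv
      have h1 := hk
      rw [LinearMap.mem_ker, map_sum] at h1
      simp only [map_smul] at h1
      have h2 := Fintype.linearIndependent_iff.mp h c h1
      simp [h2]
  mem_sub b hb i := by
    obtain ⟨G, hG⟩ := exists_halfFlag hb
    rw [halfFlag_eq hG, hG]
    refine ⟨_, ?_, rfl⟩
    change _ ∈ (CompleteFlag.ofBasis b).sub _
    rw [ofBasis_sub_eq_basisFlag]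
    exact self_mem_basisFlag b (i.castLE (by omega))

/-- The spaces of the flag of `V` determined by a flag of the image of `ι`, a maximal isotropic
subspace: the given spaces for `i ≤ n`, and their orthogonals for `i > n`. -/
noncomputable def doubleSub (B : LinearMap.BilinForm ℂ V) (ι : (Fin n → ℂ) →ₗ[ℂ] V)
    (G : CompleteFlag n (Fin n → ℂ)) (i : ℕ) : Submodule ℂ V :=
  if h : i ≤ n then (G.sub ⟨i, by omega⟩).map ι
  else B.orthogonal ((G.sub ⟨2 * n + 1 - i, by omega⟩).map ι)

theorem doubleSub_of_le {G : CompleteFlag n (Fin n → ℂ)} {i : ℕ} (h : i ≤ n) :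
    doubleSub B ι G i = (G.sub ⟨i, by omega⟩).map ι := dif_pos h

theorem doubleSub_of_lt {G : CompleteFlag n (Fin n → ℂ)} {i : ℕ} (h : n < i) :
    doubleSub B ι G i = B.orthogonal ((G.sub ⟨2 * n + 1 - i, by omega⟩).map ι) := dif_neg (by omega)

theorem doubleSub_mono (hi : ∀ w w', B (ι w) (ι w') = 0) (G : CompleteFlag n (Fin n → ℂ)) :
    Monotone (doubleSub B ι G) := by
  intro i j hij
  rcases le_or_gt i n with h1 | h1
  · rw [doubleSub_of_le h1]
    rcases le_or_gt j n with h2 | h2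
    · rw [doubleSub_of_le h2]
      exact Submodule.map_mono (G.mono hij)
    · rw [doubleSub_of_lt h2]
      rintro _ ⟨w, -, rfl⟩ _ ⟨w', -, rfl⟩
      exact hi _ _
  · rw [doubleSub_of_lt h1, doubleSub_of_lt (h1.trans_le hij)]
    refine LinearMap.BilinForm.orthogonal_le (Submodule.map_mono (G.mono ?_))
    rw [Fin.le_def]
    simp only
    omega

/-- The complete flag of `V` with `V_{2n+1-i} = V_i^⊥` that extends a complete flag of the image of
`ι`. -/
noncomputable def doubleFlag [FiniteDimensional ℂ V] (hV : finrank ℂ V = 2 * n + 1)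
    (hB : B.Nondegenerate) (hinj : Function.Injective ι)
    (hi : ∀ w w', B (ι w) (ι w') = 0) (G : CompleteFlag n (Fin n → ℂ)) :
    CompleteFlag (2 * n + 1) V where
  sub i := doubleSub B ι G i
  mono i j h := doubleSub_mono hi G h
  finrank_sub i := by
    have h3 : ∀ i, finrank ℂ ((G.sub i).map ι) = i := fun i => by
      rw [← G.finrank_sub i]
      exact LinearEquiv.finrank_eq (Submodule.equivMapOfInjective ι hinj _).symm
    rcases le_or_gt (i : ℕ) n with h1 | h1
    · rw [doubleSub_of_le h1, h3]
    · rw [doubleSub_of_lt h1, LinearMap.BilinForm.finrank_orthogonal hB, h3, hV]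
      simp only
      omega

open Matrix in
/-- A frame of the flag `doubleFlag` depending polynomially on a frame `g` of `ℂ ^ n`: the images of
the vectors of `g`, then the middle vector `e`, and then the dual frame, in reverse order. The dual
frame comes from the adjugate matrix of `g`, so that there are no denominators. -/
noncomputable def doubleFrame (ι : (Fin n → ℂ) →ₗ[ℂ] V) (e : V) (c : Fin n → V)
    (g : Fin n → Fin n → ℂ) (i : Fin (2 * n + 1)) : V :=
  if h : (i : ℕ) < n then ι (g ⟨i, h⟩)
  else if h' : n < (i : ℕ) then
    ∑ l, (Matrix.of g).adjugate l ⟨2 * n - i, by omega⟩ • c l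
  else e

/-- Up to the factor `det g`, the vectors of the adjugate matrix are dual to the vectors of `g`. -/
theorem doubleFrame_pairing {c : Fin n → V}
    (hc : ∀ i j, B (ι (Pi.single i 1)) (c j) = if i = j then 1 else 0) (g : Fin n → Fin n → ℂ)
    (j k : Fin n) : B (ι (g j)) (∑ l, (Matrix.of g).adjugate l k • c l)
      = if j = k then (Matrix.of g).det else 0 := by
  have h1 : ∀ l, B (ι (g j)) (c l) = g j l := by
    intro l
    conv_lhs => rw [← Finset.univ_sum_single (g j)]
    have : ∀ m, (Pi.single m (g j m) : Fin n → ℂ) = g j m • Pi.single m 1 := fun m => by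
      rw [← Pi.single_smul, smul_eq_mul, mul_one]
    simp [this, hc]
  have h2 := congrFun (congrFun (Matrix.mul_adjugate (Matrix.of g)) j) k
  rw [Matrix.mul_apply] at h2
  simp only [map_sum, map_smul, smul_eq_mul, h1]
  simp only [Matrix.of_apply, Matrix.smul_apply, Matrix.one_apply, smul_eq_mul, mul_ite, mul_one,
    mul_zero] at h2
  rw [← h2]
  exact Finset.sum_congr rfl fun l _ => mul_comm _ _

theorem isFrameMap_doubleFlag [FiniteDimensional ℂ V] (hV : finrank ℂ V = 2 * n + 1)
    (hB : B.Nondegenerate) (hinj : Function.Injective ι)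
    (hi : ∀ w w', B (ι w) (ι w') = 0) {c : Fin n → V}
    (hc : ∀ i j, B (ι (Pi.single i 1)) (c j) = if i = j then 1 else 0) {e : V}
    (he : e ∉ LinearMap.range ι) (he' : ∀ w, B (ι w) e = 0) :
    IsFrameMap (doubleFlag hV hB hinj hi) Set.univ (doubleFrame ι e c) := by
  have hsub : ∀ (b : Basis (Fin n) ℂ (Fin n → ℂ)) (i : Fin (2 * n + 1)),
      doubleFrame ι e c b i ∈ doubleSub B ι (CompleteFlag.ofBasis b) (i + 1) := by
    intro b i
    rcases lt_trichotomy (i : ℕ) n with h | h | h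
    · rw [doubleFrame, dif_pos h, doubleSub_of_le h]
      refine ⟨_, ?_, rfl⟩
      change _ ∈ (CompleteFlag.ofBasis b).sub _
      rw [ofBasis_sub_eq_basisFlag]
      exact self_mem_basisFlag b ⟨i, h⟩
    · rw [doubleFrame, dif_neg (by omega), dif_neg (by omega), doubleSub_of_lt (by omega)]
      rintro _ ⟨w, -, rfl⟩
      exact he' w
    · rw [doubleFrame, dif_neg (by omega), dif_pos h, doubleSub_of_lt (by omega)]
      rintro _ ⟨w, hw, rfl⟩
      have h1 : (CompleteFlag.ofBasis b).sub ⟨2 * n + 1 - (i + 1), by omega⟩ ≤ LinearMap.ker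
          (B.flip (∑ l, (Matrix.of b).adjugate l ⟨2 * n - i, by omega⟩ • c l) ∘ₗ ι) := by
        rw [ofBasis_sub_eq_basisFlag]
        refine mem_of_mem_basisFlag fun k hk => ?_
        change B (ι (b k)) _ = 0
        rw [doubleFrame_pairing hc, if_neg]
        rintro rfl
        simp only at hk
        omega
      exact h1 hw
  refine ⟨?_, fun b => iff_of_true trivial ?_, fun b _ i => hsub b i⟩
  · refine PolyMap.pi fun i => ?_
    by_cases h : (i : ℕ) < n
    · simp only [doubleFrame, dif_pos h]
      exact (PolyMap.linear ι).comp (PolyMap.linear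
        (LinearMap.proj (⟨i, h⟩ : Fin n) : (Fin n → Fin n → ℂ) →ₗ[ℂ] (Fin n → ℂ)))
    · by_cases h' : n < (i : ℕ)
      · simp only [doubleFrame, dif_neg h, dif_pos h']
        refine PolyMap.sum fun l => PolyMap.smul ?_ (PolyMap.const _)
        refine adjugate_mem_polyFun (fun a b => ?_) _ _
        exact dual_mem_polyFun ((LinearMap.proj b : (Fin n → ℂ) →ₗ[ℂ] ℂ) ∘ₗ
          (LinearMap.proj a : (Fin n → Fin n → ℂ) →ₗ[ℂ] (Fin n → ℂ)))
      · simp only [doubleFrame, dif_neg h, dif_neg h']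
        exact PolyMap.const e
  · refine linearIndependent_of_notMem_flag (S := (doubleFlag hV hB hinj hi
      (CompleteFlag.ofBasis b)).sub) (CompleteFlag.mono _) (hsub b) fun i => ?_
    change _ ∉ doubleSub B ι (CompleteFlag.ofBasis b) (i : ℕ)
    rcases lt_trichotomy (i : ℕ) n with h | h | h
    · rw [doubleFrame, dif_pos h, doubleSub_of_le h.le]
      rintro ⟨w, hw, hw'⟩
      rw [hinj hw'] at hw
      have h2 := mem_ofBasis_sub_iff.mp hw ⟨i, h⟩ le_rfl
      simp at h2
    · rw [doubleFrame, dif_neg (by omega), dif_neg (by omega), doubleSub_of_le (by omega)]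
      rintro ⟨w, -, rfl⟩
      exact he ⟨w, rfl⟩
    · rw [doubleFrame, dif_neg (by omega), dif_pos h, doubleSub_of_lt (by omega)]
      intro h1
      have h2 := h1 (ι (b ⟨2 * n - i, by omega⟩)) ⟨_, ?_, rfl⟩
      · rw [doubleFrame_pairing hc, if_pos rfl] at h2
        have h3 : Matrix.of (b : Fin n → Fin n → ℂ) =
          ((Pi.basisFun ℂ (Fin n)).toMatrix b).transpose := by
          ext; simp [Basis.toMatrix_apply]
        rw [h3, Matrix.det_transpose] at h2
        have h4 := congrArg Matrix.det ((Pi.basisFun ℂ (Fin n)).toMatrix_mul_toMatrix_flip b)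
        rw [Matrix.det_mul, h2, zero_mul, Matrix.det_one] at h4
        exact zero_ne_one h4
      · change _ ∈ (CompleteFlag.ofBasis b).sub _
        rw [ofBasis_sub_eq_basisFlag]
        exact basisFlag_mono b (by simp only; omega) (self_mem_basisFlag b _)

/-- A nilpotent endomorphism acts as zero on a quotient of dimension at most one. -/
theorem mem_of_isNilpotent_of_codim_one {K V : Type*} [Field K] [AddCommGroup V] [Module K V]
    [FiniteDimensional K V]
    {x : End K V} (hx : IsNilpotent x) {L W : Submodule K V} (hL : ∀ v ∈ L, x v ∈ L)
    (hW : ∀ v ∈ W, x v ∈ W) (hLW : L ≤ W) (hd : finrank K W ≤ finrank K L + 1) {v : V}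
    (hv : v ∈ W) :
    x v ∈ L := by
  by_contra hn
  obtain ⟨M, hM⟩ := hx
  have h1 : L ⊔ Submodule.span K {x v} = W := by
    refine Submodule.eq_of_le_of_finrank_le
      (sup_le hLW ((Submodule.span_singleton_le_iff_mem _ _).mpr (hW v hv))) ?_
    rwa [Submodule.finrank_sup_span_singleton hn]
  have h2 : ∀ k, v ∈ L ⊔ Submodule.span K {(x ^ k) v} := by
    intro k
    induction k with
    | zero => exact Submodule.mem_sup_right (Submodule.mem_span_singleton_self _)
    | succ k ih =>
      have h3 : L ⊔ Submodule.span K {x v} ≤ L ⊔ Submodule.span K {(x ^ (k + 1)) v} := by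
        refine sup_le le_sup_left ((Submodule.span_singleton_le_iff_mem _ _).mpr ?_)
        obtain ⟨l, hl, z, hz, h4⟩ := Submodule.mem_sup.mp ih
        obtain ⟨a, rfl⟩ := Submodule.mem_span_singleton.mp hz
        have h5 : x v = x l + a • (x ^ (k + 1)) v := by
          rw [pow_succ', Module.End.mul_apply, ← map_smul, ← map_add, h4]
        rw [h5]
        refine add_mem (Submodule.mem_sup_left (hL l hl)) (Submodule.mem_sup_right ?_)
        exact Submodule.smul_mem _ _ (Submodule.mem_span_singleton_self _)
      rw [h1] at h3
      exact h3 hv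
  have h3 := h2 M
  rw [hM, LinearMap.zero_apply, Submodule.span_singleton_eq_bot.mpr rfl, sup_bot_eq] at h3
  exact hn (hL v h3)

/-- The flags of the fibre over `x` whose middle space is the image of `ι`. -/
def coreFiber (B : LinearMap.BilinForm ℂ V) (x : End ℂ V) (ι : (Fin n → ℂ) →ₗ[ℂ] V) :
    Set (CompleteFlag (2 * n + 1) V) :=
  {F | F ∈ resolutionFiber (2 * n + 1) B x ∧ F.sub ⟨n, by omega⟩ = LinearMap.range ι}

theorem doubleFlag_mem_coreFiber [FiniteDimensional ℂ V] (hV : finrank ℂ V = 2 * n + 1)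
    (hB : B.Nondegenerate) (hs : B.IsSymm) (hinj : Function.Injective ι)
    (hi : ∀ w w', B (ι w) (ι w') = 0) {x : End ℂ V} (hx : x ∈ nilpotentCone B)
    {x' : End ℂ (Fin n → ℂ)} (hxι : ∀ w, x (ι w) = ι (x' w)) {G : CompleteFlag n (Fin n → ℂ)}
    (hG : G ∈ springerFiber n x') : doubleFlag hV hB hinj hi G ∈ coreFiber B x ι := by
  have hn : (CompleteFlag.sub G ⟨n, by omega⟩).map ι = LinearMap.range ι := by
    have h1 : G.sub ⟨n, by omega⟩ = ⊤ :=
      Submodule.eq_top_of_finrank_eq (by rw [G.finrank_sub, finrank_fin_fun])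
    rw [h1, LinearMap.range_eq_map]
  have hι : ∀ i (h : i + 1 ≤ n), ∀ v ∈ (G.sub ⟨i + 1, by omega⟩).map ι,
      x v ∈ (G.sub ⟨i, by omega⟩).map ι := by
    rintro i h _ ⟨w, hw, rfl⟩
    rw [hxι]
    exact ⟨_, hG ⟨i, by omega⟩ ⟨w, hw, rfl⟩, rfl⟩
  refine ⟨⟨hx, fun i => ?_, fun i => ?_⟩, ?_⟩
  · change doubleSub B ι G (i.rev : ℕ) = B.orthogonal (doubleSub B ι G (i : ℕ))
    rcases le_or_gt (i : ℕ) n with h | h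
    · rw [doubleSub_of_le h, doubleSub_of_lt (by rw [Fin.val_rev]; omega)]
      congr 4
      rw [Fin.val_rev]
      omega
    · rw [doubleSub_of_lt h, doubleSub_of_le (by rw [Fin.val_rev]; omega),
        LinearMap.BilinForm.orthogonal_orthogonal hB hs.isRefl]
      congr 3
      rw [Fin.val_rev]
      omega
  · rintro _ ⟨v, hv, rfl⟩
    change v ∈ doubleSub B ι G ((i : ℕ) + 1) at hv
    change x v ∈ doubleSub B ι G (i : ℕ)
    rcases lt_trichotomy (i : ℕ) n with h | h | h
    · rw [doubleSub_of_le (by omega)] at hv ⊢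
      exact hι i (by omega) v hv
    · rw [doubleSub_of_lt (by omega)] at hv
      rw [doubleSub_of_le (by omega)]
      have h1 : (G.sub ⟨2 * n + 1 - (i + 1), by omega⟩).map ι = LinearMap.range ι := by
        rw [← hn]
        congr 3
        omega
      have h2 : (G.sub ⟨i, by omega⟩).map ι = LinearMap.range ι := by
        rw [← hn]
        congr 3
      rw [h1] at hv
      rw [h2]
      -- in the middle, `x` acts nilpotently on the line `V_n^⊥ / V_n`
      refine mem_of_isNilpotent_of_codim_one hx.2 (W := B.orthogonal (LinearMap.range ι)) ?_ ?_ ?_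
        ?_ hv
      · rintro _ ⟨w, rfl⟩
        exact ⟨_, (hxι w).symm⟩
      · rintro u hu _ ⟨w, rfl⟩
        change B (ι w) (x u) = 0
        rw [← hx.1.2, hxι]
        exact hu _ ⟨_, rfl⟩
      · rintro _ ⟨w, rfl⟩ _ ⟨w', rfl⟩
        exact hi _ _
      · rw [LinearMap.BilinForm.finrank_orthogonal hB, finrank_range_of_injective hinj]
        omega
    · rw [doubleSub_of_lt (by omega)] at hv ⊢
      intro w hw
      change B w (x v) = 0
      rw [← hx.1.2]
      refine hv _ ?_
      have h3 := hι (2 * n + 1 - (i + 1)) (by omega) w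
      have h4 : 2 * n + 1 - (i + 1) + 1 = 2 * n + 1 - (i : ℕ) := by omega
      simp only [h4] at h3
      exact h3 hw
  · change doubleSub B ι G n = _
    rw [doubleSub_of_le le_rfl, hn]

theorem disjoint_of_mem_coreFiber (hπ : ∀ w, π (ι w) = w) {x : End ℂ V}
    {F : CompleteFlag (2 * n + 1) V} (hF : F ∈ coreFiber B x ι) :
    Disjoint (F.sub ⟨n, by omega⟩) (LinearMap.ker π) := by
  rw [hF.2, Submodule.disjoint_def]
  rintro _ ⟨w, rfl⟩ hw
  rw [LinearMap.mem_ker, hπ] at hw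
  rw [hw, map_zero]

theorem map_map_of_mem_coreFiber (hπ : ∀ w, π (ι w) = w) {x : End ℂ V}
    {F : CompleteFlag (2 * n + 1) V} (hF : F ∈ coreFiber B x ι) {i : Fin (2 * n + 1 + 1)}
    (hi : (i : ℕ) ≤ n) : ((F.sub i).map π).map ι = F.sub i := by
  have h1 : ∀ v ∈ F.sub i, ι (π v) = v := by
    intro v hv
    have h2 : F.sub i ≤ F.sub ⟨n, by omega⟩ := F.mono hi
    rw [hF.2] at h2
    obtain ⟨w, rfl⟩ := h2 hv
    rw [hπ]
  ext v
  constructor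
  · rintro ⟨_, ⟨w, hw, rfl⟩, rfl⟩
    rw [h1 w hw]
    exact hw
  · intro hv
    exact ⟨_, ⟨v, hv, rfl⟩, h1 v hv⟩

theorem halfFlag_mem_springerFiber [FiniteDimensional ℂ V] (hπ : ∀ w, π (ι w) = w) {x : End ℂ V}
    {x' : End ℂ (Fin n → ℂ)} (hxι : ∀ w, x (ι w) = ι (x' w))
    {F : CompleteFlag (2 * n + 1) V} (hF : F ∈ coreFiber B x ι) :
    halfFlag π F ∈ springerFiber n x' := by
  obtain ⟨G, hG⟩ := exists_halfFlag (disjoint_of_mem_coreFiber hπ hF)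
  rw [halfFlag_eq hG]
  intro i
  rw [hG, hG]
  rintro _ ⟨_, ⟨v, hv, rfl⟩, rfl⟩
  have h1 : ι (π v) = v := by
    have h2 : F.sub (i.succ.castLE (by omega)) ≤ F.sub ⟨n, by omega⟩ := F.mono (by
      rw [Fin.le_def]; simp)
    rw [hF.2] at h2
    obtain ⟨w, rfl⟩ := h2 hv
    rw [hπ]
  refine ⟨x v, hF.1.2.2 (i.castLE (by omega)) ⟨v, hv, rfl⟩, ?_⟩
  rw [← h1, hxι, hπ, hπ]

/-- The flags of the fibre whose middle space is the image of `ι` form a variety isomorphic to the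
Springer fibre of the restriction `x'` of `x` to this space. -/
theorem exists_coreFiber_homeomorph [FiniteDimensional ℂ V] (hV : finrank ℂ V = 2 * n + 1)
    (hB : B.Nondegenerate) (hs : B.IsSymm) (hinj : Function.Injective ι)
    (hi : ∀ w w', B (ι w) (ι w') = 0) {x : End ℂ V} (hx : x ∈ nilpotentCone B)
    {x' : End ℂ (Fin n → ℂ)} (hxι : ∀ w, x (ι w) = ι (x' w)) :
    ∃ φ : coreFiber B x ι ≃ₜ springerFiber n x', ∀ (f : springerFiber n x' → ℂ)
      (F : coreFiber B x ι), IsRegularAt f (φ F) ↔ IsRegularAt (f ∘ φ) F := by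
  obtain ⟨c, hc⟩ := exists_dual_family hB hinj
  obtain ⟨e, he, he'⟩ := exists_middle hV hB hinj
  obtain ⟨π, hπ'⟩ := LinearMap.exists_leftInverse_of_injective ι (LinearMap.ker_eq_bot.mpr hinj)
  have hπ : ∀ w, π (ι w) = w := fun w => LinearMap.congr_fun hπ' w
  have hl : ∀ F ∈ coreFiber B x ι, doubleFlag hV hB hinj hi (halfFlag π F) = F := by
    intro F hF
    obtain ⟨G, hG⟩ := exists_halfFlag (disjoint_of_mem_coreFiber hπ hF)
    rw [halfFlag_eq hG]
    refine CompleteFlag.ext (funext fun i => ?_)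
    change doubleSub B ι G (i : ℕ) = _
    rcases le_or_gt (i : ℕ) n with h | h
    · rw [doubleSub_of_le h, hG, map_map_of_mem_coreFiber hπ hF (by simpa using h)]
      rfl
    · rw [doubleSub_of_lt h, hG, map_map_of_mem_coreFiber hπ hF (by simp; omega)]
      have h1 := hF.1.2.1 i.rev
      rw [Fin.rev_rev] at h1
      rw [h1]
      congr 2
      ext
      rw [Fin.val_rev]
      simp
  have hr : ∀ G ∈ springerFiber n x', halfFlag π (doubleFlag hV hB hinj hi G) = G := by
    intro G hG
    refine halfFlag_eq fun i => ?_
    change _ = (doubleSub B ι G (i : ℕ)).map π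
    rw [doubleSub_of_le (Nat.lt_succ_iff.mp i.2), ← Submodule.map_comp, hπ', Submodule.map_id]
  obtain ⟨φ, -, hφ⟩ := isIsomorphic_of_isFrameMap hV (finrank_fin_fun ℂ) (isFrameMap_halfFlag π)
    (isFrameMap_doubleFlag hV hB hinj hi hc he he') (X := coreFiber B x ι)
    (Y := springerFiber n x') (fun F hF => disjoint_of_mem_coreFiber hπ hF) (Set.subset_univ _)
    (fun F hF => halfFlag_mem_springerFiber hπ hxι hF)
    (fun G hG => doubleFlag_mem_coreFiber hV hB hs hinj hi hx hxι hG) hl hr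
  exact ⟨φ, hφ⟩

end Iso

/-! ### Components of top dimension -/

section Top

variable {X : Type*} [TopologicalSpace X]

theorem topologicalKrullDim_image_val {S : Set X} (Z : Set S) :
    topologicalKrullDim (Subtype.val '' Z : Set X) = topologicalKrullDim Z := by
  have h1 : Topology.IsEmbedding fun z : Z => (z : S).val :=
    Topology.IsEmbedding.subtypeVal.comp Topology.IsEmbedding.subtypeVal
  have h2 : Set.range (fun z : Z => (z : S).val) = Subtype.val '' Z := by
    ext; simp
  rw [← h2]
  exact (IsHomeomorph.topologicalKrullDim_eq _ h1.toHomeomorph.isHomeomorph).symm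

theorem topologicalKrullDim_mono {Z T : Set X} (h : Z ⊆ T) :
    topologicalKrullDim Z ≤ topologicalKrullDim T :=
  (Topology.IsEmbedding.inclusion h).isInducing.topologicalKrullDim_le

/-- A criterion for `Y` to be the union of the components of maximal dimension `d`: irreducible
subsets have dimension at most `d`, those of dimension `d` are contained in `Y`, and they cover `Y`.
No finiteness of the number of components is needed. -/
theorem topologicalKrullDim_eq_and_sUnion_eq {S Y : Set X} {d : WithBot ℕ∞} (hne : Y.Nonempty)
    (h1 : ∀ Z ⊆ S, IsIrreducible Z → topologicalKrullDim Z ≤ d)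
    (h2 : ∀ Z ⊆ S, IsIrreducible Z → topologicalKrullDim Z = d → Z ⊆ Y)
    (h3 : ∀ F ∈ Y, ∃ Z ⊆ S, IsIrreducible Z ∧ F ∈ Z ∧ d ≤ topologicalKrullDim Z) :
    topologicalKrullDim S = d ∧ Subtype.val '' ⋃₀ {Z ∈ irreducibleComponents S |
      topologicalKrullDim Z = topologicalKrullDim S} = Y := by
  have hsub : ∀ Z : Set S, Subtype.val '' Z ⊆ S := fun Z => by
    rintro _ ⟨z, -, rfl⟩
    exact z.2
  have himg : ∀ Z : Set S, IsIrreducible Z → IsIrreducible (Subtype.val '' Z : Set X) :=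
    fun Z hZ => hZ.image _ continuous_subtype_val.continuousOn
  have hdim : topologicalKrullDim S = d := by
    apply le_antisymm
    · refine topologicalKrullDim_le_of_irreducible fun Z hZ _ => ?_
      rw [← topologicalKrullDim_image_val]
      exact h1 _ (hsub Z) (himg Z hZ)
    · obtain ⟨F, hF⟩ := hne
      obtain ⟨Z, hZ, -, -, hd⟩ := h3 F hF
      exact hd.trans (topologicalKrullDim_mono hZ)
  refine ⟨hdim, Set.Subset.antisymm ?_ fun F hF => ?_⟩
  · rintro _ ⟨z, ⟨Z, ⟨hZ, hd⟩, hz⟩, rfl⟩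
    have hd' := topologicalKrullDim_image_val Z
    rw [hd, hdim] at hd'
    exact h2 _ (hsub Z) (himg Z hZ.1) hd' ⟨z, hz, rfl⟩
  · obtain ⟨Z, hZ, hirr, hFZ, hd⟩ := h3 F hF
    have h4 : Subtype.val '' (Subtype.val ⁻¹' Z : Set S) = Z := by
      rw [Subtype.image_preimage_coe, Set.inter_eq_right.mpr hZ]
    have h5 : IsIrreducible (Subtype.val ⁻¹' Z : Set S) :=
      isIrreducible_of_image_subtypeVal (by rwa [h4])
    obtain ⟨C, hC, hZC, hmax⟩ := exists_preirreducible _ h5.2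
    have hCirr : IsIrreducible C := ⟨h5.1.mono hZC, hC⟩
    refine ⟨⟨F, hZ hFZ⟩, ⟨C, ⟨⟨hCirr, fun D hD hCD => (hmax D hD.2 hCD).le⟩, ?_⟩, hZC hFZ⟩, rfl⟩
    refine le_antisymm ?_ ?_
    · rw [hdim, ← topologicalKrullDim_image_val]
      exact h1 _ (hsub C) (himg C hCirr)
    · rw [hdim]
      refine hd.trans ?_
      rw [← h4, topologicalKrullDim_image_val]
      exact topologicalKrullDim_mono hZC

end Top

section Fiber

/-- A nilpotent endomorphism preserves a complete flag. -/
theorem springerFiber_nonempty (N : ℕ) : ∀ {V : Type u} [AddCommGroup V] [Module ℂ V]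
    [FiniteDimensional ℂ V] (_ : finrank ℂ V = N) {x : End ℂ V} (_ : IsNilpotent x),
    (springerFiber N x).Nonempty := by
  induction N with
  | zero =>
    intro V _ _ _ hV x hx
    have := Module.finrank_zero_iff.mp hV
    exact ⟨⟨fun _ => ⊥, fun _ _ _ => le_rfl, fun i => by rw [finrank_bot]; omega⟩, fun i => i.elim0⟩
  | succ N ih =>
    intro V _ _ _ hV x hx
    have h1 : ∃ v, v ≠ 0 ∧ x v = 0 := by
      by_contra! h
      have hinj : Function.Injective x := (injective_iff_map_eq_zero x).mpr fun v hv => by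
        by_contra h0
        exact h v h0 hv
      obtain ⟨M, hM⟩ := hx
      have h2 := hinj.iterate M
      rw [← Module.End.coe_pow, hM] at h2
      have := Module.nontrivial_of_finrank_pos (R := ℂ) (M := V) (by omega)
      obtain ⟨v, hv⟩ := exists_ne (0 : V)
      exact hv (h2 rfl)
    obtain ⟨v, hv0, hxv⟩ := h1
    obtain ⟨ψ, p, h⟩ := exists_isProjAlong hv0
    have hW : finrank ℂ (LinearMap.ker ψ) = N := by have := h.finrank_eq; omega
    obtain ⟨G, hG⟩ := ih hW (h.isNilpotent hxv hx)
    exact ⟨_, h.extendFlag_mem_springerFiber hxv hG⟩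

/-- The components of top dimension of the fibre over `x` together form the set of flags whose
middle space is the core space. -/
theorem fiber_dimension_and_components {n : ℕ} {V : Type*} [AddCommGroup V] [Module ℂ V]
    [FiniteDimensional ℂ V] (hV : finrank ℂ V = 2 * n + 1) {B : LinearMap.BilinForm ℂ V}
    (hB : B.Nondegenerate) (hs : B.IsSymm) {ι : (Fin n → ℂ) →ₗ[ℂ] V}
    (hinj : Function.Injective ι) {x : End ℂ V} (hx : x ∈ nilpotentCone B)
    {x' : End ℂ (Fin n → ℂ)} (hn' : IsNilpotent x') (hxι : ∀ w, x (ι w) = ι (x' w))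
    (hι : LinearMap.range ι = coreSpace x) (hd : pairCount x = 2 * pairCount x')
    (hdb : IsDoubled (kerRank x)) :
    topologicalKrullDim (resolutionFiber (2 * n + 1) B x) = (pairCount x' : ℕ) ∧
      IsIsomorphic (topComponentsUnion (resolutionFiber (2 * n + 1) B x)) (springerFiber n x') := by
  have hi : ∀ w w', B (ι w) (ι w') = 0 := fun w w' =>
    coreSpace_isotropic hs hx.1.2 (hι ▸ ⟨w, rfl⟩) (hι ▸ ⟨w', rfl⟩)
  obtain ⟨φ, hφ⟩ := exists_coreFiber_homeomorph hV hB hs hinj hi hx hxι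
  obtain ⟨F₀, hF₀⟩ := springerFiber_nonempty n (finrank_fin_fun ℂ) hn'
  have hub := fun Z (hZ : Z ⊆ resolutionFiber (2 * n + 1) B x) (hirr : IsIrreducible Z) =>
    topologicalKrullDim_le_of_subset_resolutionFiber hV hs hB hx.1.2 hx.2 hirr hZ hd
  have key := topologicalKrullDim_eq_and_sUnion_eq (S := resolutionFiber (2 * n + 1) B x)
    (Y := coreFiber B x ι) (d := ((pairCount x' : ℕ) : WithBot ℕ∞)) ⟨_, (φ.symm ⟨F₀, hF₀⟩).2⟩
    (fun Z hZ hirr => (hub Z hZ hirr).1) (fun Z hZ hirr hdim F hF => ⟨hZ hF, ?_⟩)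
    (fun F hF => ?_)
  · refine ⟨key.1, ?_⟩
    have h1 : topComponentsUnion (resolutionFiber (2 * n + 1) B x) = coreFiber B x ι := key.2
    rw [h1]
    exact ⟨φ, hφ⟩
  · refine (Submodule.eq_of_le_of_finrank_eq ?_ ?_).symm
    · rw [hι]
      exact (hub Z hZ hirr).2 hdb hdim F hF
    · rw [F.finrank_sub, finrank_range_of_injective hinj]
  · obtain ⟨l, hl, hFl, hlS⟩ := exists_chain_springerFiber n (finrank_fin_fun ℂ) hn' (φ ⟨F, hF⟩).2
    let L : Set (CompleteFlag n (Fin n → ℂ)) := (l.last).carrier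
    let g : L → CompleteFlag (2 * n + 1) V := fun G => (φ.symm ⟨G, hlS G.2⟩).val
    have hg : Topology.IsEmbedding g := Topology.IsEmbedding.subtypeVal.comp
      (φ.symm.isEmbedding.comp (Topology.IsEmbedding.inclusion hlS))
    refine ⟨Set.range g, ?_, ?_, ⟨⟨_, hFl⟩, ?_⟩, ?_⟩
    · rintro _ ⟨G, rfl⟩
      exact (φ.symm ⟨G, hlS G.2⟩).2.1
    · rw [← Set.image_univ]
      refine IsIrreducible.image ?_ _ hg.continuous.continuousOn
      refine isIrreducible_of_image_subtypeVal ?_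
      rw [Set.image_univ, Subtype.range_coe]
      exact l.last.isIrreducible
    · simp [g]
    · rw [← hl]
      refine (length_le_topologicalKrullDim_last l).trans ?_
      exact (IsHomeomorph.topologicalKrullDim_eq _ hg.toHomeomorph.isHomeomorph).le

end Fiber

/-! ### Comparison of the two Jordan types -/

section JordanType

variable {V : Type*} [AddCommGroup V] [Module ℂ V] [FiniteDimensional ℂ V]

/-- In a Jordan basis, the image of `x ^ j` is spanned by the vectors at positions at least `j` in
their strings. -/
theorem HasJordanType.finrank_range_pow {s : ℕ} {x : End ℂ V} {lam : Fin s → ℕ}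
    (hx : HasJordanType x lam) (j : ℕ) :
    finrank ℂ (LinearMap.range (x ^ j)) = ∑ i, (lam i - j) := by
  obtain ⟨b, hb⟩ := hx
  let e : (Σ i, Fin (lam i - j)) → Σ i, Fin (lam i) :=
    fun q => ⟨q.1, ⟨q.2 + j, by have := q.2.2; omega⟩⟩
  have he : Function.Injective e := by
    rintro ⟨i, a⟩ ⟨i', a'⟩ h
    simp only [e, Sigma.mk.injEq] at h
    obtain ⟨rfl, h2⟩ := h
    have h3 := congrArg Fin.val (eq_of_heq h2)
    simp only [add_left_inj] at h3
    rw [Fin.ext h3]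
  have h1 : LinearMap.range (x ^ j) = Submodule.span ℂ (Set.range (b ∘ e)) := by
    apply le_antisymm
    · rw [LinearMap.range_eq_map, ← b.span_eq, Submodule.map_span, Submodule.span_le]
      rintro _ ⟨_, ⟨⟨i, a⟩, rfl⟩, rfl⟩
      rw [pow_jordanBasis hb]
      split_ifs with h
      · exact Submodule.subset_span ⟨⟨i, ⟨a, by omega⟩⟩, rfl⟩
      · exact zero_mem _
    · rw [Submodule.span_le]
      rintro _ ⟨⟨i, a⟩, rfl⟩
      refine ⟨b ⟨i, ⟨a, by have := a.2; omega⟩⟩, ?_⟩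
      rw [pow_jordanBasis hb, dif_pos (by have := a.2; simp only; omega)]
      rfl
  rw [h1, finrank_span_eq_card (b.linearIndependent.comp e he), Fintype.card_sigma]
  simp

theorem HasJordanType.kerRank_eq {s : ℕ} {x : End ℂ V} {lam : Fin s → ℕ}
    (hx : HasJordanType x lam) (j : ℕ) : kerRank x j = ∑ i, if j < lam i then 1 else 0 := by
  have h1 := SymSpringer.finrank_range_pow x j
  rw [hx.finrank_range_pow, hx.finrank_range_pow] at h1
  have h2 : ∑ i, (lam i - j) = ∑ i, (lam i - (j + 1)) + ∑ i, if j < lam i then 1 else 0 := by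
    rw [← Finset.sum_add_distrib]
    refine Finset.sum_congr rfl fun i _ => ?_
    split_ifs <;> omega
  omega

variable {s n : ℕ} {p : Fin (s + 1) → ℕ} {x : End ℂ V} {x' : End ℂ (Fin n → ℂ)}

/-- The partition `(2 p₁ + 1, 2 p₂, …)` has as many parts greater than `2 k + 1` as `p` has parts
greater than `k`. -/
theorem kerRank_odd (hx : HasJordanType x (doubledPartition p)) (hx' : HasJordanType x' p) (k : ℕ) :
    kerRank x (2 * k + 1) = kerRank x' k := by
  rw [hx.kerRank_eq, hx'.kerRank_eq]
  refine Finset.sum_congr rfl fun i _ => ?_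
  refine if_congr ?_ rfl rfl
  rw [doubledPartition]
  split_ifs <;> omega

/-- The partition `(2 p₁ + 1, 2 p₂, …)` has as many parts greater than `2 k` as `p` has parts
greater than `k`, except that the largest part counts additionally for `k = p₁`. -/
theorem kerRank_even (hx : HasJordanType x (doubledPartition p)) (hx' : HasJordanType x' p)
    (k : ℕ) :
    kerRank x (2 * k) = kerRank x' k + if k = p 0 then 1 else 0 := by
  rw [hx.kerRank_eq, hx'.kerRank_eq, Fin.sum_univ_succ, Fin.sum_univ_succ, add_right_comm]
  congr 1
  · rw [doubledPartition, if_pos rfl]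
    split_ifs <;> omega
  · refine Finset.sum_congr rfl fun i _ => ?_
    refine if_congr ?_ rfl rfl
    rw [doubledPartition, if_neg (Fin.succ_ne_zero i)]
    omega

theorem kerRank_first (hp : Antitone p) (hx' : HasJordanType x' p) : kerRank x' (p 0) = 0 := by
  rw [hx'.kerRank_eq]
  refine Finset.sum_eq_zero fun i _ => if_neg ?_
  exact not_lt.mpr (hp (Fin.zero_le i))

theorem isDoubled_kerRank (hp : Antitone p) (hx : HasJordanType x (doubledPartition p))
    (hx' : HasJordanType x' p) : IsDoubled (kerRank x) := by
  refine ⟨p 0, ?_, ?_, fun i hi => ?_⟩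
  · rw [kerRank_even hx hx', kerRank_first hp hx', if_pos rfl]
  · rw [kerRank_odd hx hx', kerRank_first hp hx']
  · rw [kerRank_even hx hx', kerRank_odd hx hx', if_neg hi.ne, add_zero]

/-- The value of `pairCount` is that of `p` counted twice, since the additional part for `k = p₁`
occurs where there is no other. -/
theorem pairCount_eq_two_mul (hV : finrank ℂ V = 2 * n + 1) (hp : Antitone p)
    (hx : HasJordanType x (doubledPartition p)) (hx' : HasJordanType x' p) :
    pairCount x = 2 * pairCount x' := by
  have h1 : ∀ (f : ℕ → ℕ) (M : ℕ), ∑ j ∈ Finset.range (2 * M), f j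
      = ∑ k ∈ Finset.range M, (f (2 * k) + f (2 * k + 1)) := by
    intro f M
    induction M with
    | zero => rfl
    | succ M ih => rw [Finset.sum_range_succ _ M, ← ih, mul_add_one, Finset.sum_range_succ,
        Finset.sum_range_succ, add_assoc]
  rw [pairCount_eq_sum (isNilpotent_of_hasJordanType hx) (M := 2 * (n + 1)) (by omega), h1,
    pairCount_eq_sum (isNilpotent_of_hasJordanType hx') (M := n + 1)
      (by rw [finrank_fin_fun]; omega), Finset.mul_sum]
  refine Finset.sum_congr rfl fun k _ => ?_
  rw [kerRank_even hx hx', kerRank_odd hx hx']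
  split_ifs with h
  · rw [h, kerRank_first hp hx']
    rfl
  · rw [add_zero, two_mul]

end JordanType

/-! ### Commutators with a symmetric matrix -/

section Commutator

variable {κ : Type*} [DecidableEq κ]

/-- The matrix of the linear map `X ↦ A X - X A` on `κ × κ` matrices. Matrices are treated as
vectors indexed by `κ × κ`, as in the coordinates of the affine space of matrices. -/
def adMatrix {R : Type*} [CommRing R] (A : κ × κ → R) : Matrix (κ × κ) (κ × κ) R :=
  Matrix.of fun q r => (if q.2 = r.2 then A (q.1, r.1) else 0) -
    if q.1 = r.1 then A (r.2, q.2) else 0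

theorem adMatrix_map {R S : Type*} [CommRing R] [CommRing S] (f : R →+* S) (A : κ × κ → R) :
    (adMatrix A).map f = adMatrix (f ∘ A) := by
  ext q r
  simp only [adMatrix, Matrix.map_apply, Matrix.of_apply, map_sub, apply_ite f, map_zero,
    Function.comp_apply]

variable [Fintype κ]

theorem adMatrix_mulVec {R : Type*} [CommRing R] (A X : Matrix κ κ R) :
    (adMatrix fun q => A q.1 q.2).mulVec (fun q => X q.1 q.2) =
    fun q => (A * X - X * A) q.1 q.2 := by
  funext q
  rw [Matrix.mulVec, dotProduct, Fintype.sum_prod_type]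
  simp only [adMatrix, Matrix.of_apply, sub_mul, ite_mul, zero_mul, Finset.sum_sub_distrib,
    Finset.sum_ite_eq, Finset.mem_univ, if_true, Matrix.sub_apply, Matrix.mul_apply]
  congr 1
  rw [Finset.sum_comm]
  simp [mul_comm]

variable {K : Type*} [Field K]

variable (κ K) in
/-- The skew-symmetric matrices, as a space of vectors indexed by `κ × κ`. -/
def skewSub : Submodule K (κ × κ → K) where
  carrier := {X | ∀ q, X q.swap = - X q}
  add_mem' := fun {X Y} hX hY q => by simp only [Pi.add_apply, hX q, hY q]; ring
  zero_mem' := fun q => by simp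
  smul_mem' := fun c X hX q => by simp only [Pi.smul_apply, hX q, smul_eq_mul]; ring

variable {A : κ × κ → K} (hA : ∀ q, A q.swap = A q)
include hA

omit [Fintype κ] in
theorem adMatrix_swap (q r : κ × κ) : adMatrix A q.swap r = - adMatrix A q r.swap := by
  obtain ⟨i, j⟩ := q
  obtain ⟨k, l⟩ := r
  have h1 := hA (j, k)
  have h2 := hA (l, i)
  simp only [Prod.swap_prod_mk] at h1 h2
  simp only [adMatrix, Matrix.of_apply, Prod.swap_prod_mk, neg_sub]
  rw [← h1, ← h2]

omit [Fintype κ] in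
theorem adMatrix_transpose : (adMatrix A).transpose = adMatrix A := by
  ext ⟨i, j⟩ ⟨k, l⟩
  have h1 := hA (i, k)
  have h2 := hA (l, j)
  simp only [Prod.swap_prod_mk] at h1 h2
  simp only [Matrix.transpose_apply, adMatrix, Matrix.of_apply, h1, h2, eq_comm]

/-- For symmetric `A`, the commutator with `A` exchanges skew-symmetric and symmetric matrices. -/
theorem adMatrix_mulVec_swap (X : κ × κ → K) (q : κ × κ) :
    (adMatrix A).mulVec X q.swap = - (adMatrix A).mulVec (X ∘ Prod.swap) q := by
  simp only [Matrix.mulVec, dotProduct, adMatrix_swap hA, neg_mul, Finset.sum_neg_distrib]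
  congr 1
  exact Fintype.sum_equiv (Equiv.prodComm κ κ) _ _ fun r => rfl

omit [DecidableEq κ] [Fintype κ] hA in
theorem sub_swap_mem_skewSub (X : κ × κ → K) : X - X ∘ Prod.swap ∈ skewSub κ K := fun q => by
  simp

/-- For symmetric `A`, the rank of `X ↦ A X - X A` is twice its rank on skew-symmetric matrices. Its
restrictions to skew-symmetric matrices and to symmetric matrices are transposes of each other, up
to sign, and so have equal rank. -/
theorem rank_adMatrix_eq (h2 : (2 : K) ≠ 0) : (adMatrix A).rank
    = 2 * finrank K ((skewSub κ K).map (adMatrix A).mulVecLin) := by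
  let M := adMatrix A
  -- the composites of the commutator with the projections, up to the factor `2`, to skew-symmetric
  -- and to symmetric matrices
  let Mm := M - M.submatrix id Prod.swap
  let Mp := M + M.submatrix id Prod.swap
  have hsub : ∀ X, (M.submatrix id Prod.swap).mulVec X = M.mulVec (X ∘ Prod.swap) := fun X => by
    funext q
    simp only [Matrix.mulVec, dotProduct, Matrix.submatrix_apply]
    exact Fintype.sum_equiv (Equiv.prodComm κ κ) _ _ fun r => rfl
  have hmm : ∀ X, Mm.mulVec X = M.mulVec (X - X ∘ Prod.swap) := fun X => by
    rw [Matrix.sub_mulVec, hsub, Matrix.mulVec_sub]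
  have hmp : ∀ X, Mp.mulVec X = M.mulVec (X + X ∘ Prod.swap) := fun X => by
    rw [Matrix.add_mulVec, hsub, Matrix.mulVec_add]
  have hrank : Mm.rank = Mp.rank := by
    rw [← Matrix.rank_transpose]
    congr 1
    ext q r
    have h3 := congrFun (congrFun (adMatrix_transpose hA) q) r
    have h4 := congrFun (congrFun (adMatrix_transpose hA) q.swap) r
    rw [Matrix.transpose_apply] at h3 h4
    have h5 := adMatrix_swap hA q r
    simp only [Mm, Mp, M, Matrix.transpose_apply, Matrix.sub_apply, Matrix.submatrix_apply, id,
      Matrix.add_apply]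
    rw [h3, h4, h5, sub_neg_eq_add]
  have hsk : (skewSub κ K).map M.mulVecLin = LinearMap.range Mm.mulVecLin := by
    apply le_antisymm
    · rintro _ ⟨X, hX, rfl⟩
      refine ⟨(2 : K)⁻¹ • X, ?_⟩
      change Mm.mulVec _ = M.mulVec X
      rw [hmm]
      congr 1
      funext q
      have := hX q
      simp only [Pi.sub_apply, Pi.smul_apply, Function.comp_apply, smul_eq_mul, this]
      field_simp
      ring
    · rintro _ ⟨X, rfl⟩
      exact ⟨_, sub_swap_mem_skewSub X, (hmm X).symm⟩
  have hsup : LinearMap.range Mm.mulVecLin ⊔ LinearMap.range Mp.mulVecLin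
      = LinearMap.range M.mulVecLin := by
    apply le_antisymm
    · refine sup_le ?_ ?_
      · rintro _ ⟨X, rfl⟩
        exact ⟨_, (hmm X).symm⟩
      · rintro _ ⟨X, rfl⟩
        exact ⟨_, (hmp X).symm⟩
    · rintro _ ⟨X, rfl⟩
      refine Submodule.mem_sup.mpr ⟨_, ⟨(2 : K)⁻¹ • X, rfl⟩, _, ⟨(2 : K)⁻¹ • X, rfl⟩, ?_⟩
      simp only [Matrix.mulVecLin_apply, ← Matrix.add_mulVec]
      have : Mm + Mp = (2 : K) • M := by
        simp only [Mm, Mp, two_smul]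
        abel
      rw [this, Matrix.mulVec_smul, Matrix.smul_mulVec, smul_smul, inv_mul_cancel₀ h2, one_smul]
  have hdisj : LinearMap.range Mm.mulVecLin ⊓ LinearMap.range Mp.mulVecLin = ⊥ := by
    rw [eq_bot_iff]
    rintro Y ⟨⟨X, rfl⟩, ⟨X', hX'⟩⟩
    have h3 : ∀ q, Mm.mulVec X q.swap = Mm.mulVec X q := fun q => by
      rw [hmm, adMatrix_mulVec_swap hA, ← Pi.neg_apply, ← Matrix.mulVec_neg]
      congr 2
      funext r
      simp
    have h4 : ∀ q, Mp.mulVec X' q.swap = - Mp.mulVec X' q := fun q => by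
      have h5 : (X' + X' ∘ Prod.swap) ∘ Prod.swap = X' + X' ∘ Prod.swap := by
        funext r
        simp [add_comm]
      rw [hmp, adMatrix_mulVec_swap hA, h5]
    change Mp.mulVec X' = Mm.mulVec X at hX'
    change Mm.mulVec X = 0
    funext q
    have h5 := h4 q
    rw [hX', h3] at h5
    have h6 : (2 : K) * Mm.mulVec X q = 0 := by
      rw [two_mul]
      nth_rewrite 1 [h5]
      ring
    exact (mul_eq_zero.mp h6).resolve_left h2
  have h7 := Submodule.finrank_sup_add_finrank_inf_eq (LinearMap.range Mm.mulVecLin)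
    (LinearMap.range Mp.mulVecLin)
  rw [hsup, hdisj, finrank_bot, add_zero] at h7
  rw [Matrix.rank] at hrank
  rw [Matrix.rank] at hrank
  change finrank K (LinearMap.range M.mulVecLin) = 2 * finrank K ((skewSub κ K).map M.mulVecLin)
  rw [hsk, h7, two_mul, hrank]

end Commutator

section Skew

variable {N : ℕ} {K : Type*} [Field K]

/-- The skew-symmetric matrix with entries `a` below the diagonal. -/
def skewOf {R : Type*} [Ring R] (a : LowerIdx N → R) : Matrix (Fin N) (Fin N) R :=
  Matrix.of fun i j => if h : j < i then a ⟨(i, j), h⟩ else if h : i < j then - a ⟨(j, i), h⟩ else 0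

theorem skewOf_transpose {R : Type*} [Ring R] (a : LowerIdx N → R) :
    (skewOf a).transpose = - skewOf a := by
  ext i j
  rw [Matrix.transpose_apply, Matrix.neg_apply]
  rcases lt_trichotomy i j with h | rfl | h
  · simp [skewOf, h, not_lt.mpr h.le]
  · simp [skewOf]
  · simp [skewOf, h, not_lt.mpr h.le]

theorem finrank_skewSub (h2 : (2 : K) ≠ 0) :
    finrank K (skewSub (Fin N) K) = Fintype.card (LowerIdx N) := by
  have hs : ∀ X ∈ skewSub (Fin N) K, ∀ i j, X (i, j) = - X (j, i) := fun X hX i j => hX (j, i)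
  let e : skewSub (Fin N) K ≃ₗ[K] (LowerIdx N → K) :=
    { toFun := fun X l => X.1 l.1
      map_add' := fun _ _ => rfl
      map_smul' := fun _ _ => rfl
      invFun := fun a => ⟨fun q => skewOf a q.1 q.2, fun q => by
        have := congrFun (congrFun (skewOf_transpose a) q.1) q.2
        exact this⟩
      left_inv := fun X => by
        refine Subtype.ext (funext fun ⟨i, j⟩ => ?_)
        have h := hs X.1 X.2 i j
        simp only [skewOf, Matrix.of_apply]
        split_ifs with h1 h3
        · rfl
        · rw [h]
        · obtain rfl : i = j := le_antisymm (not_lt.mp h1) (not_lt.mp h3)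
          have h6 : (2 : K) * X.1 (i, i) = 0 := by
            rw [two_mul]
            nth_rewrite 1 [h]
            ring
          exact ((mul_eq_zero.mp h6).resolve_left h2).symm
      right_inv := fun a => by
        funext ⟨⟨i, j⟩, h⟩
        have h' : j < i := h
        simp [skewOf, h'] }
  rw [e.finrank_eq, finrank_fintype_fun_eq_card]

variable (N) in
theorem two_mul_card_lowerIdx_add : 2 * Fintype.card (LowerIdx N) + N = N ^ 2 := by
  let e : LowerIdx N ⊕ LowerIdx N ⊕ Fin N ≃ Fin N × Fin N :=
    { toFun := Sum.elim (fun l => l.1) (Sum.elim (fun l => l.1.swap) fun i => (i, i))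
      invFun := fun q => if h : q.2 < q.1 then .inl ⟨q, h⟩
        else if h' : q.1 < q.2 then .inr (.inl ⟨q.swap, h'⟩) else .inr (.inr q.1)
      left_inv := by
        rintro (⟨⟨i, j⟩, h⟩ | ⟨⟨i, j⟩, h⟩ | i)
        · have h' : j < i := h
          simp [h']
        · have h' : j < i := h
          simp [h', not_lt.mpr h'.le]
        · simp
      right_inv := by
        rintro ⟨i, j⟩
        rcases lt_trichotomy i j with h | rfl | h
        · simp [h, not_lt.mpr h.le]
        · simp
        · simp [h] }
  have h1 := Fintype.card_congr e
  rw [Fintype.card_sum, Fintype.card_sum, Fintype.card_prod, Fintype.card_fin] at h1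
  rw [sq, ← h1]
  ring

end Skew

/-! ### Upper bound for sets of nilpotent symmetric matrices -/

section Minor

variable {K : Type*} [Field K]

theorem exists_linearIndependent_columns {m n : Type*} [Fintype n] [Finite m] {A : Matrix m n K}
    {r : ℕ} (hr : A.rank = r) : ∃ g : Fin r → n, LinearIndependent K fun j => A.col (g j) := by
  rw [Matrix.rank_eq_finrank_span_cols] at hr
  subst hr
  obtain ⟨f, hf, -, hli⟩ := Submodule.exists_fun_fin_finrank_span_eq K (Set.range A.col)
  choose g hg using hf
  exact ⟨g, by simpa only [hg] using hli⟩

theorem exists_minor_ne_zero {m n : Type*} [Fintype m] [Fintype n] {A : Matrix m n K} {r : ℕ}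
    (hr : A.rank = r) : ∃ (f : Fin r → m) (g : Fin r → n), (A.submatrix f g).det ≠ 0 := by
  obtain ⟨g, hg⟩ := exists_linearIndependent_columns hr
  let A' := (A.submatrix id g).transpose
  have h1 : A'.rank = r := by
    have h2 := LinearIndependent.rank_matrix (M := A') hg
    rwa [Fintype.card_fin] at h2
  obtain ⟨f, hf⟩ := exists_linearIndependent_columns h1
  refine ⟨f, g, ?_⟩
  have h3 := (Matrix.linearIndependent_rows_iff_isUnit (A := A.submatrix f g)).mp hf
  exact ((Matrix.isUnit_iff_isUnit_det _).mp h3).ne_zero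

end Minor

section Connection

variable {K : Type*} [Field K] [Algebra ℂ K] (D : Derivation ℂ K K)

/-- Given a nilpotent endomorphism `y` of a vector space over a field with a derivation `D`, there
is an additive operator that satisfies the Leibniz rule for `D` and commutes with `y`. In a Jordan
basis one differentiates coordinates; the construction here is by induction, from the image of `y`
to the space. -/
theorem exists_connection_commuting (M : ℕ) : ∀ {V : Type*} [AddCommGroup V] [Module K V]
    [FiniteDimensional K V] {y : End K V} (_ : y ^ M = 0), ∃ nab : V →+ V,
      (∀ (c : K) v, nab (c • v) = D c • v + c • nab v) ∧ ∀ v, nab (y v) = y (nab v) := by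
  induction M with
  | zero =>
    intro V _ _ _ y hy
    have h0 : ∀ v : V, v = 0 := fun v => LinearMap.congr_fun hy v
    exact ⟨0, fun c v => by rw [h0 v]; simp, fun v => by simp⟩
  | succ M ih =>
    intro V _ _ _ y hy
    let W := LinearMap.range y
    let y' : End K W := y.rangeRestrict ∘ₗ W.subtype
    have hy' : ∀ w : W, (y' w : V) = y w := fun w => rfl
    have hpow : ∀ k (w : W), ((y' ^ k) w : V) = (y ^ k) w := by
      intro k
      induction k with
      | zero => intro w; rfl
      | succ k ihk => intro w; rw [pow_succ, pow_succ, Module.End.mul_apply, ihk, hy']; rfl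
    obtain ⟨nab, h1, h2⟩ := ih (y := y') (LinearMap.ext fun ⟨w, v, hv⟩ => Subtype.ext (by
      rw [hpow]
      change (y ^ M) w = 0
      rw [← hv, ← Module.End.mul_apply, ← pow_succ, hy, LinearMap.zero_apply]))
    obtain ⟨C, hC⟩ := Submodule.exists_isCompl W
    let c := finBasis K C
    let p : V →ₗ[K] W := W.projectionOnto C hC
    let q : V →ₗ[K] C := C.projectionOnto W hC.symm
    have hpq : ∀ v : V, (p v : V) + q v = v := fun v => by
      obtain ⟨a, ha, b, hb, rfl⟩ := Submodule.mem_sup.mp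
        (show v ∈ W ⊔ C from hC.sup_eq_top.symm ▸ Submodule.mem_top)
      rw [map_add, map_add, Submodule.projectionOnto_apply_left hC ⟨a, ha⟩,
        Submodule.projectionOnto_apply_right hC ⟨b, hb⟩,
        Submodule.projectionOnto_apply_left hC.symm ⟨b, hb⟩,
        Submodule.projectionOnto_apply_right hC.symm ⟨a, ha⟩, add_zero, zero_add]
    have hcoord : ∀ v, (q v : V) = ∑ i, c.repr (q v) i • (c i : V) := fun v => by
      refine (congrArg C.subtype (c.sum_repr (q v)).symm).trans ?_
      simp only [map_sum, map_smul, Submodule.subtype_apply]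
    have hpW : ∀ w : W, p w = w := fun w => Submodule.projectionOnto_apply_left hC w
    have hqW : ∀ w : W, q w = 0 := fun w => Submodule.projectionOnto_apply_right hC.symm w
    -- the value on a basis vector `c i` of a complement of the image has to be sent by `y` to the
    -- value on `y (c i)`
    have ht : ∀ i, ∃ t : V, y t = nab (y.rangeRestrict (c i)) := fun i =>
      (nab (y.rangeRestrict (c i))).2
    choose t ht using ht
    let nab' : V →+ V :=
      { toFun := fun v => nab (p v) + ∑ i, (D (c.repr (q v) i) • (c i : V) + c.repr (q v) i • t i)
        map_zero' := by simp
        map_add' := fun v w => by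
          simp only [map_add, Finsupp.add_apply, add_smul, Finset.sum_add_distrib,
            Submodule.coe_add]
          abel }
    have hnab' : ∀ v, nab' v = nab (p v)
      + ∑ i, (D (c.repr (q v) i) • (c i : V) + c.repr (q v) i • t i) := fun _ => rfl
    refine ⟨nab', fun a v => ?_, fun v => ?_⟩
    · have h3 : ∀ i, D (c.repr (q (a • v)) i) • (c i : V) + c.repr (q (a • v)) i • t i
          = D a • c.repr (q v) i • (c i : V)
            + a • (D (c.repr (q v) i) • (c i : V) + c.repr (q v) i • t i) := fun i => by
        rw [map_smul, map_smul, Finsupp.smul_apply, smul_eq_mul, D.leibniz, smul_eq_mul,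
          smul_eq_mul, add_smul, smul_add, smul_smul, smul_smul, smul_smul,
          mul_comm (c.repr (q v) i)]
        abel
      rw [hnab', hnab', map_smul, h1, Finset.sum_congr rfl fun i _ => h3 i, Finset.sum_add_distrib,
        ← Finset.smul_sum, ← Finset.smul_sum, ← hcoord, Submodule.coe_add, Submodule.coe_smul,
        Submodule.coe_smul]
      conv_rhs => rw [← hpq v]
      rw [smul_add, smul_add, hpq v]
      abel
    · have h3 : y v = y' (p v) + ∑ i, c.repr (q v) i • (y.rangeRestrict (c i) : V) := by
        conv_lhs => rw [← hpq v, hcoord v]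
        simp [hy']
      have h4 : y.rangeRestrict v = y' (p v) + ∑ i, c.repr (q v) i • y.rangeRestrict (c i) := by
        apply Subtype.ext
        simp [h3]
      have h5 : (y v : V) = (y.rangeRestrict v : W) := rfl
      rw [h5, hnab', hpW, hqW, h4]
      simp [h1, h2, ht, hnab', hy', Finset.sum_add_distrib]

/-- The derivative of a nilpotent matrix is its commutator with a matrix `ξ`, the one which
describes the difference between the coordinatewise derivation and an operator commuting with `Y`.
This stands in for the finiteness of the number of nilpotent orbits: infinitesimally, a nilpotent
matrix moves only inside its orbit. -/
theorem exists_commutator_eq_derivation {N : ℕ} {Y : Matrix (Fin N) (Fin N) K} {M : ℕ}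
    (hY : Y ^ M = 0) : ∃ ξ : Matrix (Fin N) (Fin N) K, ∀ i j, D (Y i j) = (Y * ξ - ξ * Y) i j := by
  obtain ⟨nab, h1, h2⟩ := exists_connection_commuting D M (y := Matrix.toLinAlgEquiv' Y)
    (by rw [← map_pow, hY, map_zero])
  refine ⟨Matrix.of fun i j => nab (Pi.single j 1) i, fun i j => ?_⟩
  have h3 := congrFun (h2 (Pi.single j 1)) i
  rw [Matrix.toLinAlgEquiv'_apply, Matrix.toLinAlgEquiv'_apply] at h3
  have h4 : Y.mulVec (Pi.single j 1) = ∑ k, Y k j • (Pi.single k 1 : Fin N → K) := by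
    rw [Matrix.mulVec_single_one]
    funext k
    simp [Pi.single_apply]
  rw [h4, map_sum] at h3
  simp only [h1, Finset.sum_add_distrib, Pi.add_apply, Finset.sum_apply, Pi.smul_apply,
    smul_eq_mul, Pi.single_apply, mul_ite, mul_one, mul_zero, Finset.sum_ite_eq, Finset.mem_univ,
    if_true, Matrix.mulVec, dotProduct] at h3
  rw [Matrix.sub_apply, Matrix.mul_apply, Matrix.mul_apply, eq_sub_iff_add_eq]
  simp only [Matrix.of_apply]
  rw [← h3]
  simp only [mul_comm]

end Connection

section UpperBound

variable {N : ℕ}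

/-- The derivatives of a generic symmetric nilpotent matrix `y` are symmetric commutators of `y`,
and so commutators with skew-symmetric matrices; these make up half of the image of the commutator
map. -/
theorem finrank_derivation_le_of_symmetric {K : Type*} [Field K] [Algebra ℂ K]
    [Module.Finite K (Derivation ℂ K K)] {y : Fin N × Fin N → K} (hs : ∀ q, y q.swap = y q) {M : ℕ}
    (hn : (Matrix.of fun i j => y (i, j)) ^ M = 0)
    (hD : ∀ D : Derivation ℂ K K, (∀ q, D (y q) = 0) → D = 0) :
    2 * finrank K (Derivation ℂ K K) ≤ (adMatrix y).rank := by
  have h2 : (2 : K) ≠ 0 := by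
    have := (algebraMap ℂ K).injective.ne (two_ne_zero (α := ℂ))
    rwa [map_ofNat, map_zero] at this
  rw [rank_adMatrix_eq hs h2]
  refine Nat.mul_le_mul_left 2 ?_
  let δ : Derivation ℂ K K →ₗ[K] (Fin N × Fin N → K) :=
    { toFun := fun D q => D (y q)
      map_add' := fun _ _ => rfl
      map_smul' := fun _ _ => rfl }
  have hδ : ∀ D, δ D ∈ (skewSub (Fin N) K).map (adMatrix y).mulVecLin := by
    intro D
    obtain ⟨ξ, hξ⟩ := exists_commutator_eq_derivation D hn
    let Ξ : Fin N × Fin N → K := fun q => ξ q.1 q.2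
    have h3 : (adMatrix y).mulVec Ξ = δ D := by
      have h4 := adMatrix_mulVec (Matrix.of fun i j => y (i, j)) ξ
      refine h4.trans (funext fun q => (hξ q.1 q.2).symm)
    have h5 : (adMatrix y).mulVec (Ξ ∘ Prod.swap) = - δ D := by
      funext q
      have h6 := adMatrix_mulVec_swap hs Ξ q
      rw [h3] at h6
      rw [Pi.neg_apply, eq_neg_iff_add_eq_zero, ← neg_eq_iff_add_eq_zero, ← h6]
      exact congrArg D (hs q)
    refine ⟨(2 : K)⁻¹ • (Ξ - Ξ ∘ Prod.swap),
      Submodule.smul_mem _ _ (sub_swap_mem_skewSub Ξ), ?_⟩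
    rw [Matrix.mulVecLin_apply, Matrix.mulVec_smul, Matrix.mulVec_sub, h3, h5, sub_neg_eq_add,
      ← two_smul K, smul_smul, inv_mul_cancel₀ h2, one_smul]
  refine LinearMap.finrank_le_finrank_of_injective (f := δ.codRestrict _ hδ)
    ((injective_iff_map_eq_zero _).mpr fun D h => hD D fun q => ?_)
  exact congrFun (congrArg Subtype.val h) q

/-- The upper bound for the dimension of a set of symmetric nilpotent matrices, in terms of the
ranks of their commutator maps. -/
theorem topologicalKrullDim_le_of_rank_adMatrix_le {e : ℕ} {T : Set (Zar (Fin N × Fin N → ℂ))}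
    (hsym : ∀ a : Fin N × Fin N → ℂ, a ∈ (T : Set (Fin N × Fin N → ℂ)) → ∀ q, a q.swap = a q)
    {M : ℕ}
    (hnil : ∀ a : Fin N × Fin N → ℂ, a ∈ (T : Set (Fin N × Fin N → ℂ)) →
      (Matrix.of fun i j => a (i, j)) ^ M = 0)
    (hr : ∀ a : Fin N × Fin N → ℂ, a ∈ (T : Set (Fin N × Fin N → ℂ)) → (adMatrix a).rank ≤ 2 * e) :
    topologicalKrullDim T ≤ e := by
  refine topologicalKrullDim_le_of_irreducible fun Z hZ _ => ?_
  have hsub : ∀ a : Fin N × Fin N → ℂ, a ∈ (Subtype.val '' Z : Set (Zar (Fin N × Fin N → ℂ))) →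
      a ∈ (T : Set (Fin N × Fin N → ℂ)) := by
    rintro _ ⟨a, -, rfl⟩
    exact a.2
  rw [← topologicalKrullDim_image_val]
  obtain ⟨K, _, _, y, hy, _, hD, hdim⟩ :=
    exists_isGenericPoint (hZ.image _ continuous_subtype_val.continuousOn)
  refine hdim.trans ?_
  have h1 : 2 * finrank K (Derivation ℂ K K) ≤ (adMatrix y).rank := by
    refine finrank_derivation_le_of_symmetric (M := M) (fun q => ?_) ?_ hD
    · have h2 := (hy (X q.swap - X q)).mpr fun a ha => by
        rw [map_sub, aeval_X, aeval_X, hsym a (hsub a ha), sub_self]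
      rwa [map_sub, aeval_X, aeval_X, sub_eq_zero] at h2
    · let G : Matrix (Fin N) (Fin N) (MvPolynomial (Fin N × Fin N) ℂ) :=
          Matrix.of fun i j => X (i, j)
      have hG : ∀ {L : Type} [Field L] [Algebra ℂ L] (a : Fin N × Fin N → L) (i j : Fin N),
          aeval a ((G ^ M) i j) = ((Matrix.of fun i j => a (i, j)) ^ M) i j := by
        intro L _ _ a i j
        have h3 : (Matrix.of fun i j => a (i, j)) = (aeval a : _ →ₐ[ℂ] L).mapMatrix G := by
          ext; simp [G]
        rw [h3]
        exact congrFun (congrFun (map_pow (aeval a : _ →ₐ[ℂ] L).mapMatrix G M) i) j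
      ext i j
      rw [← hG, Matrix.zero_apply, hy]
      intro a ha
      rw [hG, hnil a (hsub a ha), Matrix.zero_apply]
  -- the rank of the commutator map at the generic point is attained at some point of `Z`, by means
  -- of a minor
  obtain ⟨f, g, hfg⟩ := exists_minor_ne_zero (A := adMatrix y) rfl
  let P :=
    ((adMatrix (fun q => X q : Fin N × Fin N → MvPolynomial (Fin N × Fin N) ℂ)).submatrix f g).det
  have hP : ∀ {L : Type} [Field L] [Algebra ℂ L] (a : Fin N × Fin N → L),
      aeval a P = ((adMatrix a).submatrix f g).det := by
    intro L _ _ a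
    have h3 : adMatrix a = (adMatrix (fun q => X q)).map (aeval a : MvPolynomial _ ℂ →ₐ[ℂ] L) := by
      rw [show (adMatrix (fun q => X q)).map (aeval a : MvPolynomial _ ℂ →ₐ[ℂ] L)
        = adMatrix _ from adMatrix_map (aeval a : MvPolynomial _ ℂ →ₐ[ℂ] L).toRingHom _]
      congr 1
      funext q
      simp
    rw [h3, AlgHom.map_det]
    rfl
  have h4 : ¬ ∀ a ∈ (Subtype.val '' Z : Set (Zar (Fin N × Fin N → ℂ))), aeval a P = 0 := by
    intro h
    refine hfg ?_
    rw [← hP]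
    exact (hy P).mpr h
  push Not at h4
  obtain ⟨a, ha, haP⟩ := h4
  have h5 := hr a (hsub a ha)
  have h6 := Matrix.rank_submatrix_le (adMatrix a) f g
  rw [Matrix.rank_of_det_ne_zero (hP a ▸ haP), Fintype.card_fin] at h6
  have h7 : finrank K (Derivation ℂ K K) ≤ e := by omega
  exact_mod_cast h7

end UpperBound

/-! ### Lower bound for orthogonal conjugacy classes by Cayley transforms -/

section Cayley

variable {N : ℕ}

/-- The Cayley transform `(1 - ξ) (1 + ξ)⁻¹` of a skew-symmetric matrix is orthogonal. -/
theorem cayley_orthogonal {R : Type*} [CommRing R] {ξ : Matrix (Fin N) (Fin N) R}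
    (hξ : ξ.transpose = - ξ) (hd : IsUnit (1 + ξ).det) :
    ∃ h : Matrix (Fin N) (Fin N) R, h.transpose * h = 1 ∧ h * (1 + ξ) = 1 - ξ := by
  have h1 : (1 + ξ).transpose = 1 - ξ := by
    rw [Matrix.transpose_add, Matrix.transpose_one, hξ, sub_eq_add_neg]
  have hd' : IsUnit (1 - ξ).det := by rwa [← h1, Matrix.det_transpose]
  refine ⟨(1 - ξ) * (1 + ξ)⁻¹, ?_, ?_⟩
  · have h2 : (1 - ξ).transpose = 1 + ξ := by rw [← h1, Matrix.transpose_transpose]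
    have h3 : (1 + ξ) * (1 - ξ) = (1 - ξ) * (1 + ξ) := by noncomm_ring
    rw [Matrix.transpose_mul, Matrix.transpose_nonsing_inv, h1, h2, mul_assoc,
      ← mul_assoc (1 + ξ), h3, mul_assoc (1 - ξ), Matrix.mul_nonsing_inv _ hd, mul_one,
      Matrix.nonsing_inv_mul _ hd']
  · rw [mul_assoc, Matrix.nonsing_inv_mul _ hd, mul_one]

variable {K : Type*} [Field K] [Algebra ℂ K]

theorem map_derivation_mul (D : Derivation ℂ K K) (A A' : Matrix (Fin N) (Fin N) K) :
    (A * A').map D = A.map D * A' + A * A'.map D := by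
  ext i j
  simp only [Matrix.map_apply, Matrix.mul_apply, Matrix.add_apply, map_sum, D.leibniz, smul_eq_mul,
    Finset.sum_add_distrib]
  rw [add_comm]
  congr 1
  exact Finset.sum_congr rfl fun _ _ => mul_comm _ _

theorem map_derivation_one (D : Derivation ℂ K K) : (1 : Matrix (Fin N) (Fin N) K).map D = 0 := by
  ext i j
  simp [Matrix.one_apply, apply_ite D]

theorem map_derivation_const (D : Derivation ℂ K K) (A : Matrix (Fin N) (Fin N) ℂ) :
    (A.map (algebraMap ℂ K)).map D = 0 := by
  ext i j
  simp

theorem map_derivation_transpose (D : Derivation ℂ K K) (A : Matrix (Fin N) (Fin N) K) :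
    A.transpose.map D = (A.map D).transpose := rfl

/-- The derivations of `K` that kill the coordinates of the point `y`. -/
def annihilatorDer {σ : Type*} (y : σ → K) : Submodule K (Derivation ℂ K K) where
  carrier := {D | ∀ q, D (y q) = 0}
  add_mem' := fun h h' q => by rw [Derivation.add_apply, h q, h' q, add_zero]
  zero_mem' := fun q => rfl
  smul_mem' := fun c D h q => by rw [Derivation.smul_apply, h q, smul_zero]

/-- For `h` orthogonal, a derivation `D` gives the skew-symmetric matrix `hᵀ D h`, which determines
`D` if `h` is the Cayley transform of a generic skew-symmetric matrix `skewOf t`. If `D` kills the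
conjugate `h x₀ hᵀ`, this matrix commutes with `x₀`. This bounds the number of such `D` by the
dimension of the skew-symmetric commutant of `x₀`. -/
theorem finrank_annihilatorDer_add_le {x₀ : Matrix (Fin N) (Fin N) ℂ} (hx : x₀.transpose = x₀)
    {e : ℕ} (he : 2 * e ≤ (adMatrix fun q => x₀ q.1 q.2).rank) {t : LowerIdx N → K}
    (ht : ∀ D : Derivation ℂ K K, (∀ l, D (t l) = 0) → D = 0)
    {h : Matrix (Fin N) (Fin N) K} (hh : h.transpose * h = 1)
    (hc : h * (1 + skewOf t) = 1 - skewOf t) :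
    finrank K (annihilatorDer fun q : Fin N × Fin N =>
      (h * x₀.map (algebraMap ℂ K) * h.transpose) q.1 q.2) + e ≤ Fintype.card (LowerIdx N) := by
  have h2 : (2 : K) ≠ 0 := by
    have := (algebraMap ℂ K).injective.ne (two_ne_zero (α := ℂ))
    rwa [map_ofNat, map_zero] at this
  have hh' : h * h.transpose = 1 := mul_eq_one_comm.mp hh
  let x₁ := x₀.map (algebraMap ℂ K)
  have hx1 : (adMatrix fun q : Fin N × Fin N => x₁ q.1 q.2)
      = (adMatrix fun q => x₀ q.1 q.2).map (algebraMap ℂ K) := (adMatrix_map _ _).symm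
  have hsym : ∀ q : Fin N × Fin N, x₁ q.swap.1 q.swap.2 = x₁ q.1 q.2 := fun q =>
    congrArg (algebraMap ℂ K) (congrFun (congrFun hx q.1) q.2)
  have hrank := rank_adMatrix_eq (A := fun q : Fin N × Fin N => x₁ q.1 q.2) hsym h2
  rw [hx1, rank_map, ← hx1] at hrank
  have hker := finrank_map_add_finrank_inf_ker
    (adMatrix fun q : Fin N × Fin N => x₁ q.1 q.2).mulVecLin
    (skewSub (Fin N) K)
  rw [finrank_skewSub h2] at hker
  let ρ : Derivation ℂ K K →ₗ[K] (Fin N × Fin N → K) :=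
    { toFun := fun D q => (h.transpose * h.map D) q.1 q.2
      map_add' := fun D D' => by
        funext q
        simp [Matrix.mul_apply, mul_add, Finset.sum_add_distrib]
      map_smul' := fun c D => by
        funext q
        simp [Matrix.mul_apply, Finset.mul_sum, mul_left_comm] }
  -- differentiate `hᵀ h = 1`
  have hskew : ∀ D : Derivation ℂ K K,
      (h.transpose * h.map D).transpose = - (h.transpose * h.map D) := fun D => by
    have h3 := map_derivation_mul D h.transpose h
    rw [hh, map_derivation_one, map_derivation_transpose] at h3
    rw [Matrix.transpose_mul, Matrix.transpose_transpose, eq_neg_iff_add_eq_zero, h3]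
  -- differentiate `h x₀ hᵀ`
  have hcomm : ∀ D : Derivation ℂ K K, (h * x₁ * h.transpose).map D = 0 →
      x₁ * (h.transpose * h.map D) - h.transpose * h.map D * x₁ = 0 := fun D hD => by
    have h3 := map_derivation_mul D (h * x₁) h.transpose
    rw [hD, map_derivation_mul, map_derivation_const, mul_zero, add_zero,
      map_derivation_transpose] at h3
    have h4 : h.transpose * (h.map D * x₁ * h.transpose + h * x₁ * (h.map D).transpose) * h =
      0 := by
      rw [← h3, mul_zero, zero_mul]
    have h5 : h.transpose * (h.map D * x₁ * h.transpose + h * x₁ * (h.map D).transpose) * h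
        = h.transpose * h.map D * x₁ * (h.transpose * h)
          + (h.transpose * h) * x₁ * ((h.map D).transpose * h) := by noncomm_ring
    have h6 : (h.map D).transpose * h = (h.transpose * h.map D).transpose := by
      rw [Matrix.transpose_mul, Matrix.transpose_transpose]
    rw [h5, hh, mul_one, one_mul, h6, hskew, mul_neg, ← sub_eq_add_neg] at h4
    rw [← neg_sub, h4, neg_zero]
  -- differentiate `h (1 + skewOf t) = 1 - skewOf t`, and use that `h + 1` is invertible
  have hinj : ∀ D : Derivation ℂ K K, h.transpose * h.map D = 0 → D = 0 := fun D hD => by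
    have h3 : h.map D = 0 := by rw [← one_mul (h.map D), ← hh', mul_assoc, hD, mul_zero]
    have h4 := congrArg (fun A : Matrix (Fin N) (Fin N) K => A.map D) hc
    have h5 : ∀ A A' : Matrix (Fin N) (Fin N) K, (A + A').map D = A.map D + A'.map D :=
      fun A A' => by ext; simp
    have h6 : ∀ A A' : Matrix (Fin N) (Fin N) K, (A - A').map D = A.map D - A'.map D :=
      fun A A' => by ext; simp
    simp only [map_derivation_mul, h3, zero_mul, zero_add, h5, h6, map_derivation_one, zero_sub]
      at h4
    have h7 : (h + 1) * (skewOf t).map D = 0 := by rw [add_mul, h4, one_mul, neg_add_cancel]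
    have h8 : (h + 1) * (1 + skewOf t) = (2 : K) • (1 : Matrix (Fin N) (Fin N) K) := by
      rw [add_mul, hc, one_mul, two_smul]
      abel
    have h9 : (1 + skewOf t) * ((2 : K)⁻¹ • (h + 1)) = 1 := by
      refine mul_eq_one_comm.mp ?_
      rw [smul_mul_assoc, h8, smul_smul, inv_mul_cancel₀ h2, one_smul]
    have h10 : (skewOf t).map D = 0 := by
      rw [← one_mul ((skewOf t).map D), ← h9, mul_assoc, smul_mul_assoc, h7, smul_zero, mul_zero]
    refine ht D fun ⟨⟨i, j⟩, hl⟩ => ?_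
    have h11 := congrFun (congrFun h10 i) j
    have hl' : j < i := hl
    simpa [skewOf, hl'] using h11
  have hmem : ∀ D : annihilatorDer fun q : Fin N × Fin N => (h * x₁ * h.transpose) q.1 q.2,
      (ρ ∘ₗ Submodule.subtype _) D ∈ skewSub (Fin N) K ⊓
        LinearMap.ker (adMatrix fun q : Fin N × Fin N => x₁ q.1 q.2).mulVecLin := by
    rintro ⟨D, hD⟩
    refine ⟨fun q => congrFun (congrFun (hskew D) q.1) q.2, ?_⟩
    change (adMatrix fun q : Fin N × Fin N => x₁ q.1 q.2).mulVec
      (fun q => (h.transpose * h.map D) q.1 q.2) = 0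
    rw [adMatrix_mulVec, hcomm D (Matrix.ext fun i j => hD (i, j))]
    rfl
  have hle := LinearMap.finrank_le_finrank_of_injective
    (f := (ρ ∘ₗ Submodule.subtype _).codRestrict _ hmem)
    ((injective_iff_map_eq_zero _).mpr fun D hD => Subtype.ext (hinj D.1 (Matrix.ext fun i j =>
      congrFun (congrArg Subtype.val hD) (i, j))))
  change finrank K (annihilatorDer fun q : Fin N × Fin N => (h * x₁ * h.transpose) q.1 q.2) + e ≤ _
  omega

end Cayley

section LowerBound

variable {N : ℕ}

/-- The rational function field in the entries of a skew-symmetric matrix, over which the Cayley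
transform of the generic skew-symmetric matrix exists. -/
theorem exists_generic_skew (N : ℕ) : ∃ (K : Type) (_ : Field K) (_ : Algebra ℂ K)
    (t : LowerIdx N → K), IsTranscendenceBasis ℂ t ∧ (1 + skewOf t).det ≠ 0 ∧
      ∀ D : Derivation ℂ K K, (∀ l, D (t l) = 0) → D = 0 := by
  let R := MvPolynomial (LowerIdx N) ℂ
  let K := FractionRing R
  let t : LowerIdx N → K := fun l => algebraMap R K (X l)
  have hRK : Function.Injective (algebraMap R K) := FaithfulSMul.algebraMap_injective R K
  have ht : ∀ p : R, aeval t p = algebraMap R K p := by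
    intro p
    have h : aeval t = ((Algebra.ofId R K).restrictScalars ℂ) := by
      ext i
      rw [aeval_X]
      rfl
    rw [h]
    rfl
  have := IsLocalization.isAlgebraic (R := R) (S := K) (nonZeroDivisors R)
  refine ⟨K, inferInstance, inferInstance, t,
    (IsTranscendenceBasis.mvPolynomial (LowerIdx N) ℂ).algebraMap_comp, ?_, fun D hD => ?_⟩
  · let Ξ : Matrix (Fin N) (Fin N) R := 1 + skewOf fun l => X l
    have h1 : ∀ {L : Type} [Field L] [Algebra ℂ L] (a : LowerIdx N → L),
        aeval a Ξ.det = (1 + skewOf a).det := by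
      intro L _ _ a
      rw [AlgHom.map_det]
      congr 1
      ext i j
      simp [Ξ, skewOf, Matrix.one_apply, apply_ite (aeval a : _ →ₐ[ℂ] L),
        apply_dite (aeval a : _ →ₐ[ℂ] L)]
    rw [← h1, ht]
    intro h2
    have h3 : Ξ.det = 0 := hRK (by rw [h2, map_zero])
    have h4 := h1 (0 : LowerIdx N → ℂ)
    have h5 : skewOf (0 : LowerIdx N → ℂ) = 0 := by ext; simp [skewOf]
    rw [h3, map_zero, h5, add_zero, Matrix.det_one] at h4
    exact zero_ne_one h4
  · ext z
    obtain ⟨p, q, hq, rfl⟩ := IsFractionRing.div_surjective (A := R) z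
    have hq' : algebraMap R K q ≠ 0 := IsFractionRing.to_map_ne_zero_of_mem_nonZeroDivisors hq
    have h1 := D.leibniz (algebraMap R K p / algebraMap R K q) (algebraMap R K q)
    rw [div_mul_cancel₀ _ hq', ← ht, ← ht, derivation_aeval_eq_zero hD,
      derivation_aeval_eq_zero hD, smul_zero, zero_add, smul_eq_mul, eq_comm, mul_eq_zero, ht,
      ht] at h1
    exact h1.resolve_left hq'

/-- The lower bound for the dimension of a set that contains all orthogonal conjugates of a
symmetric matrix `x₀`, in terms of the rank of the commutator map of `x₀`. The conjugates by Cayley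
transforms are the image of a morphism from an open set of skew-symmetric matrices, and the fibres
of this morphism are bounded infinitesimally. -/
theorem le_topologicalKrullDim_of_orthogonal_conj {x₀ : Matrix (Fin N) (Fin N) ℂ}
    (hx : x₀.transpose = x₀) {e : ℕ} (he : 2 * e ≤ (adMatrix fun q => x₀ q.1 q.2).rank)
    {T : Set (Zar (Fin N × Fin N → ℂ))}
    (hT : ∀ h : Matrix (Fin N) (Fin N) ℂ, h.transpose * h = 1 →
      (fun q => (h * x₀ * h.transpose) q.1 q.2) ∈ (T : Set (Fin N × Fin N → ℂ))) :
    (e : WithBot ℕ∞) ≤ topologicalKrullDim T := by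
  obtain ⟨K, _, _, t, ht, hdet, hD⟩ := exists_generic_skew N
  classical
  let d := (1 + skewOf t).det
  -- `A` is the coordinate ring of the skew-symmetric matrices with a Cayley transform
  let s : Finset K := insert d⁻¹ (Finset.univ.image t)
  let A : Subalgebra ℂ K := Algebra.adjoin ℂ (s : Set K)
  have hft : Algebra.FiniteType ℂ A := (Subalgebra.fg_iff_finiteType A).mp ⟨s, rfl⟩
  have htA : ∀ l, t l ∈ A := fun l => Algebra.subset_adjoin (by simp [s])
  have hdA : d⁻¹ ∈ A := Algebra.subset_adjoin (by simp [s])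
  let tA : LowerIdx N → A := fun l => ⟨t l, htA l⟩
  have hskew : (skewOf tA).map A.val = skewOf t := by
    ext i j
    simp only [skewOf, Matrix.map_apply, Matrix.of_apply, apply_dite A.val, map_neg, map_zero]
    rfl
  have hmap : (1 + skewOf tA).map A.val = 1 + skewOf t := by
    rw [Matrix.map_add _ (map_add A.val), hskew, Matrix.map_one _ (map_zero _) (map_one _)]
  have hunit : IsUnit (1 + skewOf tA).det := by
    refine IsUnit.of_mul_eq_one ⟨d⁻¹, hdA⟩ (Subtype.ext ?_)
    have h1 : ((1 + skewOf tA).det : K) = d := by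
      change A.val _ = _
      rw [AlgHom.map_det]
      exact congrArg Matrix.det hmap
    rw [MulMemClass.coe_mul, h1]
    exact mul_inv_cancel₀ hdet
  obtain ⟨h, hh, hc⟩ := cayley_orthogonal (skewOf_transpose tA) hunit
  have hval : ∀ {L : Type} [Field L] [Algebra ℂ L] (θ : A →ₐ[ℂ] L), (h.map θ).transpose * h.map θ =
    1 := by
    intro L _ _ θ
    rw [← Matrix.transpose_map, ← Matrix.map_mul, hh, Matrix.map_one _ (map_zero _) (map_one _)]
  let yA : Matrix (Fin N) (Fin N) A := h * x₀.map (algebraMap ℂ A) * h.transpose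
  have hy : ∀ {L : Type} [Field L] [Algebra ℂ L] (θ : A →ₐ[ℂ] L), yA.map θ
      = h.map θ * x₀.map (algebraMap ℂ L) * (h.map θ).transpose := by
    intro L _ _ θ
    rw [Matrix.map_mul, Matrix.map_mul, Matrix.map_map]
    congr 3
    funext c
    exact θ.commutes c
  let φ : MvPolynomial (Fin N × Fin N) ℂ →ₐ[ℂ] A := aeval fun q => yA q.1 q.2
  obtain ⟨g, hg, hgT⟩ := exists_forall_zeroLocus_ker_exists_algHom φ
  have hcK : h.map A.val * (1 + skewOf t) = 1 - skewOf t := by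
    have h1 := congrArg (fun M : Matrix (Fin N) (Fin N) A => M.map A.val) hc
    rw [← hmap]
    refine (Matrix.map_mul (f := A.val)).symm.trans (h1.trans ?_)
    rw [Matrix.map_sub _ (map_sub A.val), hskew, Matrix.map_one _ (map_zero _) (map_one _)]
  have hz := finrank_annihilatorDer_add_le hx he hD (hval A.val) hcK
  have key : ((Fintype.card (LowerIdx N) : ℕ) : WithBot ℕ∞)
      ≤ topologicalKrullDim T + ((Fintype.card (LowerIdx N) - e : ℕ) : WithBot ℕ∞) := by
    refine card_le_topologicalKrullDim_add (T := T) hg (fun v hv hgv => ?_)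
      (fun q => ((yA q.1 q.2 : A) : K)) (fun p => ?_) ht
      (annihilatorDer fun q : Fin N × Fin N => (h.map A.val * x₀.map (algebraMap ℂ K)
        * (h.map A.val).transpose) q.1 q.2) (fun D hD' q => ?_) (by omega)
    · obtain ⟨θ, hθ⟩ := hgT v hv hgv
      have h1 := hT _ (hval θ)
      have h2 : v = fun q => (h.map θ * x₀ * (h.map θ).transpose) q.1 q.2 := by
        funext q
        have h3 := congrFun (congrFun (hy θ) q.1) q.2
        rw [← hθ q, aeval_X]
        exact h3
      rw [h2]
      exact h1
    · have h1 : aeval (fun q : Fin N × Fin N => ((yA q.1 q.2 : A) : K)) = A.val.comp φ := by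
        ext q
        simp [φ]
      rw [h1, RingHom.mem_ker]
      exact ZeroMemClass.coe_eq_zero
    · rw [← hy A.val]
      exact hD' q
  have hle : e ≤ Fintype.card (LowerIdx N) := by omega
  generalize topologicalKrullDim T = m at key ⊢
  cases m using WithBot.recBotCoe with
  | bot => simp at key
  | coe m =>
    cases m using ENat.recTopCoe with
    | top => exact le_top
    | coe m =>
      have h1 : Fintype.card (LowerIdx N) ≤ m + (Fintype.card (LowerIdx N) - e) := by
        have h2 : ((Fintype.card (LowerIdx N) : ℕ∞) : WithBot ℕ∞)
            ≤ ((m + (Fintype.card (LowerIdx N) - e : ℕ) : ℕ∞) : WithBot ℕ∞) := key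
        exact_mod_cast WithBot.coe_le_coe.mp h2
      have h2 : e ≤ m := by omega
      exact_mod_cast h2

end LowerBound

/-! ### Commutants and adapted bases -/

section Commutant

variable {V : Type*} [AddCommGroup V] [Module ℂ V]

/-- The endomorphisms that commute with `x`. -/
def commutant (x : End ℂ V) : Submodule ℂ (End ℂ V) :=
  LinearMap.ker (LinearMap.mulLeft ℂ x - LinearMap.mulRight ℂ x)

theorem mem_commutant {x z : End ℂ V} : z ∈ commutant x ↔ ∀ v, x (z v) = z (x v) := by
  rw [commutant, LinearMap.mem_ker, LinearMap.sub_apply, sub_eq_zero]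
  exact LinearMap.ext_iff

theorem finrank_ker_pow [FiniteDimensional ℂ V] (x : End ℂ V) (k : ℕ) :
    finrank ℂ (LinearMap.ker (x ^ k)) = ∑ j ∈ Finset.range k, kerRank x j := by
  induction k with
  | zero =>
    rw [pow_zero, Finset.sum_range_zero, Module.End.one_eq_id, LinearMap.ker_id, finrank_bot]
  | succ k ih =>
    rw [Finset.sum_range_succ, ← ih]
    have h1 := LinearMap.finrank_range_add_finrank_ker (x ^ k)
    have h2 := LinearMap.finrank_range_add_finrank_ker (x ^ (k + 1))
    have h3 := finrank_range_pow x k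
    omega

/-- The endomorphism that takes the first vector of each Jordan string of `x` to a given vector
`w i`, and the other vectors of the string to the images of `w i` under powers of `x`. If
`x ^ (lam i)` kills `w i` it commutes with `x`. -/
noncomputable def ofTops {s : ℕ} {lam : Fin s → ℕ} (b : Basis (Σ i, Fin (lam i)) ℂ V)
    (x : End ℂ V) :
    (∀ i, LinearMap.ker (x ^ lam i)) →ₗ[ℂ] End ℂ V :=
  (b.constr ℂ).toLinearMap ∘ₗ LinearMap.pi fun q =>
    (x ^ (q.2 : ℕ)) ∘ₗ (LinearMap.ker (x ^ lam q.1)).subtype ∘ₗ LinearMap.proj q.1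

theorem ofTops_apply {s : ℕ} {lam : Fin s → ℕ} (b : Basis (Σ i, Fin (lam i)) ℂ V) (x : End ℂ V)
    (w : ∀ i, LinearMap.ker (x ^ lam i)) (q : Σ i, Fin (lam i)) :
    ofTops b x w (b q) = (x ^ (q.2 : ℕ)) (w q.1) :=
  b.constr_basis ℂ _ q

/-- An endomorphism that commutes with `x` is determined by the images of the first vectors of the
Jordan strings, and the image for a string of length `l` can be any vector of `ker x ^ l`. -/
theorem finrank_commutant [FiniteDimensional ℂ V] {s : ℕ} {x : End ℂ V} {lam : Fin s → ℕ}
    (hx : HasJordanType x lam) :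
    finrank ℂ (commutant x) = ∑ j ∈ Finset.range (finrank ℂ V), kerRank x j ^ 2 := by
  have hk := hx.kerRank_eq
  obtain ⟨b, hb⟩ := hx
  have hpow := pow_jordanBasis hb
  have hinj : Function.Injective (ofTops b x) := by
    refine (injective_iff_map_eq_zero _).mpr fun w hw => funext fun i => Subtype.ext ?_
    rcases Nat.eq_zero_or_pos (lam i) with h0 | h0
    · have := (w i).2
      have h1 : x ^ lam i = 1 := by rw [h0, pow_zero]
      exact (LinearMap.congr_fun h1 _).symm.trans this
    · have h1 := ofTops_apply b x w ⟨i, ⟨0, h0⟩⟩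
      rw [hw] at h1
      exact h1.symm
  have hrange : LinearMap.range (ofTops b x) = commutant x := by
    apply le_antisymm
    · rintro _ ⟨w, rfl⟩
      refine mem_commutant.mpr fun v => ?_
      have h1 : x ∘ₗ ofTops b x w = ofTops b x w ∘ₗ x := by
        refine b.ext fun ⟨i, a⟩ => ?_
        rw [LinearMap.comp_apply, LinearMap.comp_apply, ofTops_apply, hb,
          ← Module.End.mul_apply, ← pow_succ']
        split_ifs with h
        · rw [ofTops_apply]
        · have h2 : (a : ℕ) + 1 = lam i := by have := a.2; omega
          simp only [h2, map_zero]
          exact (w i).2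
      exact LinearMap.congr_fun h1 v
    · intro z hz
      have hzk : ∀ k v, (x ^ k) (z v) = z ((x ^ k) v) := by
        intro k
        induction k with
        | zero => intro v; rfl
        | succ k ih =>
          intro v
          rw [pow_succ, Module.End.mul_apply, Module.End.mul_apply, mem_commutant.mp hz, ih]
      let w : ∀ i, LinearMap.ker (x ^ lam i) := fun i =>
        if h0 : 0 < lam i then ⟨z (b ⟨i, ⟨0, h0⟩⟩), by
          rw [LinearMap.mem_ker, hzk, hpow, dif_neg (by simp), map_zero]⟩ else 0
      refine ⟨w, b.ext fun ⟨i, a⟩ => ?_⟩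
      have h0 : 0 < lam i := by have := a.2; omega
      rw [ofTops_apply]
      simp only [w, dif_pos h0]
      rw [hzk, hpow, dif_pos (by simp)]
      simp
  rw [← hrange, LinearMap.finrank_range_of_inj hinj, Module.finrank_pi_fintype]
  simp only [finrank_ker_pow]
  have hV : finrank ℂ V = ∑ i, lam i := by
    rw [finrank_eq_card_basis b, Fintype.card_sigma]
    simp
  have h3 : ∀ i, ∑ j ∈ Finset.range (lam i), kerRank x j
      = ∑ j ∈ Finset.range (finrank ℂ V), if j < lam i then kerRank x j else 0 := by
    intro i
    rw [← Finset.sum_filter]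
    refine Finset.sum_congr ?_ fun _ _ => rfl
    ext j
    have := Finset.single_le_sum (f := lam) (fun _ _ => Nat.zero_le _) (Finset.mem_univ i)
    rw [Finset.mem_range, Finset.mem_filter, Finset.mem_range]
    omega
  simp only [h3]
  rw [Finset.sum_comm]
  refine Finset.sum_congr rfl fun j _ => ?_
  rw [sq]
  conv_rhs => rw [hk j, Finset.sum_mul]
  refine Finset.sum_congr rfl fun i _ => ?_
  rw [hk j]
  split_ifs <;> simp

theorem rank_adMatrix_toMatrix [FiniteDimensional ℂ V] {N : ℕ} (b : Basis (Fin N) ℂ V)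
    (x : End ℂ V) : (adMatrix fun q : Fin N × Fin N => LinearMap.toMatrix b b x q.1 q.2).rank
      + finrank ℂ (commutant x) = N ^ 2 := by
  let A : Matrix (Fin N) (Fin N) ℂ := LinearMap.toMatrix b b x
  let e : End ℂ V ≃ₗ[ℂ] (Fin N × Fin N → ℂ) :=
    (LinearMap.toMatrix b b).trans (LinearEquiv.curry ℂ ℂ (Fin N) (Fin N)).symm
  have he : ∀ z, e z = fun q : Fin N × Fin N => LinearMap.toMatrix b b z q.1 q.2 := fun z => rfl
  have h1 : (commutant x).map e.toLinearMap
      = LinearMap.ker (adMatrix fun q : Fin N × Fin N => A q.1 q.2).mulVecLin := by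
    have key : ∀ z, e z ∈ LinearMap.ker (adMatrix fun q : Fin N × Fin N => A q.1 q.2).mulVecLin
        ↔ z ∈ commutant x := by
      intro z
      rw [LinearMap.mem_ker, Matrix.mulVecLin_apply, he, adMatrix_mulVec, ← LinearMap.toMatrix_mul,
        ← LinearMap.toMatrix_mul, ← map_sub, ← he, LinearEquiv.map_eq_zero_iff, sub_eq_zero,
        mem_commutant]
      exact LinearMap.ext_iff
    ext Y
    constructor
    · rintro ⟨z, hz, rfl⟩
      exact (key z).mpr hz
    · intro hY
      refine ⟨e.symm Y, (key _).mp ?_, e.apply_symm_apply Y⟩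
      rwa [e.apply_symm_apply]
  have h2 : finrank ℂ (commutant x)
      = finrank ℂ (LinearMap.ker (adMatrix fun q : Fin N × Fin N => A q.1 q.2).mulVecLin) := by
    rw [← h1]
    exact (LinearEquiv.finrank_eq (e.submoduleMap (commutant x)))
  rw [h2, Matrix.rank, LinearMap.finrank_range_add_finrank_ker, finrank_fintype_fun_eq_card,
    Fintype.card_prod, Fintype.card_fin, sq]

end Commutant

section Orthonormal

variable {V : Type*} [AddCommGroup V] [Module ℂ V] [FiniteDimensional ℂ V]

theorem exists_orthonormal_basis {N : ℕ} (hV : finrank ℂ V = N) {B : LinearMap.BilinForm ℂ V}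
    (hs : B.IsSymm) (hB : B.Nondegenerate) :
    ∃ b : Basis (Fin N) ℂ V, ∀ i j, B (b i) (b j) = if i = j then 1 else 0 := by
  subst hV
  obtain ⟨v, hv⟩ := LinearMap.BilinForm.exists_orthogonal_basis
    (LinearMap.BilinForm.isSymm_iff.mp hs)
  have h1 : ∀ i, B (v i) (v i) ≠ 0 := hv.not_isOrtho_basis_self_of_separatingLeft hB.1
  choose c hc using fun i => IsAlgClosed.exists_pow_nat_eq (B (v i) (v i)) (n := 2) two_pos
  have hc0 : ∀ i, c i ≠ 0 := fun i h => h1 i (by rw [← hc, h]; norm_num)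
  refine ⟨v.unitsSMul fun i => (Units.mk0 (c i) (hc0 i))⁻¹, fun i j => ?_⟩
  simp only [Basis.unitsSMul_apply]
  split_ifs with h
  · subst h
    simp only [Units.smul_def, map_smul, LinearMap.smul_apply, smul_eq_mul, ← hc,
      Units.val_inv_eq_inv_val, Units.val_mk0]
    have := hc0 i
    field_simp
  · have h2 : B (v i) (v j) = 0 := hv h
    simp [Units.smul_def, h2]

omit [FiniteDimensional ℂ V] in
theorem toMatrix_eq_of_orthonormal {N : ℕ} {B : LinearMap.BilinForm ℂ V} {b : Basis (Fin N) ℂ V}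
    (hb : ∀ i j, B (b i) (b j) = if i = j then 1 else 0) (x : End ℂ V) (i j : Fin N) :
    LinearMap.toMatrix b b x i j = B (x (b j)) (b i) := by
  have h : B (x (b j)) (b i) = ∑ k, b.repr (x (b j)) k * B (b k) (b i) := by
    nth_rewrite 1 [← b.sum_repr (x (b j))]
    simp only [map_sum, map_smul, LinearMap.sum_apply, LinearMap.smul_apply, smul_eq_mul]
  rw [LinearMap.toMatrix_apply, h]
  simp [hb]

omit [FiniteDimensional ℂ V] in
theorem selfAdjoint_iff_transpose {N : ℕ} {B : LinearMap.BilinForm ℂ V} (hs : B.IsSymm)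
    {b : Basis (Fin N) ℂ V} (hb : ∀ i j, B (b i) (b j) = if i = j then 1 else 0) (x : End ℂ V) :
    (∀ v w, B (x v) w = B v (x w)) ↔
      (LinearMap.toMatrix b b x).transpose = LinearMap.toMatrix b b x := by
  have h1 : ∀ i j, B (b j) (x (b i)) = LinearMap.toMatrix b b x j i := fun i j => by
    rw [toMatrix_eq_of_orthonormal hb]
    exact hs.eq _ _
  constructor
  · intro h
    ext i j
    rw [Matrix.transpose_apply, ← h1, ← h, ← toMatrix_eq_of_orthonormal hb]
  · intro h
    have h2 : B ∘ₗ x = B.compl₂ x := by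
      refine b.ext fun j => b.ext fun i => ?_
      rw [LinearMap.comp_apply, LinearMap.compl₂_apply, h1, ← toMatrix_eq_of_orthonormal hb]
      exact congrFun (congrFun h j) i
    exact fun v w => LinearMap.congr_fun₂ h2 v w

/-- Over `ℂ` all nondegenerate symmetric forms of the same dimension are equivalent, so there is a
basis whose Gram matrix is the antidiagonal one. -/
theorem exists_antidiagonal_basis {N : ℕ} (hV : finrank ℂ V = N) {B : LinearMap.BilinForm ℂ V}
    (hs : B.IsSymm) (hB : B.Nondegenerate) :
    ∃ f : Basis (Fin N) ℂ V, ∀ i j, B (f i) (f j) = if j = i.rev then 1 else 0 := by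
  let B₀ : LinearMap.BilinForm ℂ (Fin N → ℂ) :=
    Matrix.toBilin' (Matrix.of fun i j : Fin N => if j = i.rev then (1 : ℂ) else 0)
  have hB₀ : ∀ i j, B₀ (Pi.single i 1) (Pi.single j 1) = if j = i.rev then 1 else 0 := fun i j => by
    simp [B₀, Matrix.toBilin'_single]
  have hs₀ : B₀.IsSymm := by
    refine Matrix.isSymm_toBilin'_iff_isSymm.mpr (Matrix.ext fun i j => ?_)
    exact if_congr ⟨fun h => by rw [h, Fin.rev_rev], fun h => by rw [h, Fin.rev_rev]⟩ rfl rfl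
  have hn₀ : B₀.Nondegenerate := by
    have h1 : (Matrix.of fun i j : Fin N => if j = i.rev then (1 : ℂ) else 0)
        * (Matrix.of fun i j : Fin N => if j = i.rev then (1 : ℂ) else 0) = 1 := by
      ext i k
      rw [Matrix.mul_apply]
      simp only [Matrix.of_apply, mul_ite, mul_one, mul_zero, Matrix.one_apply]
      rw [Finset.sum_eq_single i.rev]
      · simp [eq_comm]
      · intro j _ hj
        simp [hj]
      · simp
    refine Matrix.Nondegenerate.toBilin' (Matrix.nondegenerate_of_det_ne_zero fun h => ?_)
    have h2 := congrArg Matrix.det h1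
    rw [Matrix.det_mul, h, zero_mul, Matrix.det_one] at h2
    exact zero_ne_one h2
  obtain ⟨b, hb⟩ := exists_orthonormal_basis hV hs hB
  obtain ⟨c, hc⟩ := exists_orthonormal_basis (finrank_fin_fun ℂ) hs₀ hn₀
  let u := c.equiv b (Equiv.refl _)
  have hu : ∀ v w, B (u v) (u w) = B₀ v w := by
    have h1 : (B.compl₂ u.toLinearMap) ∘ₗ u.toLinearMap = B₀ := by
      refine c.ext fun i => c.ext fun j => ?_
      simp [u, hb, hc]
    exact fun v w => LinearMap.congr_fun₂ h1 v w
  refine ⟨(Pi.basisFun ℂ (Fin N)).map u, fun i j => ?_⟩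
  rw [Basis.map_apply, Basis.map_apply, hu, Pi.basisFun_apply, Pi.basisFun_apply, hB₀]

end Orthonormal

/-! ### Dimensions of nilpotent orbits and the nilpotent cone -/

section Transfer

/-- Linear isomorphisms preserve dimensions. -/
theorem zariskiDim_eq_image {M M' : Type*} [AddCommGroup M] [Module ℂ M] [AddCommGroup M']
    [Module ℂ M'] (L : M ≃ₗ[ℂ] M') (S : Set M) :
    zariskiDim S = topologicalKrullDim (L '' S : Set (Zar M')) := by
  let h : Zar M ≃ₜ Zar M' :=
    { toEquiv := L.toEquiv
      continuous_toFun := (PolyMap.linear L.toLinearMap).continuous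
      continuous_invFun := (PolyMap.linear L.symm.toLinearMap).continuous }
  have key (S' : Set (Zar M)) : topologicalKrullDim S' = topologicalKrullDim (h '' S') :=
    IsHomeomorph.topologicalKrullDim_eq _ (h.image S').isHomeomorph
  exact key S

variable {V : Type*} [AddCommGroup V] [Module ℂ V] [FiniteDimensional ℂ V] {N : ℕ}
  {B : LinearMap.BilinForm ℂ V}

omit [FiniteDimensional ℂ V] in
theorem mem_nilpotentCone_iff {x : End ℂ V} :
    x ∈ nilpotentCone B ↔ (∀ v w, B (x v) w = B v (x w)) ∧ IsNilpotent x :=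
  ⟨fun h => ⟨h.1.2, h.2⟩, fun h =>
    ⟨⟨(LinearMap.isNilpotent_trace_of_isNilpotent h.2).eq_zero, h.1⟩, h.2⟩⟩

omit [FiniteDimensional ℂ V] in
theorem HasJordanType.conj {W : Type*} [AddCommGroup W] [Module ℂ W] (g : V ≃ₗ[ℂ] W) {s : ℕ}
    {x : End ℂ V} {y : End ℂ W} (hxy : ∀ v, y (g v) = g (x v)) {lam : Fin s → ℕ}
    (h : HasJordanType x lam) : HasJordanType y lam := by
  obtain ⟨b, hb⟩ := h
  refine ⟨b.map g, fun i a => ?_⟩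
  rw [Basis.map_apply, hxy, hb]
  split_ifs
  · rw [Basis.map_apply]
  · rw [map_zero]

/-- The matrix entries of an endomorphism with respect to the basis `b`, as coordinates on the space
of endomorphisms. -/
noncomputable def entries (b : Basis (Fin N) ℂ V) : End ℂ V ≃ₗ[ℂ] (Fin N × Fin N → ℂ) :=
  (LinearMap.toMatrix b b).trans (LinearEquiv.curry ℂ ℂ (Fin N) (Fin N)).symm

omit [FiniteDimensional ℂ V] in
theorem entries_apply (b : Basis (Fin N) ℂ V) (x : End ℂ V) (q : Fin N × Fin N) :
    entries b x q = LinearMap.toMatrix b b x q.1 q.2 := rfl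

variable (hs : B.IsSymm) {b : Basis (Fin N) ℂ V}
  (hb : ∀ i j, B (b i) (b j) = if i = j then 1 else 0)
include hs hb

/-- The upper bound for the dimension of a set of self-adjoint nilpotent endomorphisms, which are
symmetric matrices in an orthonormal basis. -/
theorem zariskiDim_le_of_rank_le {S : Set (End ℂ V)} (hS : S ⊆ nilpotentCone B) {e : ℕ}
    (he : ∀ x ∈ S, (adMatrix (entries b x)).rank ≤ 2 * e) : zariskiDim S ≤ e := by
  rw [zariskiDim_eq_image (entries b)]
  refine topologicalKrullDim_le_of_rank_adMatrix_le (M := finrank ℂ V) ?_ ?_ ?_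
  · rintro _ ⟨x, hx, rfl⟩ q
    exact congrFun (congrFun ((selfAdjoint_iff_transpose hs hb x).mp (hS hx).1.2) q.1) q.2
  · rintro _ ⟨x, hx, rfl⟩
    change LinearMap.toMatrix b b x ^ _ = 0
    have h1 : LinearMap.toMatrix b b x ^ finrank ℂ V = LinearMap.toMatrix b b (x ^ finrank ℂ V) :=
      (map_pow (LinearMap.toMatrixAlgEquiv b) x _).symm
    rw [h1, pow_finrank_eq_zero (hS hx).2 le_rfl, map_zero]
  · rintro _ ⟨x, hx, rfl⟩
    exact he x hx

omit [FiniteDimensional ℂ V] in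
/-- The lower bound for the dimension of a set that contains the orthogonal conjugates of `x`. It is
enough to ask this for all self-adjoint conjugates of `x`. -/
theorem le_zariskiDim_of_le_rank {S : Set (End ℂ V)} {x : End ℂ V} (hx : x ∈ nilpotentCone B)
    (hS : ∀ (g : V ≃ₗ[ℂ] V) (y : End ℂ V), (∀ v, y (g v) = g (x v)) → y ∈ nilpotentCone B → y ∈ S)
    {e : ℕ} (he : 2 * e ≤ (adMatrix (entries b x)).rank) : (e : WithBot ℕ∞) ≤ zariskiDim S := by
  have hsym := (selfAdjoint_iff_transpose hs hb x).mp hx.1.2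
  rw [zariskiDim_eq_image (entries b)]
  refine le_topologicalKrullDim_of_orthogonal_conj hsym he fun h hh => ?_
  have hh' : h * h.transpose = 1 := mul_eq_one_comm.mp hh
  let g : V ≃ₗ[ℂ] V := LinearEquiv.ofLinearMap (Matrix.toLin b b h) (Matrix.toLin b b h.transpose)
    (by rw [← Matrix.toLin_mul, hh', Matrix.toLin_one])
    (by rw [← Matrix.toLin_mul, hh, Matrix.toLin_one])
  let y : End ℂ V := Matrix.toLin b b (h * LinearMap.toMatrix b b x * h.transpose)
  have hy : LinearMap.toMatrix b b y = h * LinearMap.toMatrix b b x * h.transpose :=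
    LinearMap.toMatrix_toLin b b _
  have hyg : ∀ v, y (g v) = g (x v) := fun v => by
    have h1 : y ∘ₗ g.toLinearMap = g.toLinearMap ∘ₗ x := by
      apply (LinearMap.toMatrix b b).injective
      rw [LinearMap.toMatrix_comp b b b, LinearMap.toMatrix_comp b b b, hy]
      change _ * LinearMap.toMatrix b b (Matrix.toLin b b h)
        = LinearMap.toMatrix b b (Matrix.toLin b b h) * _
      rw [LinearMap.toMatrix_toLin, mul_assoc, hh, mul_one]
    exact LinearMap.congr_fun h1 v
  refine ⟨y, hS g y hyg (mem_nilpotentCone_iff.mpr ⟨?_, ?_⟩), ?_⟩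
  · rw [selfAdjoint_iff_transpose hs hb, hy, Matrix.transpose_mul, Matrix.transpose_mul,
      Matrix.transpose_transpose, hsym, mul_assoc]
  · obtain ⟨k, hk⟩ := hx.2
    refine ⟨k, LinearMap.ext fun v => ?_⟩
    have h1 : ∀ k v, (y ^ k) (g v) = g ((x ^ k) v) := by
      intro k
      induction k with
      | zero => intro v; rfl
      | succ k ih =>
        intro v
        rw [pow_succ, Module.End.mul_apply, hyg, ih, pow_succ, Module.End.mul_apply]
    rw [← g.apply_symm_apply v, h1, hk, LinearMap.zero_apply, map_zero, LinearMap.zero_apply]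
  · funext q
    rw [entries_apply, hy]

omit [FiniteDimensional ℂ V] in
theorem rank_adMatrix_entries_le {x : End ℂ V} (hx : x ∈ nilpotentCone B) :
    (adMatrix (entries b x)).rank ≤ 2 * Fintype.card (LowerIdx N) := by
  rw [rank_adMatrix_eq (fun q => congrFun (congrFun
    ((selfAdjoint_iff_transpose hs hb x).mp hx.1.2) q.1) q.2) two_ne_zero,
    ← finrank_skewSub (N := N) (two_ne_zero (α := ℂ))]
  exact Nat.mul_le_mul_left 2 (Submodule.finrank_map_le _ _)

omit hs hb in
theorem rank_adMatrix_entries (hV : finrank ℂ V = N) (b : Basis (Fin N) ℂ V) {s : ℕ} {x : End ℂ V}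
    {lam : Fin s → ℕ} (hx : HasJordanType x lam) :
    (adMatrix (entries b x)).rank + 2 * pairCount x = 2 * Fintype.card (LowerIdx N) := by
  have h1 := rank_adMatrix_toMatrix b x
  rw [finrank_commutant hx] at h1
  have h2 := finrank_ker_pow x (finrank ℂ V)
  rw [pow_finrank_eq_zero (isNilpotent_of_hasJordanType hx) le_rfl, LinearMap.ker_zero,
    finrank_top] at h2
  have h3 : 2 * pairCount x + ∑ j ∈ Finset.range (finrank ℂ V), kerRank x j
      = ∑ j ∈ Finset.range (finrank ℂ V), kerRank x j ^ 2 := by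
    rw [pairCount, Finset.mul_sum, ← Finset.sum_add_distrib]
    refine Finset.sum_congr rfl fun j _ => ?_
    rw [Nat.choose_two_right, Nat.mul_div_cancel' (Nat.even_mul_pred_self _).two_dvd]
    cases kerRank x j with
    | zero => rfl
    | succ k => rw [Nat.add_sub_cancel]; ring
  have h4 := two_mul_card_lowerIdx_add N
  have h5 : adMatrix (entries b x)
      = adMatrix fun q : Fin N × Fin N => LinearMap.toMatrix b b x q.1 q.2 := rfl
  rw [h5]
  omega

end Transfer

section Dimensions

variable {V : Type*} [AddCommGroup V] [Module ℂ V] [FiniteDimensional ℂ V] {N : ℕ}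
  (hV : finrank ℂ V = N) {B : LinearMap.BilinForm ℂ V} (hs : B.IsSymm) (hB : B.Nondegenerate)
include hV hs hB

/-- The shift of a basis with antidiagonal Gram matrix is self-adjoint, and has a single Jordan
block. -/
theorem exists_regular_nilpotent : ∃ x ∈ nilpotentCone B, HasJordanType x fun _ : Fin 1 => N := by
  obtain ⟨f, hf⟩ := exists_antidiagonal_basis hV hs hB
  let x : End ℂ V := f.constr ℂ fun i => if h : (i : ℕ) + 1 < N then f ⟨i + 1, h⟩ else 0
  have hx : ∀ i, x (f i) = if h : (i : ℕ) + 1 < N then f ⟨i + 1, h⟩ else 0 := fun i =>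
    f.constr_basis ℂ _ i
  have hJ : HasJordanType x fun _ : Fin 1 => N := by
    refine ⟨f.reindex (Equiv.uniqueSigma fun _ : Fin 1 => Fin N).symm, fun i a => ?_⟩
    have h1 : ∀ (i : Fin 1) (a : Fin N),
        f.reindex (Equiv.uniqueSigma fun _ : Fin 1 => Fin N).symm ⟨i, a⟩ = f a := fun i a => by
      rw [Basis.reindex_apply]
      obtain rfl := Subsingleton.elim i 0
      rfl
    rw [h1, hx]
    split_ifs
    · rw [h1]
    · rfl
  refine ⟨x, mem_nilpotentCone_iff.mpr ⟨?_, isNilpotent_of_hasJordanType hJ⟩, hJ⟩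
  have h2 : B ∘ₗ x = B.compl₂ x := by
    refine f.ext fun i => f.ext fun j => ?_
    rw [LinearMap.comp_apply, LinearMap.compl₂_apply, hx, hx]
    split_ifs with h h' h'
    · rw [hf, hf]
      refine if_congr ?_ rfl rfl
      rw [Fin.ext_iff, Fin.ext_iff, Fin.val_rev, Fin.val_rev]
      simp only
      omega
    · rw [hf, map_zero, if_neg]
      rw [Fin.ext_iff, Fin.val_rev]
      simp only
      omega
    · rw [hf, map_zero, LinearMap.zero_apply, if_neg]
      rw [Fin.ext_iff, Fin.val_rev]
      simp only
      omega
    · rw [map_zero, map_zero, LinearMap.zero_apply]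
  exact fun v w => LinearMap.congr_fun₂ h2 v w

/-- The dimension of the nilpotent cone is that of the orthogonal group: the regular nilpotent
element has a dense orbit, and its commutant contains no skew-adjoint endomorphisms. -/
theorem zariskiDim_nilpotentCone : zariskiDim (nilpotentCone B) = Fintype.card (LowerIdx N) := by
  obtain ⟨b, hb⟩ := exists_orthonormal_basis hV hs hB
  apply le_antisymm
  · exact zariskiDim_le_of_rank_le hs hb le_rfl fun x hx => rank_adMatrix_entries_le hs hb hx
  · obtain ⟨x, hx, hJ⟩ := exists_regular_nilpotent hV hs hB
    refine le_zariskiDim_of_le_rank hs hb hx (fun g y _ hy => hy) ?_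
    have h1 := rank_adMatrix_entries hV b hJ
    have h2 : pairCount x = 0 := by
      refine Finset.sum_eq_zero fun j _ => ?_
      rw [hJ.kerRank_eq, Fin.sum_univ_one]
      split_ifs <;> rfl
    omega

/-- The codimension of the orbit of `x` in the nilpotent cone is `pairCount x`. -/
theorem exists_zariskiDim_nilpotentOrbit {s : ℕ} {lam : Fin s → ℕ} {x : End ℂ V}
    (hx : x ∈ nilpotentOrbit B lam) : ∃ e : ℕ, zariskiDim (nilpotentOrbit B lam) = e ∧
      e + pairCount x = Fintype.card (LowerIdx N) := by
  obtain ⟨b, hb⟩ := exists_orthonormal_basis hV hs hB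
  have h1 := rank_adMatrix_entries hV b hx.2
  refine ⟨Fintype.card (LowerIdx N) - pairCount x, le_antisymm ?_ ?_, by omega⟩
  · refine zariskiDim_le_of_rank_le hs hb (fun y hy => hy.1) fun y hy => ?_
    have h2 := rank_adMatrix_entries hV b hy.2
    have h3 : pairCount y = pairCount x := by
      simp only [pairCount, hx.2.kerRank_eq, hy.2.kerRank_eq]
    omega
  · exact le_zariskiDim_of_le_rank (S := nilpotentOrbit B lam) hs hb hx.1
      (fun g y hg hy => ⟨hy, hx.2.conj g hg⟩) (by omega)

end Dimensions

end SymSpringer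

open Module SymSpringer in
theorem proposition3p2 {V : Type*} [AddCommGroup V] [Module ℂ V] [FiniteDimensional ℂ V]
    (n : ℕ) (hV : finrank ℂ V = 2 * n + 1)
    (Q : QuadraticForm ℂ V) (B : LinearMap.BilinForm ℂ V)
    (hBQ : B = QuadraticMap.associated Q) (hB : B.Nondegenerate)
    (s : ℕ) (p : Fin (s + 1) → ℕ) (hp : Antitone p) (hsum : ∑ i, p i = n)
    (x : End ℂ V) (hx : x ∈ nilpotentOrbit B (doubledPartition p))
    (x' : End ℂ (Fin n → ℂ)) (hx' : HasJordanType x' p) :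
    topologicalKrullDim (resolutionFiber (2 * n + 1) B x)
        + topologicalKrullDim (resolutionFiber (2 * n + 1) B x)
        + zariskiDim (nilpotentOrbit B (doubledPartition p))
      = zariskiDim (nilpotentCone B) ∧
    IsIsomorphic (topComponentsUnion (resolutionFiber (2 * n + 1) B x)) (springerFiber n x') := by
  have hs : B.IsSymm := ⟨fun v w => by
    rw [hBQ]
    exact QuadraticMap.associated_isSymm ℂ Q v w⟩
  have hlam : ∀ i, 2 * p i ≤ doubledPartition p i := fun i => by
    rw [doubledPartition]
    split_ifs <;> omega
  obtain ⟨ι, hinj, hxι, hι⟩ := exists_embedding hlam hx.2 hx'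
  have hd := pairCount_eq_two_mul hV hp hx.2 hx'
  obtain ⟨h1, h2⟩ := fiber_dimension_and_components hV hB hs hinj hx.1
    (isNilpotent_of_hasJordanType hx') hxι
    (range_eq_coreSpace hV hs hB hx.1.1.2 hinj hι) hd (isDoubled_kerRank hp hx.2 hx')
  refine ⟨?_, h2⟩
  obtain ⟨e, he, hesum⟩ := exists_zariskiDim_nilpotentOrbit hV hs hB hx
  rw [h1, he, zariskiDim_nilpotentCone hV hs hB]
  have h3 : pairCount x' + pairCount x' + e = Fintype.card (LowerIdx (2 * n + 1)) := by omega
  exact_mod_cast h3
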